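/- Let $q,z\in\mathbb C$ with $0<|q|<1$ and $z\neq 0$. Write $(a;q)_n=\prod_{j=0}^{n-1}(1-aq^j)$, $(a;q)_\infty=\prod_{j\ge 0}(1-aq^j)$, $(a_1,\dots,a_k;q)_n=(a_1;q)_n\cdots(a_k;q)_n$ for $0\le n\le\infty$, and $c_j(z)=(1-z^j)(1-z^{j-1})z^{1-j}$. Define $$F(\rho_1,\rho_2,z;q)=\frac{(q;q)_\infty}{(z,z^{-1},\rho_1,\rho_2;q)_\infty}\sum_{n\ge1}\frac{(z,z^{-1},\rho_1,\rho_2;q)_n}{(q;q)_{2n}}\Big(\frac{q}{\rho_1\rho_2}\Big)^n,$$ $$G(\rho_1,\rho_2,z;q)=\frac{(q;q)_\infty}{(z,z^{-1},\rho_1,\rho_2;q)_\infty}\sum_{n\ge1}\frac{(z,z^{-1},\rho_1,\rho_2;q)_n}{(q;q)_{2n}}\Big(\frac{q^2}{\rho_1\rho_2}\Big)^n,$$ $$F(\rho,z;q)=\frac{(q;q)_\infty}{(\rho,z,z^{-1};q)_\infty}\sum_{n\ge1}\frac{(z,z^{-1},\rho;q)_n(-1)^nq^{n(n+1)/2}\rho^{-n}}{(q;q)_{2n}},$$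 $$G(\rho,z;q)=\frac{(q;q)_\infty}{(\rho,z,z^{-1};q)_\infty}\sum_{n\ge1}\frac{(z,z^{-1},\rho;q)_n(-1)^nq^{n(n+3)/2}\rho^{-n}}{(q;q)_{2n}},$$ $$S_{L7}(z;q)=\frac{(-q;q)_\infty}{(z,z^{-1};q^2)_\infty}\sum_{n\ge1}\frac{(z,z^{-1};q^2)_nq^{2n}}{(-q;q)_{2n}},\qquad S_{L9}(z;q)=\frac{(q;q^2)_\infty}{(z,z^{-1};q)_\infty}\sum_{n\ge1}\frac{(z,z^{-1};q)_nq^{n}}{(q;q^2)_{n}},$$ $$S_{L12}(z;q)=\frac{(-q;q^2)_\infty^2}{(z,z^{-1};q^2)_\infty}\sum_{n\ge1}\frac{(z,z^{-1};q^2)_nq^{2n}}{(-q;q^2)_{n}(-q;q^2)_{n+1}},$$ $$S_{G2}(z,q)=\frac{(q;q)_\infty}{(z,z^{-1};q)_\infty(-q;q^2)_\infty}\sum_{n\ge1}\frac{(z,z^{-1};q)_n(-q;q^2)_nq^n}{(q;q)_{2n}}=G(iq^{1/2},-iq^{1/2},z;q),$$ $$S_{G1}(z,q)=G(q,q^2,z;q^2),\qquad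 S_{F1}(z,q)=F(-q,z;q),\qquad S_{G3}(z,q)=G(q,z;q).$$ Call $z$ *$p$-generic* if $z\ne p^k$ for all $k\in\mathbb Z$, and $\rho$ *admissible* if $\rho q^k\neq1$ for all integers $k\ge0$. Under the conditions stated below, all the series (both those in the definitions and those on the right-hand sides) converge absolutely. The following identities hold. If $z$ is $q^2$-generic and $z\ne-1$: $$S_{L7}(z;q)=\frac{1}{(1+z)(q^2,z,z^{-1};q^2)_\infty}\sum_{j\ge1}\sum_{n\ge0}c_j(z)(-1)^{j+1}(1+q^{2j-1})q^{j(j-1)+\frac{n(n-1)}2+2jn},$$ $$S_{L12}(z;q)=\frac{1}{(1+z)(q^2,z,z^{-1};q^2)_\infty}\sum_{j\ge1}\sum_{n\ge0}c_j(z)(-1)^{j+1}(1+q^{2j-1})q^{j(j-1)+n^2+2jn},$$ $$S_{G1}(z,q)=\frac{1}{(1+z)(z,z^{-1},q;q^2)_\infty}\sum_{j\ge1}c_j(z)(-1)^{j+1}(1+q^{2j-1})q^{(j-1)^2}.$$ If $z$ is $q$-generic and $z\ne-1$: $$S_{L9}(z;q)=\frac{1}{(1+z)(q,z,z^{-1};q)_\infty}\sum_{j\ge1}\sum_{n\ge0}c_j(z)(-1)^{j+n+1}(1-q^{2j-1})q^{\frac{j(j-1)}2+n^2+2jn},$$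 $$S_{G2}(z,q)=\frac{1}{(1+z)(z,z^{-1},q;q)_\infty}\sum_{j=-\infty}^\infty\frac{c_j(z)(-1)^{j+1}q^{\frac{j(j-1)}2}}{1+q^{2j-1}},$$ $$S_{F1}(z,q)=\frac{1}{(1+z)(z,z^{-1};q)_\infty}\sum_{j=-\infty}^\infty c_j(z)(-1)^{j+1}q^{j^2-3j+2}(1+q^{j-1}),$$ $$S_{G3}(z,q)=\frac{1}{(1+z)(z,z^{-1};q)_\infty}\sum_{j\ge1}c_j(z)(1-q^{2j-1})q^{(j-1)^2}.$$ If $z$ is $q$-generic (with $z=-1$ allowed): $$S_{F1}(z,q)=\frac{(z^{-1}q^2,zq^2,q^2;q^2)_\infty}{(zq,z^{-1}q;q)_\infty}+\frac{(z^{-1}q,zq,q^2;q^2)_\infty}{(z,z^{-1};q)_\infty}-\frac{(q,q,q^2;q^2)_\infty}{(z,z^{-1};q)_\infty}.$$ If $z$ is $q$-generic, $z\neq-1$, $\rho_1,\rho_2$ are admissible and $|q|<|\rho_1\rho_2|$: $$F(\rho_1,\rho_2,z;q)=\sum_{j\ge1}\frac{c_j(z)(-1)^{j+1}q^{\frac{j(j-1)}2}(\rho_1,\rho_2;q)_{j-1}\big(\tfrac{q^{j+1}}{\rho_1},\tfrac{q^{j+1}}{\rho_2};q\big)_\infty}{(1+z)\rho_1^{j-1}\rho_2^{j-1}\big(z,z^{-1},\rho_1,\rho_2,\tfrac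 q{\rho_1\rho_2};q\big)_\infty}\Big(1-\tfrac{q^j}{\rho_1}-\tfrac{q^j}{\rho_2}+\tfrac{q^{3j-1}}{\rho_1}+\tfrac{q^{3j-1}}{\rho_2}-q^{4j-2}\Big).$$ If $z$ is $q$-generic, $z\neq-1$, $\rho_1,\rho_2$ are admissible and $|q^2|<|\rho_1\rho_2|$: $$G(\rho_1,\rho_2,z;q)=\sum_{j\ge1}\frac{c_j(z)(-1)^{j+1}(1-q^{2j-1})q^{\frac{j(j+1)}2-1}(\rho_1,\rho_2;q)_{j-1}\big(\tfrac{q^{j+1}}{\rho_1},\tfrac{q^{j+1}}{\rho_2};q\big)_\infty}{(1+z)\rho_1^{j-1}\rho_2^{j-1}\big(z,z^{-1},\rho_1,\rho_2,\tfrac{q^2}{\rho_1\rho_2};q\big)_\infty}.$$ If $z$ is $q$-generic and $\rho\ne0$ is admissible, then, as $\rho_2\to\infty$ through admissible values, $(\rho_2;q)_\infty F(\rho,\rho_2,z;q)\to F(\rho,z;q)$ and $(\rho_2;q)_\infty G(\rho,\rho_2,z;q)\to G(\rho,z;q)$; and if moreover $z\ne-1$, $$F(\rho,z;q)=\sum_{j\ge1}\frac{c_j(z)q^{(j-1)^2}(\rho;q)_{j-1}\big(\tfrac{q^{j+1}}\rho;q\big)_\infty}{(1+z)\rho^{j-1}(z,z^{-1},\rho;q)_\infty}\Big(1-\tfrac{q^j}\rho+\tfrac{q^{3j-1}}\rho-q^{4j-2}\Big),$$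 $$G(\rho,z;q)=\sum_{j\ge1}\frac{c_j(z)(1-q^{2j-1})q^{j(j-1)}(\rho;q)_{j-1}\big(\tfrac{q^{j+1}}\rho;q\big)_\infty}{(1+z)\rho^{j-1}(z,z^{-1},\rho;q)_\infty}.$$ -/

import Mathlib

open Filter Topology

noncomputable section

namespace SptCrank

/-- The finite `q`-shifted factorial `(z; q)_n = ∏_{j=0}^{n-1} (1 - z q^j)`. -/
def qPoch (z q : ℂ) (n : ℕ) : ℂ := ∏ j ∈ Finset.range n, (1 - z * q ^ j)

/-- The infinite product `(z; q)_∞ = ∏_{j=0}^∞ (1 - z q^j)`. -/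
def qPochInf (z q : ℂ) : ℂ := ∏' j : ℕ, (1 - z * q ^ j)

/-- The `n`-th term of the series in `F(ρ₁, ρ₂, z; q)`. -/
def termF (ρ₁ ρ₂ z q : ℂ) (n : ℕ) : ℂ :=
  qPoch z q n * qPoch z⁻¹ q n * qPoch ρ₁ q n * qPoch ρ₂ q n * (q / (ρ₁ * ρ₂)) ^ n
    / qPoch q q (2 * n)

/-- The function `F(ρ₁, ρ₂, z; q)`. -/
def genF (ρ₁ ρ₂ z q : ℂ) : ℂ :=
  qPochInf q q / (qPochInf z q * qPochInf z⁻¹ q * qPochInf ρ₁ q * qPochInf ρ₂ q)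
    * ∑' n : ℕ+, termF ρ₁ ρ₂ z q n

/-- The `n`-th term of the series in `G(ρ₁, ρ₂, z; q)`. -/
def termG (ρ₁ ρ₂ z q : ℂ) (n : ℕ) : ℂ :=
  qPoch z q n * qPoch z⁻¹ q n * qPoch ρ₁ q n * qPoch ρ₂ q n * (q ^ 2 / (ρ₁ * ρ₂)) ^ n
    / qPoch q q (2 * n)

/-- The function `G(ρ₁, ρ₂, z; q)`. -/
def genG (ρ₁ ρ₂ z q : ℂ) : ℂ :=
  qPochInf q q / (qPochInf z q * qPochInf z⁻¹ q * qPochInf ρ₁ q * qPochInf ρ₂ q)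
    * ∑' n : ℕ+, termG ρ₁ ρ₂ z q n

/-- The `n`-th term of the series in `F(ρ, z; q)`. -/
def termFInf (ρ z q : ℂ) (n : ℕ) : ℂ :=
  qPoch z q n * qPoch z⁻¹ q n * qPoch ρ q n * ((-1) ^ n * q ^ (n * (n + 1) / 2) * ρ⁻¹ ^ n)
    / qPoch q q (2 * n)

/-- The function `F(ρ, z; q)`, the limit of `(ρ₂; q)_∞ F(ρ, ρ₂, z; q)` as `ρ₂ → ∞`. -/
def genFInf (ρ z q : ℂ) : ℂ :=
  qPochInf q q / (qPochInf ρ q * qPochInf z q * qPochInf z⁻¹ q)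
    * ∑' n : ℕ+, termFInf ρ z q n

/-- The `n`-th term of the series in `G(ρ, z; q)`. -/
def termGInf (ρ z q : ℂ) (n : ℕ) : ℂ :=
  qPoch z q n * qPoch z⁻¹ q n * qPoch ρ q n * ((-1) ^ n * q ^ (n * (n + 3) / 2) * ρ⁻¹ ^ n)
    / qPoch q q (2 * n)

/-- The function `G(ρ, z; q)`, the limit of `(ρ₂; q)_∞ G(ρ, ρ₂, z; q)` as `ρ₂ → ∞`. -/
def genGInf (ρ z q : ℂ) : ℂ :=
  qPochInf q q / (qPochInf ρ q * qPochInf z q * qPochInf z⁻¹ q)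
    * ∑' n : ℕ+, termGInf ρ z q n

/-- `S_{G1}(z, q) = G(q, q², z; q²)`. -/
def sG1 (z q : ℂ) : ℂ := genG q (q ^ 2) z (q ^ 2)

/-- The `n`-th term of the series in `S_{G2}(z, q)`. -/
def termG2 (z q : ℂ) (n : ℕ) : ℂ :=
  qPoch z q n * qPoch z⁻¹ q n * qPoch (-q) (q ^ 2) n * q ^ n / qPoch q q (2 * n)

/-- The function `S_{G2}(z, q)`; it equals `G(i q^{1/2}, -i q^{1/2}, z; q)` for either
square root of `q`, see `genG_eq_sG2`. -/
def sG2 (z q : ℂ) : ℂ :=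
  qPochInf q q / (qPochInf z q * qPochInf z⁻¹ q * qPochInf (-q) (q ^ 2))
    * ∑' n : ℕ+, termG2 z q n

/-- `S_{F1}(z, q) = F(-q, z; q)`. -/
def sF1 (z q : ℂ) : ℂ := genFInf (-q) z q

/-- `S_{G3}(z, q) = G(q, z; q)`. -/
def sG3 (z q : ℂ) : ℂ := genGInf q z q

/-- The `n`-th term of the series in `S_{L7}(z; q)`. -/
def termL7 (z q : ℂ) (n : ℕ) : ℂ :=
  qPoch z (q ^ 2) n * qPoch z⁻¹ (q ^ 2) n * q ^ (2 * n) / qPoch (-q) q (2 * n)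

/-- The function `S_{L7}(z; q)`. -/
def sL7 (z q : ℂ) : ℂ :=
  qPochInf (-q) q / (qPochInf z (q ^ 2) * qPochInf z⁻¹ (q ^ 2)) * ∑' n : ℕ+, termL7 z q n

/-- The `n`-th term of the series in `S_{L9}(z; q)`. -/
def termL9 (z q : ℂ) (n : ℕ) : ℂ :=
  qPoch z q n * qPoch z⁻¹ q n * q ^ n / qPoch q (q ^ 2) n

/-- The function `S_{L9}(z; q)`. -/
def sL9 (z q : ℂ) : ℂ :=
  qPochInf q (q ^ 2) / (qPochInf z q * qPochInf z⁻¹ q) * ∑' n : ℕ+, termL9 z q n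

/-- The `n`-th term of the series in `S_{L12}(z; q)`. -/
def termL12 (z q : ℂ) (n : ℕ) : ℂ :=
  qPoch z (q ^ 2) n * qPoch z⁻¹ (q ^ 2) n * q ^ (2 * n)
    / (qPoch (-q) (q ^ 2) n * qPoch (-q) (q ^ 2) (n + 1))

/-- The function `S_{L12}(z; q)`. -/
def sL12 (z q : ℂ) : ℂ :=
  qPochInf (-q) (q ^ 2) ^ 2 / (qPochInf z (q ^ 2) * qPochInf z⁻¹ (q ^ 2))
    * ∑' n : ℕ+, termL12 z q n

/-- The common factor `(1 - z^j)(1 - z^{j-1}) z^{1-j}`. -/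
def zFactor (z : ℂ) (j : ℤ) : ℂ := (1 - z ^ j) * (1 - z ^ (j - 1)) * z ^ (1 - j)

/-- The infinite products converge for `|q| < 1`. -/
theorem multipliable_qPochInf (z q : ℂ) (hq : ‖q‖ < 1) :
    Multipliable fun j : ℕ => 1 - z * q ^ j := by
  have h : Summable fun j : ℕ => ‖-(z * q ^ j)‖ := by
    simpa using (summable_geometric_of_lt_one (norm_nonneg q) hq).mul_left ‖z‖
  simpa [sub_eq_add_neg] using multipliable_one_add_of_summable h

/-- `S_{G2}(z, q) = G(i q^{1/2}, -i q^{1/2}, z; q)`. -/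
theorem genG_eq_sG2 (z q s : ℂ) (hq0 : q ≠ 0) (hq : ‖q‖ < 1) (hs : s ^ 2 = q) :
    genG (Complex.I * s) (-(Complex.I * s)) z q = sG2 z q := by
  have key : ∀ j : ℕ, (1 - Complex.I * s * q ^ j) * (1 - -(Complex.I * s) * q ^ j)
      = 1 - -q * (q ^ 2) ^ j := by
    intro j
    have : Complex.I ^ 2 = -1 := Complex.I_sq
    rw [← pow_mul, mul_comm 2 j, pow_mul]
    linear_combination (-(s ^ 2 * (q ^ j) ^ 2)) * this + (q ^ j) ^ 2 * hs
  have hfin : ∀ n, qPoch (Complex.I * s) q n * qPoch (-(Complex.I * s)) q n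
      = qPoch (-q) (q ^ 2) n := by
    intro n
    simp only [qPoch, ← Finset.prod_mul_distrib, key]
  have hinf : qPochInf (Complex.I * s) q * qPochInf (-(Complex.I * s)) q
      = qPochInf (-q) (q ^ 2) := by
    simp only [qPochInf]
    rw [← Multipliable.tprod_mul (multipliable_qPochInf _ _ hq) (multipliable_qPochInf _ _ hq)]
    simp only [key]
  have hr : q ^ 2 / (Complex.I * s * -(Complex.I * s)) = q := by
    have : Complex.I * s * -(Complex.I * s) = q := by
      linear_combination (-(s ^ 2)) * Complex.I_sq + hs
    rw [this]; field_simp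
  have ht : ∀ n, termG (Complex.I * s) (-(Complex.I * s)) z q n = termG2 z q n := by
    intro n
    simp only [termG, termG2, hr, ← hfin]
    ring
  simp only [genG, sG2, ht, ← hinf, mul_assoc]

end SptCrank

end

open SptCrank

namespace SptCrank

/-! All the expansions are instances of Bailey's lemma for a single Bailey pair relative to `q`.
With kernel `1/((q;q)_{n-i} (q;q)_{n+i+1})`, the sequence `α_i = (-1)^i q^{i(i-1)/2} c_{i+1}(z)`,
weighted by `1 - q^{2i+1}`, has `β_n = (1+z)(z, z⁻¹; q)_n / (q;q)_{2n}` for `n ≥ 1`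
(`sum_baileyAlpha`). This comes from the finite Jacobi triple product (`sum_finite_triple_product`),
a form of the `q`-binomial theorem, taken at `z`, `z⁻¹` and `1` with weights `1`, `z`, `-(1+z)`; the
product at `1` vanishes. Given a summable `δ`, interchanging a double sum turns `∑ β_n δ_n` into `∑
α_i γ_i` (`hasSum_bailey`), so each identity reduces to evaluating `γ_i`.

For `F` and `G` the sequence `γ` is given by the `q`-Gauss sum. It is written in `u = 1/ρ₁`, `v =
1/ρ₂`, since `(ρ;q)_n ρ^{-n} = ∏_{j<n} (u - q^j)` is polynomial in `u`; the limit `ρ₂ → ∞` is then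
the value `v = 0`. For `G` the sum applies directly, while for `F` two consecutive values are
combined, which produces the six-term factor. `S_{G1}`, `S_{G2}`, `S_{G3}` and `S_{F1}` are
specialisations in which the infinite products collapse.

For `S_{L7}`, `S_{L9}` and `S_{L12}` the sequence `γ` is a partial or false theta series in `n`. It
satisfies a first-order affine recurrence in `i`, found by telescoping (`conjugateSum_recurrence`).
The theta series satisfies the same one, and a bounded solution is unique because the recurrence
contracts.

The product formula for `S_{F1}` compares its unilateral series with a combination of infinite
triple products in base `q²` (`hasSum_thetaNumerator`). Both carry a factor `1 + z`, so `z = -1` is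
reached by continuity. -/

/-! ### Shifted factorials: limits, bounds, non-vanishing and continuity. -/

theorem qPoch_zero (z q : ℂ) : qPoch z q 0 = 1 := by simp [qPoch]

theorem qPoch_succ (z q : ℂ) (n : ℕ) : qPoch z q (n + 1) = qPoch z q n * (1 - z * q ^ n) := by
  simp [qPoch, Finset.prod_range_succ]

theorem qPoch_add (z q : ℂ) (m n : ℕ) :
    qPoch z q (m + n) = qPoch z q m * qPoch (z * q ^ m) q n := by
  simp only [qPoch, Finset.prod_range_add, pow_add, mul_assoc]

theorem qPoch_succ' (z q : ℂ) (n : ℕ) : qPoch z q (n + 1) = (1 - z) * qPoch (z * q) q n := by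
  rw [add_comm, qPoch_add]; simp [qPoch]

theorem tendsto_qPoch (z : ℂ) {q : ℂ} (hq : ‖q‖ < 1) :
    Tendsto (qPoch z q) atTop (𝓝 (qPochInf z q)) :=
  (multipliable_qPochInf z q hq).hasProd.tendsto_prod_nat

theorem qPochInf_eq_mul (z : ℂ) {q : ℂ} (hq : ‖q‖ < 1) (n : ℕ) :
    qPochInf z q = qPoch z q n * qPochInf (z * q ^ n) q := by
  refine tendsto_nhds_unique ((tendsto_qPoch z hq).comp (tendsto_add_atTop_nat n)) ?_
  refine ((tendsto_qPoch (z * q ^ n) hq).const_mul (qPoch z q n)).congr fun m => ?_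
  simp only [Function.comp]
  rw [add_comm, qPoch_add]

theorem qPoch_ne_zero {z q : ℂ} (h : ∀ k : ℕ, z * q ^ k ≠ 1) (n : ℕ) : qPoch z q n ≠ 0 :=
  Finset.prod_ne_zero_iff.2 fun k _ => sub_ne_zero.2 (h k).symm

theorem summable_norm_mul_pow (z : ℂ) {q : ℂ} (hq : ‖q‖ < 1) :
    Summable fun j : ℕ => ‖-(z * q ^ j)‖ := by
  simpa using (summable_geometric_of_lt_one (norm_nonneg q) hq).mul_left ‖z‖

theorem qPochInf_ne_zero {z q : ℂ} (hq : ‖q‖ < 1) (h : ∀ k : ℕ, z * q ^ k ≠ 1) :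
    qPochInf z q ≠ 0 := by
  have := tprod_one_add_ne_zero_of_summable (f := fun j : ℕ => -(z * q ^ j))
    (fun k => by rw [← sub_eq_add_neg]; exact sub_ne_zero.2 (h k).symm) (summable_norm_mul_pow z hq)
  simpa [qPochInf, sub_eq_add_neg] using this

theorem norm_qPoch_le (z : ℂ) {q : ℂ} (hq : ‖q‖ < 1) (n : ℕ) :
    ‖qPoch z q n‖ ≤ Real.exp (‖z‖ / (1 - ‖q‖)) := by
  calc ‖qPoch z q n‖ = ∏ j ∈ Finset.range n, ‖1 - z * q ^ j‖ := by rw [qPoch, norm_prod]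
    _ ≤ ∏ j ∈ Finset.range n, Real.exp (‖z‖ * ‖q‖ ^ j) := by
        refine Finset.prod_le_prod (fun _ _ => norm_nonneg _) fun j _ => ?_
        calc ‖1 - z * q ^ j‖ ≤ ‖(1 : ℂ)‖ + ‖z * q ^ j‖ := norm_sub_le _ _
          _ = ‖z‖ * ‖q‖ ^ j + 1 := by simp [add_comm]
          _ ≤ _ := Real.add_one_le_exp _
    _ = Real.exp (∑ j ∈ Finset.range n, ‖z‖ * ‖q‖ ^ j) := (Real.exp_sum _ _).symm
    _ ≤ _ := by
        rw [Real.exp_le_exp, ← Finset.mul_sum, div_eq_mul_inv]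
        refine mul_le_mul_of_nonneg_left ?_ (norm_nonneg z)
        rw [← tsum_geometric_of_lt_one (norm_nonneg q) hq]
        exact (summable_geometric_of_lt_one (norm_nonneg q) hq).sum_le_tsum _
          fun _ _ => by positivity

/-- The limit product is nonzero, so the inverses converge and are therefore bounded. -/
theorem exists_norm_inv_qPoch_le {z q : ℂ} (hq : ‖q‖ < 1) (h : ∀ k : ℕ, z * q ^ k ≠ 1) :
    ∃ B : ℝ, 0 < B ∧ ∀ n, ‖(qPoch z q n)⁻¹‖ ≤ B := by
  obtain ⟨B, hB⟩ := (Metric.isBounded_range_of_tendsto _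
    ((tendsto_qPoch z hq).inv₀ (qPochInf_ne_zero hq h))).exists_norm_le
  exact ⟨max B 1, by positivity, fun n => (hB _ ⟨n, rfl⟩).trans (le_max_left _ _)⟩

theorem pow_mul_pow_ne_one {q : ℂ} (hq : ‖q‖ < 1) {m : ℕ} (hm : m ≠ 0) (k : ℕ) :
    q ^ m * q ^ k ≠ 1 := by
  intro h
  have h1 : ‖q ^ (m + k)‖ = 1 := by rw [pow_add, h, norm_one]
  rw [norm_pow] at h1
  exact (pow_lt_one₀ (norm_nonneg q) hq (by omega)).ne h1

theorem self_mul_pow_ne_one {q : ℂ} (hq : ‖q‖ < 1) (k : ℕ) : q * q ^ k ≠ 1 := by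
  simpa using pow_mul_pow_ne_one hq one_ne_zero k

theorem qPoch_self_ne_zero {q : ℂ} (hq : ‖q‖ < 1) (n : ℕ) : qPoch q q n ≠ 0 :=
  qPoch_ne_zero (self_mul_pow_ne_one hq) n

theorem qPochInf_self_ne_zero {q : ℂ} (hq : ‖q‖ < 1) : qPochInf q q ≠ 0 :=
  qPochInf_ne_zero hq (self_mul_pow_ne_one hq)

theorem mul_pow_ne_one_of_norm_lt {z q : ℂ} (hz : ‖z‖ < 1) (hq : ‖q‖ < 1) (k : ℕ) :
    z * q ^ k ≠ 1 := by
  intro h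
  have h1 : ‖z * q ^ k‖ = 1 := by rw [h, norm_one]
  rw [norm_mul, norm_pow] at h1
  have := mul_le_of_le_one_right (norm_nonneg z) (pow_le_one₀ (norm_nonneg q) hq.le (n := k))
  linarith

theorem continuous_qPoch (q : ℂ) (n : ℕ) : Continuous fun z => qPoch z q n := by
  unfold qPoch; fun_prop

/-- Dominated convergence on a neighbourhood of `z`, with majorant `(‖z‖ + 1) ‖q‖^j`. It serves the
passage to `z = -1` in the product formula for `S_{F1}`. -/
theorem continuous_qPochInf {q : ℂ} (hq : ‖q‖ < 1) : Continuous fun z => qPochInf z q := by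
  refine continuous_iff_continuousAt.2 fun z => ?_
  have hb : Summable fun j : ℕ => (‖z‖ + 1) * ‖q‖ ^ j :=
    (summable_geometric_of_lt_one (norm_nonneg q) hq).mul_left _
  have := tendsto_tprod_one_add_of_dominated_convergence (𝓕 := 𝓝 z)
    (f := fun w (j : ℕ) => -(w * q ^ j)) (g := fun j : ℕ => -(z * q ^ j)) hb
    (fun j => Continuous.tendsto (f := fun w : ℂ => -(w * q ^ j)) (by fun_prop) z) ?_
  · simpa [ContinuousAt, qPochInf, sub_eq_add_neg] using this
  · have h1 : ∀ᶠ w in 𝓝 z, ‖w‖ < ‖z‖ + 1 :=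
      continuous_norm.continuousAt.eventually_lt continuousAt_const (by simp)
    filter_upwards [h1] with w hw j
    rw [norm_neg, norm_mul, norm_pow]
    gcongr

/-! ### Telescoping sums and contracting recurrences. -/

theorem hasSum_of_eq {ι : Type*} {f g : ι → ℂ} {a b : ℂ} (h : HasSum f a) (hf : ∀ k, g k = f k)
    (ha : b = a) : HasSum g b :=
  ha ▸ h.congr_fun hf

theorem hasSum_of_telescope {f U : ℕ → ℂ} {a : ℂ} (hf : Summable f)
    (h : ∀ k, f k = U (k + 1) - U k) (hU : Tendsto U atTop (𝓝 a)) : HasSum f (a - U 0) := by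
  have h1 := hf.hasSum.tendsto_sum_nat
  simp only [h, Finset.sum_range_sub] at h1
  have := tendsto_nhds_unique h1 (hU.sub_const (U 0))
  rw [← this]
  simpa only [← h] using hf.hasSum

/-- Iterating `m` times gives `‖d i‖ ≤ s^m B`, and `m` is arbitrary. -/
theorem eq_zero_of_contracting {d r : ℕ → ℂ} {B s : ℝ} (hd : ∀ i, d i = r i * d (i + 1))
    (hr : ∀ i, ‖r i‖ ≤ s) (hs : s < 1) (hB : ∀ i, ‖d i‖ ≤ B) (i : ℕ) : d i = 0 := by
  have hs0 : 0 ≤ s := (norm_nonneg _).trans (hr 0)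
  have key : ∀ m i, ‖d i‖ ≤ s ^ m * B := by
    intro m
    induction m with
    | zero => simpa using hB
    | succ m ih =>
      intro i
      rw [hd, norm_mul, pow_succ', mul_assoc]
      exact mul_le_mul (hr i) (ih _) (norm_nonneg _) hs0
  have := ge_of_tendsto' ((tendsto_pow_atTop_nhds_zero_of_lt_one hs0 hs).mul_const B)
    fun m => key m i
  rw [zero_mul] at this
  exact norm_le_zero_iff.1 this

/-! ### The `q`-binomial theorem and the finite triple product. -/

theorem triangle_succ (n : ℕ) : (n + 1) * (n + 1 - 1) / 2 = n * (n - 1) / 2 + n :=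
  Nat.triangle_succ n

theorem two_mul_triangle (n : ℕ) : 2 * (n * (n - 1) / 2) + n = n * n := by
  induction n with
  | zero => rfl
  | succ n ih => rw [triangle_succ]; nlinarith

/-- The `q`-binomial theorem. -/
theorem sum_qBinomial {q : ℂ} (hq : ‖q‖ < 1) (x : ℂ) (N : ℕ) :
    ∑ k ∈ Finset.range (N + 1), (-1) ^ k * q ^ (k * (k - 1) / 2) * x ^ k
      * (qPoch q q k * qPoch q q (N - k))⁻¹ = qPoch x q N / qPoch q q N := by
  induction N with
  | zero => simp [qPoch]
  | succ N ih =>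
    have hP := qPoch_self_ne_zero hq
    have h1 (k : ℕ) : 1 - q * q ^ k ≠ 0 := sub_ne_zero.2 (self_mul_pow_ne_one hq k).symm
    -- Pascal-type recursion: `1 - q^{N+1} = (1 - q^{N+1-k}) + q^{N+1-k}(1 - q^k)`. The first piece
    -- removes the last factor of `(q;q)_{N+1-k}`, the second that of `(q;q)_k`. After shifting `k`
    -- the second contributes `-x q^N` times the sum for `N`.
    have key : (1 - q * q ^ N) * ∑ k ∈ Finset.range (N + 1 + 1), (-1) ^ k * q ^ (k * (k - 1) / 2)
        * x ^ k * (qPoch q q k * qPoch q q (N + 1 - k))⁻¹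
        = (1 - x * q ^ N) * ∑ k ∈ Finset.range (N + 1), (-1) ^ k * q ^ (k * (k - 1) / 2) * x ^ k
          * (qPoch q q k * qPoch q q (N - k))⁻¹ := by
      have hsplit : ∀ k ∈ Finset.range (N + 1 + 1),
          (1 - q * q ^ N) * ((-1) ^ k * q ^ (k * (k - 1) / 2)
            * x ^ k * (qPoch q q k * qPoch q q (N + 1 - k))⁻¹)
          = (-1) ^ k * q ^ (k * (k - 1) / 2) * x ^ k * (1 - q ^ (N + 1 - k))
              * (qPoch q q k * qPoch q q (N + 1 - k))⁻¹
            + (-1) ^ k * q ^ (k * (k - 1) / 2) * x ^ k * (q ^ (N + 1 - k) * (1 - q ^ k))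
              * (qPoch q q k * qPoch q q (N + 1 - k))⁻¹ := by
        intro k hk
        have : q * q ^ N = q ^ (N + 1 - k) * q ^ k := by
          rw [← pow_add, Nat.sub_add_cancel (Finset.mem_range_succ_iff.1 hk), pow_succ']
        rw [this]; ring
      rw [Finset.mul_sum, Finset.sum_congr rfl hsplit, Finset.sum_add_distrib,
        Finset.sum_range_succ, Finset.sum_range_succ' (n := N + 1)]
      simp only [Nat.sub_self, pow_zero, sub_self, mul_zero, zero_mul, add_zero]
      rw [Finset.mul_sum, ← Finset.sum_add_distrib]
      refine Finset.sum_congr rfl fun k hk => ?_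
      obtain ⟨m, rfl⟩ := Nat.exists_eq_add_of_le (Finset.mem_range_succ_iff.1 hk)
      rw [triangle_succ, show k + m + 1 - k = m + 1 by omega,
        show k + m + 1 - (k + 1) = m by omega, show k + m - k = m by omega,
        qPoch_succ, qPoch_succ]
      have := hP k; have := hP m; have := h1 k; have := h1 m
      field_simp
      ring
    rw [ih] at key
    rw [qPoch_succ, qPoch_succ]
    refine mul_left_cancel₀ (h1 N) (key.trans ?_)
    rw [mul_div_assoc', mul_div_assoc', mul_comm (1 - x * q ^ N), mul_comm (qPoch q q N),
      mul_div_mul_left _ _ (h1 N)]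

/-- `1 / ((q; q)_{n-i} (q; q)_{n+i+1})`, understood as `0` when `n < i`. -/
noncomputable def baileyKernel (q : ℂ) (i n : ℕ) : ℂ :=
  if i ≤ n then (qPoch q q (n - i) * qPoch q q (n + i + 1))⁻¹ else 0

theorem baileyKernel_of_lt (q : ℂ) {i n : ℕ} (h : n < i) : baileyKernel q i n = 0 :=
  if_neg h.not_ge

theorem baileyKernel_add (q : ℂ) (i k : ℕ) :
    baileyKernel q i (i + k) = (qPoch q q k * qPoch q q (2 * i + 1 + k))⁻¹ := by
  rw [baileyKernel, if_pos (Nat.le_add_right i k), Nat.add_sub_cancel_left]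
  congr 3; omega

/-- Reversal of the product: `-z q^{-m}` is pulled out of each factor `1 - z q^{-m}`, `1 ≤ m ≤ n`.
-/
theorem qPoch_div_pow {z q : ℂ} (hq0 : q ≠ 0) (hz : z ≠ 0) (n : ℕ) :
    qPoch (z / q ^ n) q n * q ^ ((n + 1) * (n + 1 - 1) / 2) = (-z) ^ n * qPoch (q / z) q n := by
  induction n with
  | zero => simp [qPoch]
  | succ n ih =>
    rw [qPoch_succ', triangle_succ, pow_add _ _ (n + 1), qPoch_succ (q / z),
      show z / q ^ (n + 1) * q = z / q ^ n by field_simp; ring]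
    calc _ = (qPoch (z / q ^ n) q n * q ^ ((n + 1) * (n + 1 - 1) / 2))
          * ((1 - z / q ^ (n + 1)) * q ^ (n + 1)) := by ring
      _ = _ := by rw [ih]; field_simp; ring

/-- The finite form of the Jacobi triple product identity. -/
theorem sum_finite_triple_product {z q : ℂ} (hq0 : q ≠ 0) (hq : ‖q‖ < 1) (hz : z ≠ 0) (n : ℕ) :
    ∑ i ∈ Finset.range (n + 1), (-1) ^ i * (q ^ (i * (i - 1) / 2) * z ^ (i + 1)
      - q ^ ((i + 2) * (i + 1) / 2) * z⁻¹ ^ i) * baileyKernel q i n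
      = z * qPoch z q n * qPoch (q / z) q (n + 1) / qPoch q q (2 * n + 1) := by
  -- The argument `z/q^{n+1}` centres the `2n+2` terms: `(z/q^{n+1};q)_{2n+1} = (z/q^{n+1};q)_{n+1}
  -- (z;q)_n`. The indices `k = n-i` and `k = n+1+i` share the denominator
  -- `(q;q)_{n-i}(q;q)_{n+i+1}`, so they are paired by reflecting the first half.
  have hb := sum_qBinomial hq (z / q ^ (n + 1)) (2 * n + 1)
  rw [show 2 * n + 1 = (n + 1) + n by ring, qPoch_add,
    show z / q ^ (n + 1) * q ^ (n + 1) = z by field_simp,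
    show n + 1 + n + 1 = (n + 1) + (n + 1) by ring, Finset.sum_range_add,
    ← Finset.sum_range_reflect, ← Finset.sum_add_distrib] at hb
  have hd := qPoch_div_pow hq0 hz (n + 1)
  have hC : (-1 : ℂ) ^ (n + 1) * q ^ ((n + 2) * (n + 2 - 1) / 2) * z⁻¹ ^ n ≠ 0 := by
    simp [hq0, hz]
  have hrhs : z * qPoch z q n * qPoch (q / z) q (n + 1) / qPoch q q (2 * n + 1)
      = ((-1 : ℂ) ^ (n + 1) * q ^ ((n + 2) * (n + 2 - 1) / 2) * z⁻¹ ^ n)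
        * (qPoch (z / q ^ (n + 1)) q (n + 1) * qPoch z q n / qPoch q q (n + 1 + n)) := by
    have : ((-1 : ℂ) ^ (n + 1) * q ^ ((n + 2) * (n + 2 - 1) / 2) * z⁻¹ ^ n)
        * qPoch (z / q ^ (n + 1)) q (n + 1) = z * qPoch (q / z) q (n + 1) := by
      rw [show (-1 : ℂ) ^ (n + 1) * q ^ ((n + 2) * (n + 2 - 1) / 2) * z⁻¹ ^ n
        * qPoch (z / q ^ (n + 1)) q (n + 1) = (-1 : ℂ) ^ (n + 1) * z⁻¹ ^ n *
          (qPoch (z / q ^ (n + 1)) q (n + 1) * q ^ ((n + 2) * (n + 2 - 1) / 2)) by ring, hd,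
        neg_pow z, inv_pow]
      have : ((-1 : ℂ) ^ (n + 1)) ^ 2 = 1 := by rw [← pow_mul, mul_comm, pow_mul]; simp
      field_simp
      rw [this]; ring
    rw [show 2 * n + 1 = n + 1 + n by ring, ← mul_div_assoc, ← mul_assoc, this]
    ring
  rw [hrhs, ← hb, Finset.mul_sum]
  refine Finset.sum_congr rfl fun i hi => ?_
  obtain ⟨m, rfl⟩ := Nat.exists_eq_add_of_le (Finset.mem_range_succ_iff.1 hi)
  rw [baileyKernel_add, show i + m + 1 - 1 - i = m by omega,
    show i + m + 1 + (i + m) - m = 2 * i + 1 + m by omega,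
    show i + m + 1 + (i + m) - (i + m + 1 + i) = m by omega,
    show i + m + 1 + i = 2 * i + 1 + m by omega,
    mul_comm (qPoch q q (2 * i + 1 + m))]
  -- The halved exponents become atoms, tied together only by `2·(n(n-1)/2) + n = n²`.
  have t1 := two_mul_triangle m
  have t2 := two_mul_triangle (i + m + 2)
  have t3 : 2 * ((i + 2) * (i + 1) / 2) + (i + 2) = (i + 2) * (i + 2) := two_mul_triangle (i + 2)
  have t4 := two_mul_triangle i
  have t5 := two_mul_triangle (2 * i + 1 + m)
  generalize m * (m - 1) / 2 = a1 at *
  generalize (i + m + 2) * (i + m + 2 - 1) / 2 = a2 at *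
  generalize (i + 2) * (i + 1) / 2 = a3 at *
  generalize i * (i - 1) / 2 = a4 at *
  generalize (2 * i + 1 + m) * (2 * i + 1 + m - 1) / 2 = a5 at *
  have p1 : q ^ a1 * q ^ a2 = (q ^ (i + m + 1)) ^ m * q ^ a3 := by
    rw [← pow_add, ← pow_mul, ← pow_add]; congr 1; nlinarith
  have p2 : q ^ a5 * q ^ a2 = (q ^ (i + m + 1)) ^ (2 * i + 1 + m) * q ^ a4 := by
    rw [← pow_add, ← pow_mul, ← pow_add]; congr 1; nlinarith
  have hs : ((-1 : ℂ) ^ m) ^ 2 = 1 := by rw [← pow_mul, mul_comm, pow_mul]; simp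
  have hs' : ((-1 : ℂ) ^ i) ^ 2 = 1 := by rw [← pow_mul, mul_comm, pow_mul]; simp
  have hQ : q ^ (i + m + 1) ≠ 0 := pow_ne_zero _ hq0
  have e1 : (-1 : ℂ) ^ (i + m + 1) * q ^ a2 * z⁻¹ ^ (i + m)
      * ((-1) ^ m * q ^ a1 * (z / q ^ (i + m + 1)) ^ m) = -(-1) ^ i * q ^ a3 * z⁻¹ ^ i := by
    generalize q ^ (i + m + 1) = Q at *
    rw [div_pow, pow_add, pow_add, pow_add z⁻¹, inv_pow, inv_pow]
    field_simp
    rw [hs]; linear_combination -p1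
  have e2 : (-1 : ℂ) ^ (i + m + 1) * q ^ a2 * z⁻¹ ^ (i + m)
      * ((-1) ^ (2 * i + 1 + m) * q ^ a5 * (z / q ^ (i + m + 1)) ^ (2 * i + 1 + m))
      = (-1) ^ i * q ^ a4 * z ^ (i + 1) := by
    generalize q ^ (i + m + 1) = Q at *
    rw [show (-1 : ℂ) ^ (i + m + 1) * q ^ a2 * z⁻¹ ^ (i + m)
      * ((-1) ^ (2 * i + 1 + m) * q ^ a5 * (z / Q) ^ (2 * i + 1 + m)) =
      ((-1 : ℂ) ^ (i + m + 1) * (-1) ^ (2 * i + 1 + m)) * (q ^ a5 * q ^ a2) * z⁻¹ ^ (i + m)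
      * (z / Q) ^ (2 * i + 1 + m) by ring, p2, div_pow]
    rw [show (-1 : ℂ) ^ (i + m + 1) * (-1) ^ (2 * i + 1 + m)
      = (-1) ^ i * ((-1) ^ i) ^ 2 * ((-1) ^ m) ^ 2 by ring, hs, hs',
      show 2 * i + 1 + m = (i + 1) + (i + m) by ring, inv_pow]
    field_simp
    ring
  linear_combination (-(qPoch q q m * qPoch q q (2 * i + 1 + m))⁻¹) * (e1 + e2)

/-! ### The Bailey pair. -/

theorem zFactor_add_one {z : ℂ} (hz : z ≠ 0) (i : ℕ) :
    zFactor z ((i : ℤ) + 1) = z ^ (i + 1) + z⁻¹ ^ i - (1 + z) := by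
  have h1 : z ^ ((i : ℤ) + 1) = z ^ i * z := by rw [zpow_add_one₀ hz, zpow_natCast]
  have h2 : (1 : ℤ) - ((i : ℤ) + 1) = -i := by ring
  rw [zFactor, h1, add_sub_cancel_right, h2, zpow_neg, zpow_natCast, inv_pow]
  field_simp
  ring

/-- The weights `1`, `z`, `-(1+z)` make the coefficients of `q^a` and of `-q^b` both equal to
`z^{i+1} + z^{-i} - (1+z)`, which is `c_{i+1}(z)`. -/
theorem sum_triple_product_zFactor (q : ℂ) {z : ℂ} (hz : z ≠ 0) (a b i : ℕ) :
    (q ^ a * z ^ (i + 1) - q ^ b * z⁻¹ ^ i) + z * (q ^ a * z⁻¹ ^ (i + 1) - q ^ b * z⁻¹⁻¹ ^ i)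
      - (1 + z) * (q ^ a * 1 ^ (i + 1) - q ^ b * (1 : ℂ)⁻¹ ^ i)
      = (q ^ a - q ^ b) * zFactor z ((i : ℤ) + 1) := by
  rw [zFactor_add_one hz, inv_inv, inv_one, one_pow, one_pow, pow_succ z⁻¹]
  field_simp
  ring

/-- The `α`-part of the Bailey pair with `β_n = (1 + z) (z, z⁻¹; q)_n / (q; q)_{2n}`. -/
noncomputable def baileyAlpha (z q : ℂ) (i : ℕ) : ℂ :=
  (-1) ^ i * q ^ (i * (i - 1) / 2) * zFactor z ((i : ℤ) + 1)

/-- The vanishing of `c_1(z)` removes the `n = 0` contribution, so that Bailey's lemma yields a sum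
over `n ≥ 1`. -/
theorem baileyAlpha_zero (z q : ℂ) : baileyAlpha z q 0 = 0 := by
  simp [baileyAlpha, zFactor]

/-- In the combination of the three finite triple products the one at `1` is zero for `n ≥ 1`. The
relation `(1-x)(xq;q)_n = (x;q)_n(1-xq^n)` turns the other two into multiples of `(z,
z⁻¹;q)_n/(1-z)`. Their bracket `(1-zq^n)(1-zq^{n+1}) - (z-q^n)(z-q^{n+1})` equals
`(1-z²)(1-q^{2n+1})`; the last factor reduces `(q;q)_{2n+1}` to `(q;q)_{2n}`. -/
theorem sum_baileyAlpha {z q : ℂ} (hq0 : q ≠ 0) (hq : ‖q‖ < 1) (hz : z ≠ 0) {n : ℕ} (hn : n ≠ 0) :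
    ∑ i ∈ Finset.range (n + 1), baileyAlpha z q i * ((1 - q ^ (2 * i + 1)) * baileyKernel q i n)
      = (1 + z) * (qPoch z q n * qPoch z⁻¹ q n / qPoch q q (2 * n)) := by
  have h1 := sum_finite_triple_product hq0 hq hz n
  have h2 := sum_finite_triple_product hq0 hq (inv_ne_zero hz) n
  have h3 := sum_finite_triple_product hq0 hq one_ne_zero n
  have h0 : qPoch 1 q n = 0 := by
    obtain ⟨m, rfl⟩ := Nat.exists_eq_succ_of_ne_zero hn
    rw [Nat.succ_eq_add_one, qPoch_succ']; simp
  rw [h0, mul_zero, zero_mul, zero_div] at h3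
  have hexp (i : ℕ) : (i + 2) * (i + 1) / 2 = i * (i - 1) / 2 + (2 * i + 1) := by
    have h4 : (i + 2) * (i + 1) / 2 = _ := triangle_succ (i + 1)
    rw [h4, triangle_succ]; ring
  have hsum : ∑ i ∈ Finset.range (n + 1),
      baileyAlpha z q i * ((1 - q ^ (2 * i + 1)) * baileyKernel q i n)
      = z * qPoch z q n * qPoch (q / z) q (n + 1) / qPoch q q (2 * n + 1)
        + z * (z⁻¹ * qPoch z⁻¹ q n * qPoch (q / z⁻¹) q (n + 1) / qPoch q q (2 * n + 1)) := by
    rw [← h1, ← h2, ← sub_zero (_ + z * _), ← mul_zero (1 + z), ← h3, Finset.mul_sum,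
      Finset.mul_sum, ← Finset.sum_add_distrib, ← Finset.sum_sub_distrib]
    refine Finset.sum_congr rfl fun i _ => ?_
    have := sum_triple_product_zFactor q hz (i * (i - 1) / 2) ((i + 2) * (i + 1) / 2) i
    rw [baileyAlpha]
    rw [hexp, pow_add] at *
    linear_combination (-(-1) ^ i * baileyKernel q i n) * this
  have hz1 (x : ℂ) (hx : x ≠ 0) : qPoch x q n * (1 - x * q ^ n) = (1 - x) * qPoch (q / x⁻¹) q n := by
    rw [← qPoch_succ, qPoch_succ', div_inv_eq_mul, mul_comm q]
  rw [hsum, qPoch_succ q q (2 * n), qPoch_succ (q / z), qPoch_succ (q / z⁻¹)]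
  have e1 := hz1 z hz
  have e2 := hz1 z⁻¹ (inv_ne_zero hz)
  rw [inv_inv] at e2
  have hP := qPoch_self_ne_zero hq (2 * n)
  have hP1 : 1 - q * q ^ (2 * n) ≠ 0 := sub_ne_zero.2 (self_mul_pow_ne_one hq _).symm
  rw [mul_div_assoc', mul_div_assoc', ← add_div, div_eq_div_iff (mul_ne_zero hP hP1) hP]
  -- The general argument cancels `1 - z`; at `z = 1` both sides contain `(1;q)_n = 0`.
  rcases eq_or_ne z 1 with rfl | hz1'
  · simp [h0]
  · generalize qPoch (q / z) q n = X at *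
    generalize qPoch (q / z⁻¹) q n = Y at *
    generalize qPoch z⁻¹ q n = B at *
    have e2' : (1 - z) * X = -(B * (z - q ^ n)) := by
      field_simp at e2
      linear_combination e2
    have e3 : z * (1 - q / z * q ^ n) = z - q * q ^ n := by field_simp
    have e4 : z * z⁻¹ = 1 := mul_inv_cancel₀ hz
    refine mul_left_cancel₀ (sub_ne_zero.2 hz1'.symm) ?_
    rw [pow_mul', pow_two, div_inv_eq_mul]
    linear_combination (qPoch z q n * X * (1 - z) * e3 + (1 - z) * B * Y * (1 - q * z * q ^ n) * e4
      + (qPoch z q n * (z - q * q ^ n)) * e2' - (B * (1 - q * z * q ^ n)) * e1)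
        * qPoch q q (2 * n)

/-! ### Bailey's lemma and the infinite triple product. -/

theorem hasSum_pnat_iff {f : ℕ → ℂ} {a : ℂ} :
    HasSum (fun n : ℕ+ => f n) a ↔ HasSum (fun n : ℕ => f (n + 1)) a := by
  rw [← Equiv.pnatEquivNat.symm.hasSum_iff]
  rfl

theorem summable_pnat_iff {f : ℕ → ℂ} :
    Summable (fun n : ℕ+ => f n) ↔ Summable f := by
  rw [← summable_nat_add_iff 1, ← Equiv.pnatEquivNat.symm.summable_iff]
  rfl

theorem summable_pow_triangle_mul_pow {r R : ℝ} (hr0 : 0 < r) (hr : r < 1) (hR : 0 < R) :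
    Summable fun i : ℕ => r ^ (i * (i - 1) / 2) * R ^ i := by
  refine summable_of_ratio_test_tendsto_lt_one (l := 0 * R) (by simp)
    (Eventually.of_forall fun i => by positivity) ?_
  refine ((tendsto_pow_atTop_nhds_zero_of_lt_one hr0.le hr).mul_const R).congr fun i => ?_
  rw [triangle_succ, Real.norm_of_nonneg (by positivity), Real.norm_of_nonneg (by positivity),
    pow_add, pow_succ R]
  field_simp

theorem exists_norm_zFactor_le {z : ℂ} (hz : z ≠ 0) :
    ∃ R : ℝ, 1 ≤ R ∧ ∀ i : ℕ, ‖zFactor z ((i : ℤ) + 1)‖ ≤ 2 * (1 + R) * R ^ i := by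
  refine ⟨max 1 (max ‖z‖ ‖z⁻¹‖), le_max_left _ _, fun i => ?_⟩
  set R := max 1 (max ‖z‖ ‖z⁻¹‖)
  have h1 : 1 ≤ R := le_max_left _ _
  have h2 : ‖z‖ ≤ R := (le_max_left _ _).trans (le_max_right _ _)
  have h3 : ‖z⁻¹‖ ≤ R := (le_max_right _ _).trans (le_max_right _ _)
  have h4 : 1 ≤ R ^ i := one_le_pow₀ h1
  rw [zFactor_add_one hz]
  calc ‖z ^ (i + 1) + z⁻¹ ^ i - (1 + z)‖ ≤ ‖z‖ ^ (i + 1) + ‖z⁻¹‖ ^ i + (1 + ‖z‖) := by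
        refine (norm_sub_le _ _).trans (add_le_add ((norm_add_le _ _).trans ?_)
          ((norm_add_le _ _).trans ?_)) <;> simp
    _ ≤ R ^ (i + 1) + R ^ i + (1 + R) := by gcongr
    _ ≤ 2 * (1 + R) * R ^ i := by rw [pow_succ]; nlinarith

/-- The quadratic power of `q` beats the geometric growth of `c_{i+1}(z)`. -/
theorem summable_norm_baileyAlpha {z q : ℂ} (hq0 : q ≠ 0) (hq : ‖q‖ < 1) (hz : z ≠ 0) :
    Summable fun i => ‖baileyAlpha z q i‖ := by
  obtain ⟨R, hR, h⟩ := exists_norm_zFactor_le hz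
  refine Summable.of_nonneg_of_le (fun _ => norm_nonneg _) (fun i => ?_)
    ((summable_pow_triangle_mul_pow (norm_pos_iff.2 hq0) hq (by linarith : 0 < R)).mul_left
      (2 * (1 + R)))
  rw [baileyAlpha, norm_mul, norm_mul, norm_pow, norm_neg, norm_one, one_pow, one_mul, norm_pow]
  calc _ ≤ ‖q‖ ^ (i * (i - 1) / 2) * (2 * (1 + R) * R ^ i) := by gcongr; exact h i
    _ = _ := by ring

theorem exists_norm_baileyKernel_le {q : ℂ} (hq : ‖q‖ < 1) :
    ∃ B : ℝ, 0 < B ∧ ∀ i n, ‖baileyKernel q i n‖ ≤ B := by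
  obtain ⟨B, hB0, hB⟩ := exists_norm_inv_qPoch_le hq (self_mul_pow_ne_one hq)
  refine ⟨B * B, by positivity, fun i n => ?_⟩
  rw [baileyKernel]
  split_ifs
  · rw [mul_inv, norm_mul]
    exact mul_le_mul (hB _) (hB _) (norm_nonneg _) hB0.le
  · rw [norm_zero]; positivity

theorem norm_one_sub_pow_le {q : ℂ} (hq : ‖q‖ < 1) (k : ℕ) : ‖1 - q ^ k‖ ≤ 2 := by
  refine (norm_sub_le _ _).trans ?_
  rw [norm_one, norm_pow]
  linarith [pow_le_one₀ (norm_nonneg q) hq.le (n := k)]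

/-- The shifted factorials and their inverses are bounded in `n`, so convergence is inherited from
`δ`. -/
theorem summable_bailey (z : ℂ) {q : ℂ} (hq : ‖q‖ < 1) {δ : ℕ → ℂ}
    (hδ : Summable fun n => ‖δ n‖) :
    Summable fun n : ℕ+ => qPoch z q n * qPoch z⁻¹ q n / qPoch q q (2 * n) * δ n := by
  obtain ⟨B, hB0, hB⟩ := exists_norm_inv_qPoch_le hq (self_mul_pow_ne_one hq)
  refine summable_pnat_iff
    (f := fun n => qPoch z q n * qPoch z⁻¹ q n / qPoch q q (2 * n) * δ n).2 ?_
  refine Summable.of_norm_bounded (hδ.mul_left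
    (Real.exp (‖z‖ / (1 - ‖q‖)) * Real.exp (‖z⁻¹‖ / (1 - ‖q‖)) * B)) fun n => ?_
  rw [norm_mul, div_eq_mul_inv, norm_mul, norm_mul]
  gcongr
  exacts [norm_qPoch_le z hq n, norm_qPoch_le z⁻¹ hq n, hB _]

/-- Bailey's lemma for the pair `baileyAlpha` and a conjugate Bailey pair `(δ, γ)`. -/
theorem hasSum_bailey {z q : ℂ} (hq0 : q ≠ 0) (hq : ‖q‖ < 1) (hz : z ≠ 0) {δ γ : ℕ → ℂ}
    (hδ : Summable fun n => ‖δ n‖)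
    (hγ : ∀ i, HasSum (fun n => (1 - q ^ (2 * i + 1)) * baileyKernel q i n * δ n) (γ i)) :
    HasSum (fun i => baileyAlpha z q i * γ i)
      ((1 + z) * ∑' n : ℕ+, qPoch z q n * qPoch z⁻¹ q n / qPoch q q (2 * n) * δ n) := by
  obtain ⟨B, hB0, hB⟩ := exists_norm_baileyKernel_le hq
  -- The kernel is bounded, so the double series is dominated by the product of two absolutely
  -- convergent ones and may be summed in either order.
  let F : ℕ × ℕ → ℂ := fun p => baileyAlpha z q p.1
    * ((1 - q ^ (2 * p.1 + 1)) * baileyKernel q p.1 p.2 * δ p.2)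
  have hF : Summable F := by
    refine Summable.of_norm_bounded (((summable_norm_baileyAlpha hq0 hq hz).mul_of_nonneg hδ
      (fun _ => norm_nonneg _) (fun _ => norm_nonneg _)).mul_left (2 * B)) fun p => ?_
    calc ‖F p‖ = ‖baileyAlpha z q p.1‖ * (‖1 - q ^ (2 * p.1 + 1)‖ * ‖baileyKernel q p.1 p.2‖
          * ‖δ p.2‖) := by simp only [F, norm_mul]
      _ ≤ ‖baileyAlpha z q p.1‖ * (2 * B * ‖δ p.2‖) := by
          gcongr
          exacts [norm_one_sub_pow_le hq _, hB _ _]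
      _ = _ := by ring
  have h1 := hF.hasSum.prod_fiberwise fun i => (hγ i).mul_left (baileyAlpha z q i)
  -- For fixed `n` the kernel vanishes once `i > n`, so the inner sum is the finite Bailey sum.
  have h2 := ((Equiv.prodComm ℕ ℕ).hasSum_iff.2 hF.hasSum).prod_fiberwise
    (g := fun n => (∑ i ∈ Finset.range (n + 1),
      baileyAlpha z q i * ((1 - q ^ (2 * i + 1)) * baileyKernel q i n)) * δ n) fun n => by
    have h : HasSum (fun i => F (i, n)) (∑ i ∈ Finset.range (n + 1), F (i, n)) :=
      hasSum_sum_of_ne_finset_zero fun i hi => by simp [F, baileyKernel_of_lt q (show n < i by simpa using hi)]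
    simpa [F, Finset.sum_mul, mul_assoc] using h
  have h3 : (1 + z) * ∑' n : ℕ+, qPoch z q n * qPoch z⁻¹ q n / qPoch q q (2 * n) * δ n
      = ∑' p, F p := by
    rw [← tsum_mul_left]
    rw [← hasSum_nat_add_iff' 1] at h2
    simp only [Finset.range_one, Finset.sum_singleton, zero_add, baileyAlpha_zero, zero_mul,
      sub_zero] at h2
    refine ((hasSum_pnat_iff (f := fun n => (∑ i ∈ Finset.range (n + 1),
      baileyAlpha z q i * ((1 - q ^ (2 * i + 1)) * baileyKernel q i n)) * δ n)).2 h2).tsum_eq ▸ ?_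
    refine tsum_congr fun n => ?_
    rw [sum_baileyAlpha hq0 hq hz n.ne_zero]
    ring
  rw [h3]
  exact h1

/-- The Jacobi triple product identity. -/
theorem hasSum_triple_product {z q : ℂ} (hq0 : q ≠ 0) (hq : ‖q‖ < 1) (hz : z ≠ 0) :
    HasSum (fun i : ℕ => (-1) ^ i * (q ^ (i * (i - 1) / 2) * z ^ (i + 1)
      - q ^ ((i + 2) * (i + 1) / 2) * z⁻¹ ^ i))
      (z * (qPochInf z q * qPochInf (q / z) q * qPochInf q q)) := by
  obtain ⟨B, hB0, hB⟩ := exists_norm_baileyKernel_le hq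
  set f : ℕ → ℂ := fun i => (-1) ^ i * (q ^ (i * (i - 1) / 2) * z ^ (i + 1)
      - q ^ ((i + 2) * (i + 1) / 2) * z⁻¹ ^ i) with hf
  have hq0' : 0 < ‖q‖ := norm_pos_iff.2 hq0
  have hfs : Summable fun i => ‖f i‖ := by
    have h1 := (summable_pow_triangle_mul_pow hq0' hq (norm_pos_iff.2 hz)).mul_right ‖z‖
    have h2 := ((summable_nat_add_iff 2).2 (summable_pow_triangle_mul_pow hq0' hq
      (norm_pos_iff.2 (inv_ne_zero hz)))).mul_left (‖z‖ ^ 2)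
    refine Summable.of_nonneg_of_le (fun _ => norm_nonneg _) (fun i => ?_) (h1.add h2)
    rw [hf, norm_mul, norm_pow, norm_neg, norm_one, one_pow, one_mul]
    refine (norm_sub_le _ _).trans (le_of_eq ?_)
    have : ‖z‖ ≠ 0 := norm_ne_zero_iff.2 hz
    simp only [norm_mul, norm_pow, norm_inv]
    rw [show i + 2 - 1 = i + 1 from rfl, pow_add _ i 2, pow_succ]
    field_simp
  have hP := qPochInf_self_ne_zero hq
  -- As `n → ∞` in the finite identity, the kernel tends to `1/(q;q)_∞²`; the bound `B ‖f i‖` allows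
  -- the limit under the sum.
  have htend : Tendsto (fun n => ∑' i, f i * baileyKernel q i n) atTop
      (𝓝 (∑' i, f i * (qPochInf q q * qPochInf q q)⁻¹)) := by
    refine tendsto_tsum_of_dominated_convergence (hfs.mul_right B) (fun i => ?_)
      (Eventually.of_forall fun n i => ?_)
    · refine Tendsto.const_mul _ ?_
      refine Tendsto.congr' (f₁ := fun n => (qPoch q q (n - i) * qPoch q q (n + i + 1))⁻¹) ?_ ?_
      · filter_upwards [eventually_ge_atTop i] with n hn
        rw [baileyKernel, if_pos hn]
      · refine Tendsto.inv₀ (Tendsto.mul ?_ ?_) (mul_ne_zero hP hP)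
        · exact (tendsto_qPoch q hq).comp (tendsto_sub_atTop_nat i)
        · exact (tendsto_qPoch q hq).comp (tendsto_add_atTop_nat (i + 1))
    · rw [norm_mul]; gcongr; exact hB _ _
  have hfin (n : ℕ) : ∑' i, f i * baileyKernel q i n
      = z * qPoch z q n * qPoch (q / z) q (n + 1) / qPoch q q (2 * n + 1) := by
    rw [← sum_finite_triple_product hq0 hq hz n]
    refine tsum_eq_sum fun i hi => ?_
    rw [baileyKernel_of_lt q (by simpa using hi), mul_zero]
  have htend' : Tendsto (fun n => ∑' i, f i * baileyKernel q i n) atTop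
      (𝓝 (z * qPochInf z q * qPochInf (q / z) q / qPochInf q q)) := by
    simp only [hfin]
    refine Tendsto.div (Tendsto.mul (Tendsto.const_mul _ (tendsto_qPoch z hq)) ?_) ?_ hP
    · exact (tendsto_qPoch _ hq).comp (tendsto_add_atTop_nat 1)
    · refine (tendsto_qPoch q hq).comp (tendsto_atTop_mono (fun n => ?_) tendsto_id)
      simp only [id]; omega
  have := tendsto_nhds_unique htend htend'
  rw [tsum_mul_right] at this
  have h : ∑' i, f i = z * (qPochInf z q * qPochInf (q / z) q * qPochInf q q) := by
    field_simp at this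
    rw [this]; ring
  exact h ▸ hfs.of_norm.hasSum

/-! ### The `q`-Gauss summation by iterating `c ↦ cq`. -/

theorem tendsto_mul_pow_zero (c : ℂ) {q : ℂ} (hq : ‖q‖ < 1) :
    Tendsto (fun N : ℕ => c * q ^ N) atTop (𝓝 0) := by
  simpa using (tendsto_pow_atTop_nhds_zero_of_norm_lt_one hq).const_mul c

/-- Uniformity in `N` comes from `1/(cq^N;q)_k = (c;q)_N/(c;q)_{N+k}`, both factors being bounded.
-/
theorem exists_norm_inv_qPoch_mul_pow_le {c q : ℂ} (hq : ‖q‖ < 1) (hc : ∀ k : ℕ, c * q ^ k ≠ 1) :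
    ∃ B : ℝ, 0 < B ∧ ∀ N k, ‖(qPoch (c * q ^ N) q k)⁻¹‖ ≤ B := by
  obtain ⟨B, hB0, hB⟩ := exists_norm_inv_qPoch_le hq hc
  refine ⟨Real.exp (‖c‖ / (1 - ‖q‖)) * B, by positivity, fun N k => ?_⟩
  have : (qPoch (c * q ^ N) q k)⁻¹ = qPoch c q N * (qPoch c q (N + k))⁻¹ := by
    have := qPoch_ne_zero hc N
    rw [qPoch_add]
    field_simp
  rw [this, norm_mul]
  exact mul_le_mul (norm_qPoch_le c hq N) (hB _) (norm_nonneg _) (Real.exp_pos _).le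

theorem summable_div_qPoch {c q : ℂ} (hq : ‖q‖ < 1) (hc : ∀ k : ℕ, c * q ^ k ≠ 1) {w : ℕ → ℂ}
    (hw : Summable fun k => ‖w k * c ^ k‖) : Summable fun k => w k * c ^ k / qPoch c q k := by
  obtain ⟨B, hB0, hB⟩ := exists_norm_inv_qPoch_le hq hc
  refine Summable.of_norm_bounded (hw.mul_right B) fun k => ?_
  rw [div_eq_mul_inv, norm_mul]
  gcongr
  exact hB _

/-- As `cq^N → 0`, dominated convergence leaves only the constant term. -/
theorem tendsto_tsum_div_qPoch {c q : ℂ} (hq : ‖q‖ < 1) (hc : ∀ k : ℕ, c * q ^ k ≠ 1) {w : ℕ → ℂ}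
    (hw : Summable fun k => ‖w k * c ^ k‖) :
    Tendsto (fun N : ℕ => ∑' k, w k * (c * q ^ N) ^ k / qPoch (c * q ^ N) q k) atTop (𝓝 (w 0)) := by
  obtain ⟨B, hB0, hB⟩ := exists_norm_inv_qPoch_mul_pow_le hq hc
  have h0 : ∑' k, w k * (0 : ℂ) ^ k / qPoch 0 q k = w 0 := by
    rw [tsum_eq_single 0 fun k hk => by simp [hk]]
    simp [qPoch]
  rw [← h0]
  refine tendsto_tsum_of_dominated_convergence (hw.mul_right B) (fun k => ?_)
    (Eventually.of_forall fun N k => ?_)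
  · have h1 : qPoch 0 q k ≠ 0 := by simp [qPoch]
    have h2 : ContinuousAt (fun x => w k * x ^ k / qPoch x q k) 0 :=
      ContinuousAt.div (by fun_prop) (continuous_qPoch q k).continuousAt h1
    exact h2.tendsto.comp (tendsto_mul_pow_zero c hq)
  · rw [div_eq_mul_inv, norm_mul, mul_pow, ← mul_assoc, norm_mul]
    refine mul_le_mul ?_ (hB _ _) (norm_nonneg _) (norm_nonneg _)
    refine mul_le_of_le_one_right (norm_nonneg _) ?_
    rw [norm_pow, norm_pow]
    exact pow_le_one₀ (by positivity) (pow_le_one₀ (norm_nonneg _) hq.le)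

/-- A series `∑ w_k c^k / (c; q)_k` is determined by its behaviour under `c ↦ c q`. -/
theorem hasSum_div_qPoch_of_step {c q L : ℂ} (hq : ‖q‖ < 1) (hc : ∀ k : ℕ, c * q ^ k ≠ 1)
    {w r : ℕ → ℂ} (hw : Summable fun k => ‖w k * c ^ k‖) (hw0 : w 0 = 1)
    (hstep : ∀ N : ℕ, ∑' k, w k * (c * q ^ N) ^ k / qPoch (c * q ^ N) q k
      = r N * ∑' k, w k * (c * q ^ N * q) ^ k / qPoch (c * q ^ N * q) q k)
    (hr : Tendsto (fun N => ∏ n ∈ Finset.range N, r n) atTop (𝓝 L)) :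
    HasSum (fun k => w k * c ^ k / qPoch c q k) L := by
  -- After `N` steps the sum at `c` is `∏_{n<N} r_n` times the sum at `cq^N`, which tends to `w 0 =
  -- 1`.
  have key (N : ℕ) : ∑' k, w k * c ^ k / qPoch c q k = (∏ n ∈ Finset.range N, r n)
      * ∑' k, w k * (c * q ^ N) ^ k / qPoch (c * q ^ N) q k := by
    induction N with
    | zero => simp
    | succ N ih => rw [ih, hstep, Finset.prod_range_succ, pow_succ, ← mul_assoc c, mul_assoc (∏ n ∈ _, r n)]
  have h := hr.mul (tendsto_tsum_div_qPoch hq hc hw)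
  rw [hw0, mul_one] at h
  have := tendsto_nhds_unique (tendsto_const_nhds.congr key) h
  rw [← this]
  exact (summable_div_qPoch hq hc hw).hasSum

theorem qPoch_mul_q {c q : ℂ} (n : ℕ) :
    (1 - c) * qPoch (c * q) q n = qPoch c q n * (1 - c * q ^ n) := by
  rw [← qPoch_succ', qPoch_succ]

theorem mul_q_mul_pow_ne_one {c q : ℂ} (hc : ∀ k : ℕ, c * q ^ k ≠ 1) (k : ℕ) :
    c * q * q ^ k ≠ 1 := by
  rw [mul_assoc, ← pow_succ']; exact hc _

theorem mul_pow_mul_pow_ne_one {c q : ℂ} (hc : ∀ k : ℕ, c * q ^ k ≠ 1) (N k : ℕ) :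
    c * q ^ N * q ^ k ≠ 1 := by
  rw [mul_assoc, ← pow_add]; exact hc _

theorem norm_mul_pow_le (c : ℂ) {q : ℂ} (hq : ‖q‖ < 1) (N : ℕ) : ‖c * q ^ N‖ ≤ ‖c‖ := by
  rw [norm_mul, norm_pow]
  exact mul_le_of_le_one_right (norm_nonneg _) (pow_le_one₀ (norm_nonneg _) hq.le)

/-- The product `∏_{j<n} (u - q^j)`; for `u = ρ⁻¹` it equals `(ρ; q)_n ρ^{-n}`. -/
noncomputable def qShift (u q : ℂ) (n : ℕ) : ℂ := ∏ j ∈ Finset.range n, (u - q ^ j)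

theorem qShift_succ (u q : ℂ) (n : ℕ) : qShift u q (n + 1) = qShift u q n * (u - q ^ n) := by
  simp [qShift, Finset.prod_range_succ]

theorem qShift_inv {ρ : ℂ} (hρ : ρ ≠ 0) (q : ℂ) (n : ℕ) :
    qShift ρ⁻¹ q n = qPoch ρ q n / ρ ^ n := by
  induction n with
  | zero => simp [qShift, qPoch]
  | succ n ih => rw [qShift_succ, qPoch_succ, ih]; field_simp; ring

theorem qShift_zero_left (q : ℂ) (n : ℕ) :
    qShift 0 q n = (-1) ^ n * q ^ (n * (n - 1) / 2) := by
  induction n with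
  | zero => simp [qShift]
  | succ n ih => rw [qShift_succ, ih, triangle_succ]; ring

/-- Each further factor rescales: `u - q^{i+j} = q^i (u/q^i - q^j)`. -/
theorem qShift_add (u : ℂ) {q : ℂ} (hq0 : q ≠ 0) (i k : ℕ) :
    qShift u q (i + k) = qShift u q i * ((q ^ i) ^ k * qShift (u / q ^ i) q k) := by
  induction k with
  | zero => simp [qShift]
  | succ k ih =>
    rw [← add_assoc, qShift_succ, ih, qShift_succ]
    field_simp
    ring

theorem continuous_qShift (q : ℂ) (n : ℕ) : Continuous fun u => qShift u q n := by
  unfold qShift; fun_prop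

theorem summable_norm_qShift {u v x q : ℂ} (hq : ‖q‖ < 1) (hx : ‖u * v * x‖ < 1) :
    Summable fun n => ‖qShift u q n * qShift v q n * x ^ n‖ := by
  obtain ⟨r, hr1, hr2⟩ := exists_between hx
  refine summable_of_ratio_norm_eventually_le hr2 ?_
  have hq' := tendsto_pow_atTop_nhds_zero_of_norm_lt_one hq
  have h : Tendsto (fun n : ℕ => ‖(u - q ^ n) * (v - q ^ n) * x‖) atTop (𝓝 ‖u * v * x‖) := by
    simpa using (((hq'.const_sub u).mul (hq'.const_sub v)).mul_const x).norm
  filter_upwards [h.eventually_le_const hr1] with n hn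
  rw [norm_norm, norm_norm, qShift_succ, qShift_succ, pow_succ,
    show qShift u q n * (u - q ^ n) * (qShift v q n * (v - q ^ n)) * (x ^ n * x)
      = (u - q ^ n) * (v - q ^ n) * x * (qShift u q n * qShift v q n * x ^ n) by ring, norm_mul]
  gcongr

theorem summable_norm_qShift_div {u v c q : ℂ} (hq : ‖q‖ < 1) (hx : ‖u * v * c‖ < 1) :
    Summable fun k => ‖qShift u q k * qShift v q k / qPoch q q k * c ^ k‖ := by
  obtain ⟨B, hB0, hB⟩ := exists_norm_inv_qPoch_le hq (self_mul_pow_ne_one hq)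
  refine Summable.of_nonneg_of_le (fun _ => norm_nonneg _) (fun k => ?_)
    ((summable_norm_qShift hq hx).mul_left B)
  rw [div_mul_eq_mul_div, div_eq_mul_inv, norm_mul, mul_comm]
  gcongr
  exact hB k

/-- A contiguous relation: `(1-c)(1-uvc)` times the sum at `c`, minus `(1-uc)(1-vc)` times the sum
at `cq`, telescopes to zero. -/
theorem qGauss_step {u v c q : ℂ} (hq : ‖q‖ < 1) (hc : ∀ k : ℕ, c * q ^ k ≠ 1)
    (hx : ‖u * v * c‖ < 1) :
    ∑' k, qShift u q k * qShift v q k / qPoch q q k * c ^ k / qPoch c q k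
      = (1 - u * c) * (1 - v * c) / ((1 - c) * (1 - u * v * c))
        * ∑' k, qShift u q k * qShift v q k / qPoch q q k * (c * q) ^ k / qPoch (c * q) q k := by
  have hw := summable_norm_qShift_div hq hx
  have hw' := summable_norm_qShift_div (u := u) (v := v) (c := c * q) hq (by
    rw [← mul_assoc, norm_mul]; exact mul_lt_one_of_nonneg_of_lt_one_left (norm_nonneg _) hx hq.le)
  have hf1 := summable_div_qPoch hq hc hw
  have hf2 := summable_div_qPoch hq (mul_q_mul_pow_ne_one hc) hw'
  have hc1 : 1 - c ≠ 0 := sub_ne_zero.2 (by simpa using (hc 0).symm)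
  have hx1 : 1 - u * v * c ≠ 0 := by
    refine sub_ne_zero.2 fun h => ?_
    rw [← h, norm_one] at hx; exact lt_irrefl _ hx
  -- The telescoping certificate. The factor `1 - q^k` gives `U 0 = 0`, and summability of the
  -- numerators gives `U k → 0`.
  let U : ℕ → ℂ := fun k => qShift u q k * qShift v q k / qPoch q q k * c ^ k
    * (-((1 - q ^ k) * (1 - c * q ^ k)) * (qPoch (c * q) q k)⁻¹)
  obtain ⟨B, hB0, hB⟩ := exists_norm_inv_qPoch_le hq (mul_q_mul_pow_ne_one hc)
  have hU : Tendsto U atTop (𝓝 0) := by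
    refine squeeze_zero_norm (a := fun k => ‖qShift u q k * qShift v q k / qPoch q q k
      * c ^ k‖ * (2 * (1 + ‖c‖) * B)) (fun k => ?_) ?_
    · rw [norm_mul]
      refine mul_le_mul_of_nonneg_left ?_ (norm_nonneg _)
      rw [norm_mul, norm_neg, norm_mul]
      gcongr
      · exact norm_one_sub_pow_le hq k
      · refine (norm_sub_le _ _).trans ?_
        rw [norm_one]
        linarith [norm_mul_pow_le c hq k]
      · exact hB k
    · simpa using hw.of_norm.tendsto_atTop_zero.norm.mul_const (2 * (1 + ‖c‖) * B)
  have hT := hasSum_of_telescope (U := U)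
    ((hf1.mul_left ((1 - c) * (1 - u * v * c))).sub (hf2.mul_left ((1 - u * c) * (1 - v * c))))
    (fun k => ?_) hU
  · have h0 : U 0 = 0 := by simp [U]
    rw [h0, sub_zero] at hT
    have := hT.unique ((hf1.hasSum.mul_left _).sub (hf2.hasSum.mul_left _))
    rw [div_mul_eq_mul_div, eq_div_iff (mul_ne_zero hc1 hx1)]
    linear_combination -this
  · have h1 := qPoch_ne_zero (mul_q_mul_pow_ne_one hc) k
    have h3 := qPoch_self_ne_zero hq k
    have h4 : 1 - q * q ^ k ≠ 0 := sub_ne_zero.2 (self_mul_pow_ne_one hq k).symm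
    have h5 : 1 - c * q * q ^ k ≠ 0 := sub_ne_zero.2 (mul_q_mul_pow_ne_one hc k).symm
    have h6 : (qPoch c q k)⁻¹ = (1 - c * q ^ k) * ((1 - c)⁻¹ * (qPoch (c * q) q k)⁻¹) := by
      rw [← mul_inv, qPoch_mul_q, mul_inv, mul_comm (_⁻¹),
        mul_inv_cancel_left₀ (sub_ne_zero.2 (hc k).symm)]
    have e1 : U (k + 1) = qShift u q k * qShift v q k / qPoch q q k * c ^ k
        * (-(c * ((u - q ^ k) * (v - q ^ k)))) * (qPoch (c * q) q k)⁻¹ := by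
      simp only [U, qShift_succ, qPoch_succ, pow_succ]
      rw [mul_comm (q ^ k) q, ← mul_assoc c q]
      generalize 1 - q * q ^ k = X at *
      generalize 1 - c * q * q ^ k = Y at *
      field_simp
    rw [e1, div_eq_mul_inv _ (qPoch c q k), h6, mul_pow, div_eq_mul_inv _ (qPoch (c * q) q k)]
    simp only [U]
    field_simp
    ring

/-- The `q`-Gauss summation, in a form that includes its limiting case `v = 0`. -/
theorem hasSum_qGauss {u v c q : ℂ} (hq : ‖q‖ < 1) (hc : ∀ k : ℕ, c * q ^ k ≠ 1)
    (hx : ‖u * v * c‖ < 1) :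
    HasSum (fun k => qShift u q k * qShift v q k / qPoch q q k * c ^ k / qPoch c q k)
      (qPochInf (u * c) q * qPochInf (v * c) q / (qPochInf c q * qPochInf (u * v * c) q)) := by
  refine hasSum_div_qPoch_of_step hq hc (summable_norm_qShift_div hq hx) (by simp [qPoch, qShift])
    (fun N => qGauss_step hq (mul_pow_mul_pow_ne_one hc N) ?_) ?_
  · rw [← mul_assoc]
    exact (norm_mul_pow_le _ hq N).trans_lt hx
  · have h := ((tendsto_qPoch (u * c) hq).mul (tendsto_qPoch (v * c) hq)).div
      ((tendsto_qPoch c hq).mul (tendsto_qPoch (u * v * c) hq))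
      (mul_ne_zero (qPochInf_ne_zero hq hc)
        (qPochInf_ne_zero hq (mul_pow_ne_one_of_norm_lt hx hq)))
    refine h.congr fun N => ?_
    simp only [qPoch, Pi.div_apply, ← Finset.prod_mul_distrib, ← Finset.prod_div_distrib,
      mul_assoc]

/-! ### Conjugate Bailey pairs from the `q`-Gauss sum. -/

theorem qPoch_self_add (q : ℂ) (m k : ℕ) :
    qPoch q q (m + k) = qPoch q q m * qPoch (q ^ (m + 1)) q k := by
  rw [qPoch_add, pow_succ']

/-- The conjugate Bailey pairs relative to `q ^ e` coming from the `q`-Gauss summation. -/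
theorem hasSum_qShift_conjugate {u v q : ℂ} (hq0 : q ≠ 0) (hq : ‖q‖ < 1) (e : ℕ)
    (hx : ‖u * v * q ^ (e + 1)‖ < 1) (i : ℕ) :
    HasSum (fun k => (qPoch q q k * qPoch q q (2 * i + e + k))⁻¹
        * (qShift u q (i + k) * qShift v q (i + k) * (q ^ (e + 1)) ^ (i + k)))
      (qShift u q i * qShift v q i * (q ^ (e + 1)) ^ i
        * (qPochInf (u * q ^ (i + e + 1)) q * qPochInf (v * q ^ (i + e + 1)) q)
        / (qPochInf q q * qPochInf (u * v * q ^ (e + 1)) q)) := by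
  have hQ : q ^ i ≠ 0 := pow_ne_zero _ hq0
  have hc1 : u / q ^ i * (v / q ^ i) * q ^ (2 * i + e + 1) = u * v * q ^ (e + 1) := by
    rw [show 2 * i + e + 1 = i + i + (e + 1) by ring, pow_add, pow_add]
    field_simp
  have hc2 (w : ℂ) : w / q ^ i * q ^ (2 * i + e + 1) = w * q ^ (i + e + 1) := by
    rw [show 2 * i + e + 1 = i + (i + e + 1) by ring, pow_add]
    field_simp
  -- Factoring `q^i` out of the shifted products replaces `u, v` by `u/q^i, v/q^i` and `c` by
  -- `q^{2i+e+1}`, so `uvc` does not depend on `i`.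
  have h := hasSum_qGauss (u := u / q ^ i) (v := v / q ^ i) (c := q ^ (2 * i + e + 1)) hq
    (pow_mul_pow_ne_one hq (by omega)) (by rwa [hc1])
  rw [hc1, hc2, hc2] at h
  have hinf : qPochInf q q = qPoch q q (2 * i + e) * qPochInf (q ^ (2 * i + e + 1)) q := by
    rw [qPochInf_eq_mul q hq (2 * i + e), pow_succ']
  have hP := qPoch_self_ne_zero hq (2 * i + e)
  have h' := h.mul_left (qShift u q i * qShift v q i * (q ^ (e + 1)) ^ i / qPoch q q (2 * i + e))
  refine hasSum_of_eq h' (fun k => ?_) ?_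
  · rw [qShift_add u hq0, qShift_add v hq0, qPoch_self_add, pow_add _ i k, mul_inv, mul_inv]
    have : (q ^ (2 * i + e + 1)) ^ k = (q ^ i) ^ k * (q ^ i) ^ k * (q ^ (e + 1)) ^ k := by
      rw [← mul_pow, ← mul_pow]; congr 1; ring
    rw [this]
    ring
  · rw [hinf, div_mul_div_comm, mul_assoc (qPoch q q (2 * i + e))]

theorem hasSum_baileyKernel {q a : ℂ} {i : ℕ} {g : ℕ → ℂ}
    (h : HasSum (fun k => (qPoch q q k * qPoch q q (2 * i + 1 + k))⁻¹ * g (i + k)) a) :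
    HasSum (fun n => baileyKernel q i n * g n) a := by
  rw [← hasSum_nat_add_iff' i, Finset.sum_eq_zero fun n hn => by
    rw [baileyKernel_of_lt q (Finset.mem_range.1 hn), zero_mul], sub_zero]
  simpa only [add_comm _ i, baileyKernel_add] using h

/-- The unilateral expansion underlying `G(ρ₁, ρ₂, z; q)` and its limiting case. -/
theorem hasSum_qShift_sq {z u v q : ℂ} (hq0 : q ≠ 0) (hq : ‖q‖ < 1) (hz : z ≠ 0)
    (hx : ‖u * v * q ^ 2‖ < 1) :
    HasSum (fun i => baileyAlpha z q i * ((1 - q ^ (2 * i + 1))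
        * (qShift u q i * qShift v q i * (q ^ 2) ^ i
          * (qPochInf (u * q ^ (i + 2)) q * qPochInf (v * q ^ (i + 2)) q)
          / (qPochInf q q * qPochInf (u * v * q ^ 2) q))))
      ((1 + z) * ∑' n : ℕ+, qPoch z q n * qPoch z⁻¹ q n / qPoch q q (2 * n)
        * (qShift u q n * qShift v q n * (q ^ 2) ^ (n : ℕ))) := by
  refine hasSum_bailey hq0 hq hz (δ := fun n => qShift u q n * qShift v q n * (q ^ 2) ^ n)
    (summable_norm_qShift hq hx) fun i => ?_
  have h0 := hasSum_qShift_conjugate (u := u) (v := v) hq0 hq 1 (by rwa [one_add_one_eq_two]) i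
  rw [one_add_one_eq_two, show i + 1 + 1 = i + 2 from rfl] at h0
  have h := hasSum_baileyKernel (g := fun n => qShift u q n * qShift v q n * (q ^ 2) ^ n) h0
  exact hasSum_of_eq (h.mul_left (1 - q ^ (2 * i + 1))) (fun n => mul_assoc _ _ _) rfl

/-- Here `δ` belongs to a conjugate pair relative to `1`, while the kernel is relative to `q`. They
are reconciled by `1 - q^{2i+1} = (1-q^{2i+1+k}) - q^{2i+1}(1-q^k)`, which expresses the sum as the
`q`-Gauss value at `i` minus `q^{2i+1}` times the value at `i+1`. The final factor is
`(1-uq^{i+1})(1-vq^{i+1}) - q^{2i+2}(u-q^i)(v-q^i)`, in which the `uv` terms cancel. -/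
theorem hasSum_qShift_kernel {u v q : ℂ} (hq0 : q ≠ 0) (hq : ‖q‖ < 1) (hx : ‖u * v * q‖ < 1)
    (i : ℕ) :
    HasSum (fun n => (1 - q ^ (2 * i + 1)) * baileyKernel q i n
        * (qShift u q n * qShift v q n * q ^ n))
      (qShift u q i * qShift v q i * q ^ i
        * (qPochInf (u * q ^ (i + 2)) q * qPochInf (v * q ^ (i + 2)) q)
        / (qPochInf q q * qPochInf (u * v * q) q)
        * (1 - u * q ^ (i + 1) - v * q ^ (i + 1) + u * q ^ (3 * i + 2) + v * q ^ (3 * i + 2)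
          - q ^ (4 * i + 2))) := by
  have hP := qPoch_self_ne_zero hq
  have h0 := hasSum_qShift_conjugate (u := u) (v := v) hq0 hq 0 (by simpa using hx) i
  have h1 := hasSum_qShift_conjugate (u := u) (v := v) hq0 hq 0 (by simpa using hx) (i + 1)
  simp only [zero_add, pow_one, add_zero] at h0 h1
  -- The series at `i+1` is reindexed by `k ↦ k+1`; the factor `1 - q^k` makes the missing `k = 0`
  -- term zero.
  have h2 := (hasSum_nat_add_iff (f := fun k => (1 - q ^ k)
      * (qPoch q q k * qPoch q q (2 * i + 1 + k))⁻¹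
      * (qShift u q (i + k) * qShift v q (i + k) * q ^ (i + k))) 1).1 (h1.congr_fun fun k => by
    have h3 : 1 - q * q ^ k ≠ 0 := sub_ne_zero.2 (self_mul_pow_ne_one hq k).symm
    rw [show 2 * (i + 1) + k = 2 * i + 1 + (k + 1) by ring, show i + 1 + k = i + (k + 1) by ring,
      qPoch_succ q q k, pow_succ' q k]
    have := hP k; have := hP (2 * i + 1 + (k + 1))
    field_simp)
  simp only [Finset.range_one, Finset.sum_singleton, pow_zero, sub_self, zero_mul, add_zero] at h2
  have h3 := h0.sub (h2.mul_left (q ^ (2 * i + 1)))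
  have hk : 1 - q ^ (2 * i + 1) ≠ 0 :=
    sub_ne_zero.2 fun h => pow_mul_pow_ne_one hq (m := 2 * i + 1) (by omega) 0 (by simpa using h.symm)
  have h4 := (h3.mul_left (1 - q ^ (2 * i + 1))⁻¹).congr_fun
    (g := fun k => (qPoch q q k * qPoch q q (2 * i + 1 + k))⁻¹
      * (qShift u q (i + k) * qShift v q (i + k) * q ^ (i + k))) fun k => by
    have h5 : 1 - q * q ^ (2 * i + k) ≠ 0 := sub_ne_zero.2 (self_mul_pow_ne_one hq _).symm
    have hP1 := hP k
    have hP2 := hP (2 * i + k)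
    rw [show 2 * i + 1 + k = 2 * i + k + 1 by ring, qPoch_succ q q (2 * i + k),
      eq_inv_mul_iff_mul_eq₀ hk]
    field_simp
    ring
  refine hasSum_of_eq ((hasSum_baileyKernel
    (g := fun n => qShift u q n * qShift v q n * q ^ n) h4).mul_left (1 - q ^ (2 * i + 1)))
    (fun _ => mul_assoc _ _ _) ?_
  rw [mul_inv_cancel_left₀ hk, qShift_succ, qShift_succ,
    qPochInf_eq_mul (u * q ^ (i + 1)) hq 1, qPochInf_eq_mul (v * q ^ (i + 1)) hq 1]
  simp only [qPoch, Finset.range_one, Finset.prod_singleton, pow_zero, mul_one, pow_one]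
  rw [mul_assoc u, mul_assoc v, ← pow_succ, show i + 1 + 1 = i + 2 by ring]
  ring_nf

/-- The unilateral expansion underlying `F(ρ₁, ρ₂, z; q)` and its limiting case. -/
theorem hasSum_qShift_self {z u v q : ℂ} (hq0 : q ≠ 0) (hq : ‖q‖ < 1) (hz : z ≠ 0)
    (hx : ‖u * v * q‖ < 1) :
    HasSum (fun i => baileyAlpha z q i * (qShift u q i * qShift v q i * q ^ i
        * (qPochInf (u * q ^ (i + 2)) q * qPochInf (v * q ^ (i + 2)) q)
        / (qPochInf q q * qPochInf (u * v * q) q)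
        * (1 - u * q ^ (i + 1) - v * q ^ (i + 1) + u * q ^ (3 * i + 2) + v * q ^ (3 * i + 2)
          - q ^ (4 * i + 2))))
      ((1 + z) * ∑' n : ℕ+, qPoch z q n * qPoch z⁻¹ q n / qPoch q q (2 * n)
        * (qShift u q n * qShift v q n * q ^ (n : ℕ))) :=
  hasSum_bailey hq0 hq hz (δ := fun n => qShift u q n * qShift v q n * q ^ n)
    (summable_norm_qShift hq hx) fun i => hasSum_qShift_kernel hq0 hq hx i

/-! ### Conjugate Bailey pairs given by partial and false theta series. -/

/-- The difference of two bounded solutions solves the homogeneous contracting recurrence, hence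
vanishes. -/
theorem eq_of_affine_recurrence {S T e r : ℕ → ℂ} {B B' s : ℝ}
    (hS : ∀ i, S i = e i + r i * S (i + 1)) (hT : ∀ i, T i = e i + r i * T (i + 1))
    (hr : ∀ i, ‖r i‖ ≤ s) (hs : s < 1) (hB : ∀ i, ‖S i‖ ≤ B) (hB' : ∀ i, ‖T i‖ ≤ B') (i : ℕ) :
    S i = T i := by
  refine sub_eq_zero.1 (eq_zero_of_contracting (d := fun i => S i - T i) (B := B + B')
    (fun i => ?_) hr hs (fun i => (norm_sub_le _ _).trans (add_le_add (hB i) (hB' i))) i)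
  linear_combination hS i - hT i

/-- `∑_k D_{i+k} q^k / ((q; q)_k (q; q)_{2i+1+k})`. -/
noncomputable def conjugateSum (q : ℂ) (D : ℕ → ℂ) (i : ℕ) : ℂ :=
  ∑' k, (qPoch q q k * qPoch q q (2 * i + 1 + k))⁻¹ * (D (i + k) * q ^ k)

theorem exists_norm_conjugateSum_term_le {q : ℂ} (hq : ‖q‖ < 1) {D : ℕ → ℂ} {M : ℝ}
    (hD : ∀ n, ‖D n‖ ≤ M) :
    ∃ B : ℝ, ∀ i k, ‖(qPoch q q k * qPoch q q (2 * i + 1 + k))⁻¹ * (D (i + k) * q ^ k)‖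
      ≤ B * ‖q‖ ^ k := by
  obtain ⟨B, hB0, hB⟩ := exists_norm_baileyKernel_le hq
  refine ⟨B * M, fun i k => ?_⟩
  have hM : 0 ≤ M := (norm_nonneg _).trans (hD 0)
  rw [← baileyKernel_add, norm_mul, norm_mul, norm_pow, ← mul_assoc]
  gcongr
  exacts [hB _ _, hD _]

theorem hasSum_conjugateSum {q : ℂ} (hq : ‖q‖ < 1) {D : ℕ → ℂ} {M : ℝ}
    (hD : ∀ n, ‖D n‖ ≤ M) (i : ℕ) :
    HasSum (fun k => (qPoch q q k * qPoch q q (2 * i + 1 + k))⁻¹ * (D (i + k) * q ^ k))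
      (conjugateSum q D i) := by
  obtain ⟨B, hB⟩ := exists_norm_conjugateSum_term_le hq hD
  exact (Summable.of_norm_bounded
    ((summable_geometric_of_lt_one (norm_nonneg _) hq).mul_left B) (hB i)).hasSum

theorem exists_norm_conjugateSum_le {q : ℂ} (hq : ‖q‖ < 1) {D : ℕ → ℂ} {M : ℝ}
    (hD : ∀ n, ‖D n‖ ≤ M) : ∃ B : ℝ, ∀ i, ‖conjugateSum q D i‖ ≤ B := by
  obtain ⟨B, hB⟩ := exists_norm_conjugateSum_term_le hq hD
  exact ⟨B * (1 - ‖q‖)⁻¹, fun i => tsum_of_norm_bounded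
    ((hasSum_geometric_of_lt_one (norm_nonneg _) hq).mul_left B) (hB i)⟩

theorem hasSum_baileyKernel_conjugateSum {q : ℂ} (hq : ‖q‖ < 1) {D : ℕ → ℂ} {M : ℝ}
    (hD : ∀ n, ‖D n‖ ≤ M) (i : ℕ) :
    HasSum (fun n => baileyKernel q i n * (D n * q ^ n)) (q ^ i * conjugateSum q D i) :=
  hasSum_baileyKernel (g := fun n => D n * q ^ n)
    (((hasSum_conjugateSum hq hD i).mul_left (q ^ i)).congr_fun fun k => by ring)

/-- A telescoping criterion for a recurrence between consecutive conjugate sums. -/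
theorem conjugateSum_recurrence {q : ℂ} (hq : ‖q‖ < 1) {D D' : ℕ → ℂ} {M : ℝ} {a b v L : ℂ} {i : ℕ}
    (hD : ∀ n, ‖D n‖ ≤ M) (hD' : Tendsto D' atTop (𝓝 L))
    (h : ∀ k, (a * (1 - q ^ (2 * i + 2 + k)) - b * (1 - q ^ k)) * q ^ k * D (i + k)
      = v * (D' (i + k + 1) - D' (i + k) * (1 - q ^ k) * (1 - q ^ (2 * i + 2 + k)))) :
    a * conjugateSum q D i - b * q * conjugateSum q D (i + 1)
      = v * (L / (qPochInf q q * qPochInf q q)) := by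
  have hP := qPoch_self_ne_zero hq
  have h0 := hasSum_conjugateSum hq hD i
  have h1 := (hasSum_conjugateSum hq hD (i + 1)).mul_left q
  have h2 := (hasSum_nat_add_iff (f := fun k => (1 - q ^ k)
      * (qPoch q q k * qPoch q q (2 * i + 2 + k))⁻¹ * (D (i + k) * q ^ k)) 1).1
      (h1.congr_fun fun k => by
    have h3 : 1 - q * q ^ k ≠ 0 := sub_ne_zero.2 (self_mul_pow_ne_one hq k).symm
    rw [show 2 * (i + 1) + 1 + k = 2 * i + 2 + (k + 1) by ring,
      show i + 1 + k = i + (k + 1) by ring, qPoch_succ q q k, pow_succ' q k]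
    have := hP k; have := hP (2 * i + 2 + (k + 1))
    field_simp)
  simp only [Finset.range_one, Finset.sum_singleton, pow_zero, sub_self, zero_mul, add_zero] at h2
  have h3 := (h0.mul_left a).sub (h2.mul_left b)
  -- Over the common denominator `(q;q)_k (q;q)_{2i+2+k}`, hypothesis `h` says that the summand is a
  -- difference of consecutive values of this sequence. It starts at `0` because of `1 - q^k`, so
  -- only the limit at infinity contributes.
  have h4 := hasSum_of_telescope (U := fun k => v * (D' (i + k) * (1 - q ^ k)
    * (qPoch q q k * qPoch q q (2 * i + 1 + k))⁻¹))
    (a := v * (L * (1 - 0) * (qPochInf q q * qPochInf q q)⁻¹)) h3.summable (fun k => ?_) ?_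
  · have h5 := h3.unique h4
    simp only [pow_zero, sub_self, mul_zero, zero_mul, sub_zero, mul_one] at h5
    rw [mul_assoc b, h5, div_eq_mul_inv]
  · have h5 : 1 - q * q ^ k ≠ 0 := sub_ne_zero.2 (self_mul_pow_ne_one hq k).symm
    have h6 : 1 - q * q ^ (2 * i + 1 + k) ≠ 0 := sub_ne_zero.2 (self_mul_pow_ne_one hq _).symm
    have h7 := h k
    have hP1 := hP k
    have hP2 := hP (2 * i + 1 + k)
    rw [show 2 * i + 2 + k = 2 * i + 1 + k + 1 by ring] at *
    rw [← add_assoc i k 1, show 2 * i + 1 + (k + 1) = 2 * i + 1 + k + 1 by ring,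
      qPoch_succ q q (2 * i + 1 + k), qPoch_succ q q k, pow_succ' q k]
    rw [pow_succ' q (2 * i + 1 + k)] at h7
    generalize 1 - q * q ^ k = X at *
    generalize 1 - q * q ^ (2 * i + 1 + k) = Y at *
    field_simp
    linear_combination h7
  · refine Tendsto.const_mul _ (Tendsto.mul (Tendsto.mul ?_ ?_) (Tendsto.inv₀ (Tendsto.mul ?_ ?_) ?_))
    · simpa only [add_comm _ i, Function.comp_def] using hD'.comp (tendsto_add_atTop_nat i)
    · exact (tendsto_pow_atTop_nhds_zero_of_norm_lt_one hq).const_sub 1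
    · exact tendsto_qPoch q hq
    · simpa only [add_comm _ (2 * i + 1), Function.comp_def] using
        (tendsto_qPoch q hq).comp (tendsto_add_atTop_nat (2 * i + 1))
    · exact mul_ne_zero (qPochInf_self_ne_zero hq) (qPochInf_self_ne_zero hq)

theorem norm_le_of_tsum_pow {q : ℂ} (hq : ‖q‖ < 1) {g : ℕ → ℂ} (hg : ∀ m, ‖g m‖ ≤ ‖q‖ ^ m) :
    ‖∑' m, g m‖ ≤ (1 - ‖q‖)⁻¹ :=
  tsum_of_norm_bounded (hasSum_geometric_of_lt_one (norm_nonneg _) hq) hg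

theorem summable_of_norm_le_pow {q : ℂ} (hq : ‖q‖ < 1) {g : ℕ → ℂ} (hg : ∀ m, ‖g m‖ ≤ ‖q‖ ^ m) :
    Summable g :=
  Summable.of_norm_bounded (summable_geometric_of_lt_one (norm_nonneg _) hq) hg

theorem norm_sq_lt_one {q : ℂ} (hq : ‖q‖ < 1) : ‖q ^ 2‖ < 1 := by
  rw [norm_pow]; exact pow_lt_one₀ (norm_nonneg _) hq two_ne_zero

theorem norm_one_sub_le_two {q : ℂ} (hq : ‖q‖ < 1) (k : ℕ) (x : ℂ) {B : ℝ} (hx : ‖x‖ ≤ B) :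
    ‖(1 - q ^ k) * x‖ ≤ 2 * B := by
  rw [norm_mul]
  exact mul_le_mul (norm_one_sub_pow_le hq k) hx (norm_nonneg _) zero_le_two

theorem norm_pow_le_of_pos {q : ℂ} (hq : ‖q‖ < 1) {k : ℕ} (hk : 1 ≤ k) : ‖q ^ k‖ ≤ ‖q‖ := by
  rw [norm_pow]
  exact pow_le_of_le_one (norm_nonneg _) hq.le (by omega)

section FalseTheta

variable {q : ℂ}

theorem norm_pow_le_pow (hq : ‖q‖ < 1) {k m : ℕ} (h : m ≤ k) : ‖q ^ k‖ ≤ ‖q‖ ^ m := by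
  rw [norm_pow]; exact pow_le_pow_of_le_one (norm_nonneg _) hq.le h

theorem norm_alternating_theta_le (hq : ‖q‖ < 1) (j m : ℕ) :
    ‖(-1) ^ m * q ^ (m ^ 2 + 2 * j * m)‖ ≤ ‖q‖ ^ m := by
  rw [norm_mul, norm_pow, norm_neg, norm_one, one_pow, one_mul]
  exact norm_pow_le_pow hq (by nlinarith [Nat.le_self_pow two_ne_zero m])

theorem norm_theta_le (hq : ‖q‖ < 1) (j m : ℕ) : ‖q ^ (m ^ 2 + 2 * j * m)‖ ≤ ‖q‖ ^ m :=
  norm_pow_le_pow hq (by nlinarith [Nat.le_self_pow two_ne_zero m])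

theorem norm_triangle_theta_le (hq : ‖q‖ < 1) (j m : ℕ) :
    ‖q ^ (m * (m - 1) / 2 + 2 * (j + 1) * m)‖ ≤ ‖q‖ ^ m :=
  norm_pow_le_pow hq (by nlinarith [Nat.zero_le (m * (m - 1) / 2)])

theorem alternating_theta_recurrence (hq : ‖q‖ < 1) (j : ℕ) :
    ∑' m : ℕ, (-1) ^ m * q ^ (m ^ 2 + 2 * j * m)
      = 1 - q ^ (2 * j + 1) * ∑' m : ℕ, (-1) ^ m * q ^ (m ^ 2 + 2 * (j + 1) * m) := by
  rw [(summable_of_norm_le_pow hq (norm_alternating_theta_le hq j)).tsum_eq_zero_add, ← tsum_mul_left,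
    sub_eq_add_neg, ← tsum_neg]
  congr 1
  · simp
  · refine tsum_congr fun m => ?_
    rw [show (m + 1) ^ 2 + 2 * j * (m + 1) = 2 * j + 1 + (m ^ 2 + 2 * (j + 1) * m) by ring,
      pow_add _ (2 * j + 1)]
    ring

theorem theta_recurrence (hq : ‖q‖ < 1) (j : ℕ) :
    ∑' m : ℕ, q ^ (m ^ 2 + 2 * j * m)
      = 1 + q ^ (2 * j + 1) * ∑' m : ℕ, q ^ (m ^ 2 + 2 * (j + 1) * m) := by
  rw [(summable_of_norm_le_pow hq (norm_theta_le hq j)).tsum_eq_zero_add, ← tsum_mul_left]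
  congr 1
  refine tsum_congr fun m => ?_
  rw [← pow_add]; congr 1; ring

/-- Two terms are split off because shifting `m` by one changes the linear coefficient from `2(j+1)`
to the odd number `2j+3`; a shift by two gives `2(j+2)`. -/
theorem triangle_theta_recurrence (hq : ‖q‖ < 1) (j : ℕ) :
    ∑' m : ℕ, q ^ (m * (m - 1) / 2 + 2 * (j + 1) * m)
      = 1 + q ^ (2 * (j + 1)) + q ^ (4 * (j + 1) + 1)
        * ∑' m : ℕ, q ^ (m * (m - 1) / 2 + 2 * (j + 2) * m) := by
  rw [← (summable_of_norm_le_pow hq (norm_triangle_theta_le hq j)).sum_add_tsum_nat_add 2,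
    ← tsum_mul_left]
  congr 1
  · simp [Finset.sum_range_succ]
  · refine tsum_congr fun m => ?_
    rw [← pow_add, show (m + 2) * (m + 2 - 1) / 2 = m * (m - 1) / 2 + m + (m + 1) from by
      rw [triangle_succ (m + 1), triangle_succ m]]
    congr 1; ring

end FalseTheta

/-- The conjugate Bailey pair with `δ_n = (q²; q²)_n q^n`. -/
theorem conjugateSum_qPoch_sq {q : ℂ} (hq : ‖q‖ < 1) (i : ℕ) :
    conjugateSum q (qPoch (q ^ 2) (q ^ 2)) i
      = qPochInf (q ^ 2) (q ^ 2) / (qPochInf q q * qPochInf q q)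
        * ∑' m : ℕ, (-1) ^ m * q ^ (m ^ 2 + 2 * (i + 1) * m) := by
  have hq2 := norm_sq_lt_one hq
  have hD := norm_qPoch_le (q ^ 2) hq2
  obtain ⟨B, hB⟩ := exists_norm_conjugateSum_le hq hD
  set C := qPochInf (q ^ 2) (q ^ 2) / (qPochInf q q * qPochInf q q)
  refine eq_of_affine_recurrence (S := conjugateSum q (qPoch (q ^ 2) (q ^ 2)))
    (T := fun i => C * ∑' m : ℕ, (-1) ^ m * q ^ (m ^ 2 + 2 * (i + 1) * m))
    (e := fun _ => C) (r := fun i => -q ^ (2 * (i + 1) + 1)) (fun i => ?_) (fun i => ?_)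
    (fun i => ?_) hq hB (B' := ‖C‖ * (1 - ‖q‖)⁻¹) (fun i => ?_) i
  -- These coefficients give `S_i = C - q^{2i+3} S_{i+1}`, the recurrence of the alternating theta
  -- series.
  · have := conjugateSum_recurrence hq (D' := qPoch (q ^ 2) (q ^ 2)) (a := 1)
      (b := -q ^ (2 * (i + 1))) (v := 1) (i := i) hD (tendsto_qPoch (q ^ 2) hq2) fun k => by
        rw [qPoch_succ]; ring
    linear_combination this
  · rw [alternating_theta_recurrence hq (i + 1)]; ring
  · rw [norm_neg]; exact norm_pow_le_of_pos hq (by omega)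
  · rw [norm_mul]
    gcongr
    exact norm_le_of_tsum_pow hq (norm_alternating_theta_le hq (i + 1))

/-- The conjugate Bailey pair in base `q²` with `δ_n = (q; q)_{2n} q^{2n}`. -/
theorem conjugateSum_qPoch_two_mul {q : ℂ} (hq : ‖q‖ < 1) (i : ℕ) :
    (1 - q ^ (2 * i + 1)) * conjugateSum (q ^ 2) (fun n => qPoch q q (2 * n)) i
      = qPochInf q q / (qPochInf (q ^ 2) (q ^ 2) * qPochInf (q ^ 2) (q ^ 2))
        * ∑' m : ℕ, q ^ (m * (m - 1) / 2 + 2 * (i + 1) * m) := by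
  have hq2 := norm_sq_lt_one hq
  have hD : ∀ n, ‖qPoch q q (2 * n)‖ ≤ _ := fun n => norm_qPoch_le q hq (2 * n)
  obtain ⟨B, hB⟩ := exists_norm_conjugateSum_le hq2 hD
  set C := qPochInf q q / (qPochInf (q ^ 2) (q ^ 2) * qPochInf (q ^ 2) (q ^ 2))
  refine eq_of_affine_recurrence
    (S := fun i => (1 - q ^ (2 * i + 1)) * conjugateSum (q ^ 2) (fun n => qPoch q q (2 * n)) i)
    (T := fun i => C * ∑' m : ℕ, q ^ (m * (m - 1) / 2 + 2 * (i + 1) * m))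
    (e := fun i => C * (1 + q ^ (2 * (i + 1)))) (r := fun i => q ^ (4 * (i + 1) + 1))
    (fun i => ?_) (fun i => ?_)
    (fun i => norm_pow_le_of_pos hq (by omega)) hq
    (fun i => norm_one_sub_le_two hq _ _ (hB i)) (B' := ‖C‖ * (1 - ‖q‖)⁻¹) (fun i => ?_) i
  -- In base `q²` the constant `b` is multiplied by `q²`, so with the weight `1 - q^{2i+1}` absorbed
  -- in `S_i` this reads `S_i = C(1+q^{2i+2}) + q^{4i+5} S_{i+1}`.
  · have := conjugateSum_recurrence hq2 (D := fun n => qPoch q q (2 * n))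
      (D' := fun n => qPoch q q (2 * n)) (a := 1 - q ^ (2 * i + 1))
      (b := q ^ (4 * i + 3) * (1 - q ^ (2 * i + 3))) (v := 1 + q ^ (2 * (i + 1))) (i := i) hD
      ((tendsto_qPoch q hq).comp (tendsto_atTop_mono (fun n => by simp only [id]; omega) tendsto_id))
      fun k => by
        rw [show 2 * (i + k + 1) = 2 * (i + k) + 1 + 1 by ring, qPoch_succ, qPoch_succ]
        ring
    linear_combination this
  · rw [triangle_theta_recurrence hq i]; ring
  · rw [norm_mul]
    gcongr
    exact norm_le_of_tsum_pow hq (norm_triangle_theta_le hq i)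

theorem qPoch_two_mul_self (q : ℂ) (n : ℕ) :
    qPoch q q (2 * n) = qPoch q (q ^ 2) n * qPoch (q ^ 2) (q ^ 2) n := by
  induction n with
  | zero => simp [qPoch]
  | succ n ih =>
    rw [show 2 * (n + 1) = 2 * n + 1 + 1 by ring, qPoch_succ, qPoch_succ, qPoch_succ, qPoch_succ, ih]
    ring

/-- The conjugate Bailey pair in base `q²` with
`δ_n = (q²; q²)_{2n} q^{2n} / ((-q; q²)_n (-q; q²)_{n+1})`. -/
theorem conjugateSum_qPoch_div {q : ℂ} (hq : ‖q‖ < 1) (i : ℕ) :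
    (1 - q ^ (2 * i + 1)) * conjugateSum (q ^ 2) (fun n => qPoch (q ^ 2) (q ^ 2) (2 * n)
        * ((qPoch (-q) (q ^ 2) n)⁻¹ * (qPoch (-q) (q ^ 2) (n + 1))⁻¹)) i
      = qPochInf (q ^ 2) (q ^ 2) * ((qPochInf (-q) (q ^ 2))⁻¹ * (qPochInf (-q) (q ^ 2))⁻¹)
        / (qPochInf (q ^ 2) (q ^ 2) * qPochInf (q ^ 2) (q ^ 2))
        * ∑' m : ℕ, q ^ (m ^ 2 + 2 * (i + 1) * m) := by
  have hq2 := norm_sq_lt_one hq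
  have hne : ∀ k : ℕ, -q * (q ^ 2) ^ k ≠ 1 := mul_pow_ne_one_of_norm_lt (by simpa using hq) hq2
  obtain ⟨B₁, hB₁0, hB₁⟩ := exists_norm_inv_qPoch_le hq2 hne
  set D : ℕ → ℂ := fun n => qPoch (q ^ 2) (q ^ 2) (2 * n)
        * ((qPoch (-q) (q ^ 2) n)⁻¹ * (qPoch (-q) (q ^ 2) (n + 1))⁻¹) with hDdef
  have hD : ∀ n, ‖D n‖ ≤ Real.exp (‖q ^ 2‖ / (1 - ‖q ^ 2‖)) * (B₁ * B₁) := fun n => by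
    rw [hDdef, norm_mul, norm_mul]
    gcongr
    exacts [norm_qPoch_le _ hq2 _, hB₁ _, hB₁ _]
  obtain ⟨B, hB⟩ := exists_norm_conjugateSum_le hq2 hD
  set C := qPochInf (q ^ 2) (q ^ 2) * ((qPochInf (-q) (q ^ 2))⁻¹ * (qPochInf (-q) (q ^ 2))⁻¹)
        / (qPochInf (q ^ 2) (q ^ 2) * qPochInf (q ^ 2) (q ^ 2))
  refine eq_of_affine_recurrence
    (S := fun i => (1 - q ^ (2 * i + 1)) * conjugateSum (q ^ 2) D i)
    (T := fun i => C * ∑' m : ℕ, q ^ (m ^ 2 + 2 * (i + 1) * m))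
    (e := fun i => C) (r := fun i => q ^ (2 * (i + 1) + 1))
    (fun i => ?_) (fun i => ?_)
    (fun i => norm_pow_le_of_pos hq (by omega)) hq
    (fun i => norm_one_sub_le_two hq _ _ (hB i)) (B' := ‖C‖ * (1 - ‖q‖)⁻¹) (fun i => ?_) i
  -- The certificate sequence is `D'_n = (1+q^{2n+1}) D_n`, with `(-q;q²)_n` squared in the
  -- denominator. It telescopes because `1 - q^{4n+2}` in `(q²;q²)_{2n+2}` contains the factor `1 +
  -- q^{2n+1}`.
  · have := conjugateSum_recurrence hq2 (D := D)
      (D' := fun n => qPoch (q ^ 2) (q ^ 2) (2 * n)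
        * ((qPoch (-q) (q ^ 2) n)⁻¹ * (qPoch (-q) (q ^ 2) n)⁻¹)) (a := 1 - q ^ (2 * i + 1))
      (b := q ^ (2 * i + 1) * (1 - q ^ (2 * i + 3))) (v := 1) (i := i) hD
      (Tendsto.mul ((tendsto_qPoch _ hq2).comp
        (tendsto_atTop_mono (fun n => by simp only [id]; omega) tendsto_id))
        (((tendsto_qPoch _ hq2).inv₀ (qPochInf_ne_zero hq2 hne)).mul
          ((tendsto_qPoch _ hq2).inv₀ (qPochInf_ne_zero hq2 hne))))
      fun k => by
        simp only [hDdef]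
        have h1 := qPoch_ne_zero hne (i + k)
        have h2 : 1 - -q * (q ^ 2) ^ (i + k) ≠ 0 := sub_ne_zero.2 (hne _).symm
        rw [show 2 * (i + k + 1) = 2 * (i + k) + 1 + 1 by ring, qPoch_succ (-q),
          qPoch_succ _ _ (2 * (i + k) + 1), qPoch_succ _ _ (2 * (i + k))]
        have h3 : (1 - q ^ 2 * (q ^ 2) ^ (2 * (i + k))) = (1 - -q * (q ^ 2) ^ (i + k))
            * (1 - q * (q ^ 2) ^ (i + k)) := by ring
        rw [h3, show (q ^ 2) ^ (2 * i + 2 + k) = (q ^ 2) ^ i * (q ^ 2) ^ 2 * (q ^ 2) ^ (i + k) by ring]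
        generalize hX : 1 - -q * (q ^ 2) ^ (i + k) = X at *
        field_simp
        rw [← hX]
        ring
    linear_combination this
  · rw [theta_recurrence hq (i + 1)]; ring
  · rw [norm_mul]
    gcongr
    exact norm_le_of_tsum_pow hq (norm_theta_le hq (i + 1))

/-! ### The defining series in terms of `u = 1/ρ₁`, `v = 1/ρ₂`. -/

theorem hasSum_pnat_iff_succPNat {f : ℕ+ → ℂ} {a : ℂ} :
    HasSum f a ↔ HasSum (fun n : ℕ => f n.succPNat) a :=
  Equiv.pnatEquivNat.symm.hasSum_iff.symm

theorem mul_pow_ne_one_of_generic {z q : ℂ} (hz : ∀ k : ℤ, z ≠ q ^ k) (k : ℕ) :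
    z * q ^ k ≠ 1 := fun h => hz (-k) (by
  rw [zpow_neg, zpow_natCast]; exact eq_inv_of_mul_eq_one_left h)

theorem inv_mul_pow_ne_one_of_generic {z q : ℂ} (hz0 : z ≠ 0) (hz : ∀ k : ℤ, z ≠ q ^ k) (k : ℕ) :
    z⁻¹ * q ^ k ≠ 1 := fun h => hz k (by
  rw [zpow_natCast]; exact ((inv_mul_eq_one₀ hz0).1 h))

/-- The series `∑_{n ≥ 1} (z, z⁻¹; q)_n x^n ∏_{j<n} (u - q^j) (v - q^j) / (q; q)_{2n}`. -/
noncomputable def qShiftSeries (z q u v x : ℂ) : ℂ :=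
  ∑' n : ℕ+, qPoch z q n * qPoch z⁻¹ q n / qPoch q q (2 * n)
    * (qShift u q n * qShift v q n * x ^ (n : ℕ))

theorem termF_eq {ρ₁ ρ₂ : ℂ} (h1 : ρ₁ ≠ 0) (h2 : ρ₂ ≠ 0) (z q : ℂ) (n : ℕ) :
    termF ρ₁ ρ₂ z q n = qPoch z q n * qPoch z⁻¹ q n / qPoch q q (2 * n)
      * (qShift ρ₁⁻¹ q n * qShift ρ₂⁻¹ q n * q ^ n) := by
  rw [termF, qShift_inv h1, qShift_inv h2, div_pow, mul_pow]
  ring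

theorem termG_eq {ρ₁ ρ₂ : ℂ} (h1 : ρ₁ ≠ 0) (h2 : ρ₂ ≠ 0) (z q : ℂ) (n : ℕ) :
    termG ρ₁ ρ₂ z q n = qPoch z q n * qPoch z⁻¹ q n / qPoch q q (2 * n)
      * (qShift ρ₁⁻¹ q n * qShift ρ₂⁻¹ q n * (q ^ 2) ^ n) := by
  rw [termG, qShift_inv h1, qShift_inv h2, div_pow, mul_pow]
  ring

/-- The case `ρ₂ = ∞` is `v = 0`: `∏_{j<n} (0 - q^j)` supplies the sign and the triangular power. -/
theorem termFInf_eq {ρ : ℂ} (h : ρ ≠ 0) (z q : ℂ) (n : ℕ) :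
    termFInf ρ z q n = qPoch z q n * qPoch z⁻¹ q n / qPoch q q (2 * n)
      * (qShift ρ⁻¹ q n * qShift 0 q n * q ^ n) := by
  have : n * (n + 1) / 2 = n * (n - 1) / 2 + n := by rw [← triangle_succ, mul_comm]; rfl
  rw [termFInf, qShift_inv h, qShift_zero_left, this, pow_add, inv_pow]
  ring

theorem termGInf_eq {ρ : ℂ} (h : ρ ≠ 0) (z q : ℂ) (n : ℕ) :
    termGInf ρ z q n = qPoch z q n * qPoch z⁻¹ q n / qPoch q q (2 * n)
      * (qShift ρ⁻¹ q n * qShift 0 q n * (q ^ 2) ^ n) := by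
  have : n * (n + 3) / 2 = n * (n - 1) / 2 + 2 * n := by
    have h1 : (n + 1) * n / 2 = n * (n - 1) / 2 + n := triangle_succ n
    have h2 : n * (n + 3) = (n + 1) * n + 2 * n := by ring
    omega
  rw [termGInf, qShift_inv h, qShift_zero_left, this, pow_add, inv_pow, pow_mul]
  ring

theorem genF_eq {ρ₁ ρ₂ : ℂ} (h1 : ρ₁ ≠ 0) (h2 : ρ₂ ≠ 0) (z q : ℂ) :
    genF ρ₁ ρ₂ z q = qPochInf q q / (qPochInf z q * qPochInf z⁻¹ q * qPochInf ρ₁ q * qPochInf ρ₂ q)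
      * qShiftSeries z q ρ₁⁻¹ ρ₂⁻¹ q := by
  simp only [genF, qShiftSeries, termF_eq h1 h2]

theorem genG_eq {ρ₁ ρ₂ : ℂ} (h1 : ρ₁ ≠ 0) (h2 : ρ₂ ≠ 0) (z q : ℂ) :
    genG ρ₁ ρ₂ z q = qPochInf q q / (qPochInf z q * qPochInf z⁻¹ q * qPochInf ρ₁ q * qPochInf ρ₂ q)
      * qShiftSeries z q ρ₁⁻¹ ρ₂⁻¹ (q ^ 2) := by
  simp only [genG, qShiftSeries, termG_eq h1 h2]

theorem genFInf_eq {ρ : ℂ} (h : ρ ≠ 0) (z q : ℂ) :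
    genFInf ρ z q = qPochInf q q / (qPochInf ρ q * qPochInf z q * qPochInf z⁻¹ q)
      * qShiftSeries z q ρ⁻¹ 0 q := by
  simp only [genFInf, qShiftSeries, termFInf_eq h]

theorem genGInf_eq {ρ : ℂ} (h : ρ ≠ 0) (z q : ℂ) :
    genGInf ρ z q = qPochInf q q / (qPochInf ρ q * qPochInf z q * qPochInf z⁻¹ q)
      * qShiftSeries z q ρ⁻¹ 0 (q ^ 2) := by
  simp only [genGInf, qShiftSeries, termGInf_eq h]

theorem qPochInf_zero_left (q : ℂ) : qPochInf 0 q = 1 := by simp [qPochInf]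

theorem norm_inv_mul_inv_mul_lt {a b x : ℂ} (h : ‖x‖ < ‖a * b‖) : ‖a⁻¹ * b⁻¹ * x‖ < 1 := by
  rw [← mul_inv, norm_mul, norm_inv, inv_mul_lt_one₀ ((norm_nonneg x).trans_lt h)]
  exact h

theorem ne_zero_of_norm_lt {a b x : ℂ} (h : ‖x‖ < ‖a * b‖) : a ≠ 0 ∧ b ≠ 0 :=
  mul_ne_zero_iff.1 (norm_pos_iff.1 ((norm_nonneg x).trans_lt h))

/-- The two signs cancel and the two triangular powers double, so the one-parameter expansions have
no alternating sign. -/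
theorem baileyAlpha_mul_qShift_zero (z q : ℂ) (i : ℕ) :
    baileyAlpha z q i * qShift 0 q i
      = zFactor z ((i : ℤ) + 1) * q ^ (2 * (i * (i - 1) / 2)) := by
  have hs : ((-1 : ℂ) ^ i) * (-1) ^ i = 1 := by rw [← mul_pow]; simp
  rw [baileyAlpha, qShift_zero_left]
  linear_combination (zFactor z ((i : ℤ) + 1) * q ^ (2 * (i * (i - 1) / 2))) * hs

theorem neg_one_pow_add_two (i : ℕ) : (-1 : ℂ) ^ (i + 1 + 1) = (-1) ^ i := by
  rw [pow_succ, pow_succ]; ring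

/-! ### Expansions of `F` and `G` and the limits `ρ₂ → ∞`. -/

section
variable {q z : ℂ}

theorem genF_expansion (hq0 : q ≠ 0) (hq1 : ‖q‖ < 1) (hz0 : z ≠ 0) (ρ₁ ρ₂ : ℂ)
    (hρ : ‖q‖ < ‖ρ₁ * ρ₂‖) (hz1 : z ≠ -1) :
    Summable (fun n : ℕ+ => termF ρ₁ ρ₂ z q n) ∧
      HasSum (fun p : ℕ+ =>
          let j : ℕ := p
          zFactor z j * (-1) ^ (j + 1) * q ^ (j * (j - 1) / 2)
            * (qPoch ρ₁ q (j - 1) * qPoch ρ₂ q (j - 1))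
            * (qPochInf (q ^ (j + 1) / ρ₁) q * qPochInf (q ^ (j + 1) / ρ₂) q)
            / ((1 + z) * ρ₁ ^ (j - 1) * ρ₂ ^ (j - 1)
              * (qPochInf z q * qPochInf z⁻¹ q * qPochInf ρ₁ q * qPochInf ρ₂ q
                * qPochInf (q / (ρ₁ * ρ₂)) q))
            * (1 - q ^ j / ρ₁ - q ^ j / ρ₂ + q ^ (3 * j - 1) / ρ₁ + q ^ (3 * j - 1) / ρ₂
              - q ^ (4 * j - 2)))
        (genF ρ₁ ρ₂ z q) := by
  obtain ⟨hρ1, hρ2⟩ := ne_zero_of_norm_lt hρ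
  have hx := norm_inv_mul_inv_mul_lt hρ
  refine ⟨(summable_bailey z hq1 (summable_norm_qShift hq1 hx)).congr
    fun n => (termF_eq hρ1 hρ2 z q n).symm, ?_⟩
  have hz1' : 1 + z ≠ 0 := fun h => hz1 (by linear_combination h)
  have hP := qPochInf_self_ne_zero hq1
  rw [hasSum_pnat_iff_succPNat]
  refine hasSum_of_eq ((hasSum_qShift_self hq0 hq1 hz0 hx).mul_left (qPochInf q q
    / (qPochInf z q * qPochInf z⁻¹ q * qPochInf ρ₁ q * qPochInf ρ₂ q) / (1 + z))) (fun i => ?_) ?_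
  · simp only [Nat.succPNat_coe, Nat.succ_eq_add_one, Nat.add_sub_cancel]
    rw [show 3 * (i + 1) - 1 = 3 * i + 2 by omega, show 4 * (i + 1) - 2 = 4 * i + 2 by omega,
      qShift_inv hρ1, qShift_inv hρ2, baileyAlpha, neg_one_pow_add_two]
    have e1 : (i + 1) * i / 2 = i * (i - 1) / 2 + i := triangle_succ i
    rw [e1, pow_add _ (i * (i - 1) / 2), div_eq_inv_mul _ ρ₁, div_eq_inv_mul _ ρ₂,
      div_eq_inv_mul _ (ρ₁ * ρ₂), mul_inv]
    push_cast
    rw [show i + 2 = i + 1 + 1 from rfl]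
    -- With the products as atoms, the only cancellation needed is that of `(q;q)_∞`; all other
    -- inverses are carried along formally.
    generalize qPochInf (ρ₁⁻¹ * q ^ (i + 1 + 1)) q = W₁ at *
    generalize qPochInf (ρ₂⁻¹ * q ^ (i + 1 + 1)) q = W₂ at *
    generalize qPochInf (ρ₁⁻¹ * ρ₂⁻¹ * _) q = X at *
    generalize qPochInf z q = Z at *
    generalize qPochInf z⁻¹ q = Z' at *
    generalize qPochInf ρ₁ q = R₁ at *
    generalize qPochInf ρ₂ q = R₂ at *
    generalize qPochInf q q = Q at *
    generalize qPoch ρ₁ q i = r₁ at *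
    generalize qPoch ρ₂ q i = r₂ at *
    generalize zFactor z _ = c at *
    generalize 1 + z = y at *
    have hQ : Q * Q⁻¹ = 1 := mul_inv_cancel₀ hP
    simp only [div_eq_mul_inv, mul_inv]
    linear_combination (-(c * (-1) ^ i * q ^ (i * (i - 1) / 2) * q ^ i * r₁ * r₂ * W₁ * W₂ * y⁻¹
      * (ρ₁ ^ i)⁻¹ * (ρ₂ ^ i)⁻¹ * Z⁻¹ * Z'⁻¹ * R₁⁻¹ * R₂⁻¹ * X⁻¹
      * (1 - ρ₁⁻¹ * q ^ (i + 1) - ρ₂⁻¹ * q ^ (i + 1) + ρ₁⁻¹ * q ^ (3 * i + 2)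
        + ρ₂⁻¹ * q ^ (3 * i + 2) - q ^ (4 * i + 2)))) * hQ
  · rw [genF_eq hρ1 hρ2, qShiftSeries]
    field_simp

theorem genG_expansion (hq0 : q ≠ 0) (hq1 : ‖q‖ < 1) (hz0 : z ≠ 0) (ρ₁ ρ₂ : ℂ)
    (hρ : ‖q ^ 2‖ < ‖ρ₁ * ρ₂‖) (hz1 : z ≠ -1) :
      Summable (fun n : ℕ+ => termG ρ₁ ρ₂ z q n) ∧
      HasSum (fun p : ℕ+ =>
          let j : ℕ := p
          zFactor z j * (-1) ^ (j + 1) * (1 - q ^ (2 * j - 1)) * q ^ (j * (j + 1) / 2 - 1)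
            * (qPoch ρ₁ q (j - 1) * qPoch ρ₂ q (j - 1))
            * (qPochInf (q ^ (j + 1) / ρ₁) q * qPochInf (q ^ (j + 1) / ρ₂) q)
            / ((1 + z) * ρ₁ ^ (j - 1) * ρ₂ ^ (j - 1)
              * (qPochInf z q * qPochInf z⁻¹ q * qPochInf ρ₁ q * qPochInf ρ₂ q
                * qPochInf (q ^ 2 / (ρ₁ * ρ₂)) q)))
        (genG ρ₁ ρ₂ z q) := by
  obtain ⟨hρ1, hρ2⟩ := ne_zero_of_norm_lt hρ
  have hx := norm_inv_mul_inv_mul_lt hρ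
  refine ⟨(summable_bailey z hq1 (summable_norm_qShift hq1 hx)).congr
    fun n => (termG_eq hρ1 hρ2 z q n).symm, ?_⟩
  have hz1' : 1 + z ≠ 0 := fun h => hz1 (by linear_combination h)
  have hP := qPochInf_self_ne_zero hq1
  rw [hasSum_pnat_iff_succPNat]
  refine hasSum_of_eq ((hasSum_qShift_sq hq0 hq1 hz0 hx).mul_left (qPochInf q q
    / (qPochInf z q * qPochInf z⁻¹ q * qPochInf ρ₁ q * qPochInf ρ₂ q) / (1 + z))) (fun i => ?_) ?_
  · simp only [Nat.succPNat_coe, Nat.succ_eq_add_one, Nat.add_sub_cancel]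
    have e1 : (i + 1) * (i + 1 + 1) / 2 - 1 = i * (i - 1) / 2 + 2 * i := by
      rw [mul_comm]
      have h3 : (i + 1 + 1) * (i + 1) / 2 = (i + 1) * i / 2 + (i + 1) := triangle_succ (i + 1)
      have h4 : (i + 1) * i / 2 = i * (i - 1) / 2 + i := triangle_succ i
      omega
    rw [show 2 * (i + 1) - 1 = 2 * i + 1 by omega,
      qShift_inv hρ1, qShift_inv hρ2, baileyAlpha, neg_one_pow_add_two,
      e1, pow_add _ (i * (i - 1) / 2), div_eq_inv_mul _ ρ₁, div_eq_inv_mul _ ρ₂,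
      div_eq_inv_mul _ (ρ₁ * ρ₂), mul_inv, pow_mul q 2 i]
    push_cast
    rw [show i + 2 = i + 1 + 1 from rfl]
    generalize qPochInf (ρ₁⁻¹ * q ^ (i + 1 + 1)) q = W₁ at *
    generalize qPochInf (ρ₂⁻¹ * q ^ (i + 1 + 1)) q = W₂ at *
    generalize qPochInf (ρ₁⁻¹ * ρ₂⁻¹ * _) q = X at *
    generalize qPochInf z q = Z at *
    generalize qPochInf z⁻¹ q = Z' at *
    generalize qPochInf ρ₁ q = R₁ at *
    generalize qPochInf ρ₂ q = R₂ at *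
    generalize qPochInf q q = Q at *
    generalize qPoch ρ₁ q i = r₁ at *
    generalize qPoch ρ₂ q i = r₂ at *
    generalize zFactor z _ = c at *
    generalize 1 + z = y at *
    have hQ : Q * Q⁻¹ = 1 := mul_inv_cancel₀ hP
    generalize 1 - q ^ (2 * i + 1) = E
    simp only [div_eq_mul_inv, mul_inv]
    linear_combination (-(c * (-1) ^ i * q ^ (i * (i - 1) / 2) * (q ^ 2) ^ i * r₁ * r₂ * W₁ * W₂
      * y⁻¹ * (ρ₁ ^ i)⁻¹ * (ρ₂ ^ i)⁻¹ * Z⁻¹ * Z'⁻¹ * R₁⁻¹ * R₂⁻¹ * X⁻¹ * E)) * hQ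
  · rw [genG_eq hρ1 hρ2, qShiftSeries]
    field_simp

/-- A majorant valid for all `‖v‖ < ε` at once, from `‖v - q^j‖ ≤ ε + ‖q‖^j`; the ratio of
consecutive terms tends to `‖u‖ ε ‖x‖`. -/
theorem summable_real_qShift {u x q : ℂ} {ε : ℝ} (hε : 0 ≤ ε) (hq : ‖q‖ < 1)
    (hx : ‖u‖ * ε * ‖x‖ < 1) :
    Summable fun n => ‖qShift u q n‖ * (∏ j ∈ Finset.range n, (ε + ‖q‖ ^ j)) * ‖x‖ ^ n := by
  obtain ⟨r, hr1, hr2⟩ := exists_between hx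
  refine summable_of_ratio_norm_eventually_le hr2 ?_
  have h : Tendsto (fun n : ℕ => ‖u - q ^ n‖ * (ε + ‖q‖ ^ n) * ‖x‖) atTop
      (𝓝 (‖u - 0‖ * (ε + 0) * ‖x‖)) :=
    ((((tendsto_pow_atTop_nhds_zero_of_norm_lt_one hq).const_sub u).norm).mul
      ((tendsto_pow_atTop_nhds_zero_of_lt_one (norm_nonneg _) hq).const_add ε)).mul_const _
  rw [sub_zero, add_zero] at h
  filter_upwards [h.eventually_le_const hr1] with n hn
  have hpos : 0 ≤ ∏ j ∈ Finset.range n, (ε + ‖q‖ ^ j) :=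
    Finset.prod_nonneg fun j _ => by positivity
  have hpos' : 0 ≤ ∏ j ∈ Finset.range (n + 1), (ε + ‖q‖ ^ j) :=
    Finset.prod_nonneg fun j _ => by positivity
  rw [Real.norm_of_nonneg (by positivity), Real.norm_of_nonneg (by positivity), qShift_succ,
    Finset.prod_range_succ, pow_succ, norm_mul]
  calc _ = (‖u - q ^ n‖ * (ε + ‖q‖ ^ n) * ‖x‖) * (‖qShift u q n‖
        * (∏ j ∈ Finset.range n, (ε + ‖q‖ ^ j)) * ‖x‖ ^ n) := by ring
    _ ≤ _ := by gcongr

theorem tendsto_qShiftSeries (z u x : ℂ) {q : ℂ} (hq : ‖q‖ < 1) :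
    Tendsto (fun v => qShiftSeries z q u v x) (𝓝 0) (𝓝 (qShiftSeries z q u 0 x)) := by
  obtain ⟨B, hB0, hB⟩ := exists_norm_inv_qPoch_le hq (self_mul_pow_ne_one hq)
  -- This radius makes the limiting ratio `‖u‖ ε ‖x‖` less than `1`.
  set ε : ℝ := (‖u‖ * ‖x‖ + 1)⁻¹ with hεdef
  have hpos : 0 < ‖u‖ * ‖x‖ + 1 := by positivity
  have hε : 0 < ε := by positivity
  have hlt : ‖u‖ * ε * ‖x‖ < 1 := by
    rw [hεdef, mul_right_comm, ← div_eq_mul_inv, div_lt_one hpos]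
    linarith
  have hs := (summable_real_qShift hε.le hq hlt).mul_left
    (Real.exp (‖z‖ / (1 - ‖q‖)) * Real.exp (‖z⁻¹‖ / (1 - ‖q‖)) * B)
  refine tendsto_tsum_of_dominated_convergence
    (hs.comp_injective PNat.coe_injective) (fun n => ?_) ?_
  · refine Tendsto.const_mul _ (Tendsto.mul_const _ (Tendsto.const_mul _ ?_))
    exact (continuous_qShift q n).tendsto 0
  · filter_upwards [Metric.ball_mem_nhds (0 : ℂ) hε] with v hv n
    rw [mem_ball_zero_iff] at hv
    simp only [Function.comp]
    rw [norm_mul, div_eq_mul_inv, norm_mul, norm_mul, norm_mul, norm_mul, norm_pow]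
    gcongr
    · exact norm_qPoch_le z hq n
    · exact norm_qPoch_le z⁻¹ hq n
    · exact hB _
    · rw [qShift, norm_prod]
      refine Finset.prod_le_prod (fun _ _ => norm_nonneg _) fun j _ => ?_
      refine (norm_sub_le _ _).trans ?_
      rw [norm_pow]
      gcongr

/-- Multiplying by `(ρ;q)_∞` leaves a function of `ρ⁻¹` alone, and `ρ⁻¹ → 0` as `ρ → ∞`. -/
theorem tendsto_qPochInf_mul (z u x A : ℂ) {q : ℂ} (hq : ‖q‖ < 1) {g : ℂ → ℂ}
    (hg : ∀ ρ : ℂ, ρ ≠ 0 → (∀ k : ℕ, ρ * q ^ k ≠ 1) →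
      qPochInf ρ q * g ρ = A * qShiftSeries z q u ρ⁻¹ x) :
    Tendsto (fun ρ => qPochInf ρ q * g ρ)
      (Bornology.cobounded ℂ ⊓ 𝓟 {ρ | ∀ k : ℕ, ρ * q ^ k ≠ 1})
      (𝓝 (A * qShiftSeries z q u 0 x)) := by
  have h1 : Tendsto (fun ρ : ℂ => A * qShiftSeries z q u ρ⁻¹ x)
      (Bornology.cobounded ℂ ⊓ 𝓟 {ρ | ∀ k : ℕ, ρ * q ^ k ≠ 1})
      (𝓝 (A * qShiftSeries z q u 0 x)) :=
    ((tendsto_qShiftSeries z u x hq).comp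
      (tendsto_inv₀_cobounded.mono_left inf_le_left)).const_mul A
  refine h1.congr' ?_
  have h2 : ∀ᶠ ρ in Bornology.cobounded ℂ, ρ ≠ (0 : ℂ) := Bornology.eventually_ne_cobounded 0
  filter_upwards [mem_inf_of_left h2, mem_inf_of_right (mem_principal_self _)] with ρ h3 h4
  exact (hg ρ h3 h4).symm

theorem genFInf_expansion (hq0 : q ≠ 0) (hq1 : ‖q‖ < 1) (hz0 : z ≠ 0) (ρ : ℂ) (hρ : ρ ≠ 0) :
      Summable (fun n : ℕ+ => termFInf ρ z q n) ∧
      Tendsto (fun ρ₂ => qPochInf ρ₂ q * genF ρ ρ₂ z q)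
        (Bornology.cobounded ℂ ⊓ 𝓟 {ρ₂ | ∀ k : ℕ, ρ₂ * q ^ k ≠ 1}) (𝓝 (genFInf ρ z q)) ∧
      (z ≠ -1 → HasSum (fun p : ℕ+ =>
          let j : ℕ := p
          zFactor z j * q ^ ((j - 1) ^ 2) * qPoch ρ q (j - 1) * qPochInf (q ^ (j + 1) / ρ) q
            / ((1 + z) * ρ ^ (j - 1) * (qPochInf z q * qPochInf z⁻¹ q * qPochInf ρ q))
            * (1 - q ^ j / ρ + q ^ (3 * j - 1) / ρ - q ^ (4 * j - 2)))
        (genFInf ρ z q)) := by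
  have hx : ‖ρ⁻¹ * 0 * q‖ < 1 := by simp
  refine ⟨(summable_bailey z hq1 (summable_norm_qShift hq1 hx)).congr
    fun n => (termFInf_eq hρ z q n).symm, ?_, fun hz1 => ?_⟩
  · rw [genFInf_eq hρ]
    refine tendsto_qPochInf_mul z ρ⁻¹ q _ hq1 fun ρ₂ h2 h3 => ?_
    have := qPochInf_ne_zero hq1 h3
    rw [genF_eq hρ h2]
    field_simp
  · have hz1' : 1 + z ≠ 0 := fun h => hz1 (by linear_combination h)
    have hP := qPochInf_self_ne_zero hq1
    rw [hasSum_pnat_iff_succPNat]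
    refine hasSum_of_eq ((hasSum_qShift_self hq0 hq1 hz0 hx).mul_left (qPochInf q q
      / (qPochInf ρ q * qPochInf z q * qPochInf z⁻¹ q) / (1 + z))) (fun i => ?_) ?_
    · simp only [Nat.succPNat_coe, Nat.succ_eq_add_one, Nat.add_sub_cancel]
      rw [show 3 * (i + 1) - 1 = 3 * i + 2 by omega, show 4 * (i + 1) - 2 = 4 * i + 2 by omega,
        qShift_inv hρ, pow_two i, ← two_mul_triangle i,
        div_eq_inv_mul _ ρ, mul_zero, zero_mul, zero_mul, zero_mul, qPochInf_zero_left]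
      have hA := baileyAlpha_mul_qShift_zero z q i
      rw [show i + 2 = i + 1 + 1 from rfl]
      push_cast
      generalize baileyAlpha z q i = A at *
      generalize qShift 0 q i = S at *
      generalize qPochInf (ρ⁻¹ * q ^ (i + 1 + 1)) q = W at *
      generalize qPochInf z q = Z at *
      generalize qPochInf z⁻¹ q = Z' at *
      generalize qPochInf ρ q = R at *
      generalize qPochInf q q = Q at *
      generalize qPoch ρ q i = r at *
      generalize zFactor z _ = c at *
      generalize 1 + z = y at *
      trans A * S * (Q / (R * Z * Z') / y * (r / ρ ^ i * q ^ i * W / Q * (1 - ρ⁻¹ * q ^ (i + 1)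
        + ρ⁻¹ * q ^ (3 * i + 2) - q ^ (4 * i + 2))))
      · rw [hA]
        field_simp
        ring
      · ring
    · rw [genFInf_eq hρ, qShiftSeries]
      field_simp

theorem genGInf_expansion (hq0 : q ≠ 0) (hq1 : ‖q‖ < 1) (hz0 : z ≠ 0) (ρ : ℂ) (hρ : ρ ≠ 0) :
      Summable (fun n : ℕ+ => termGInf ρ z q n) ∧
      Tendsto (fun ρ₂ => qPochInf ρ₂ q * genG ρ ρ₂ z q)
        (Bornology.cobounded ℂ ⊓ 𝓟 {ρ₂ | ∀ k : ℕ, ρ₂ * q ^ k ≠ 1}) (𝓝 (genGInf ρ z q)) ∧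
      (z ≠ -1 → HasSum (fun p : ℕ+ =>
          let j : ℕ := p
          zFactor z j * (1 - q ^ (2 * j - 1)) * q ^ (j * (j - 1)) * qPoch ρ q (j - 1)
            * qPochInf (q ^ (j + 1) / ρ) q
            / ((1 + z) * ρ ^ (j - 1) * (qPochInf z q * qPochInf z⁻¹ q * qPochInf ρ q)))
        (genGInf ρ z q)) := by
  have hx : ‖ρ⁻¹ * 0 * q ^ 2‖ < 1 := by simp
  refine ⟨(summable_bailey z hq1 (summable_norm_qShift hq1 hx)).congr
    fun n => (termGInf_eq hρ z q n).symm, ?_, fun hz1 => ?_⟩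
  · rw [genGInf_eq hρ]
    refine tendsto_qPochInf_mul z ρ⁻¹ (q ^ 2) _ hq1 fun ρ₂ h2 h3 => ?_
    have := qPochInf_ne_zero hq1 h3
    rw [genG_eq hρ h2]
    field_simp
  · have hz1' : 1 + z ≠ 0 := fun h => hz1 (by linear_combination h)
    have hP := qPochInf_self_ne_zero hq1
    rw [hasSum_pnat_iff_succPNat]
    refine hasSum_of_eq ((hasSum_qShift_sq hq0 hq1 hz0 hx).mul_left (qPochInf q q
      / (qPochInf ρ q * qPochInf z q * qPochInf z⁻¹ q) / (1 + z))) (fun i => ?_) ?_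
    · simp only [Nat.succPNat_coe, Nat.succ_eq_add_one, Nat.add_sub_cancel]
      rw [show 2 * (i + 1) - 1 = 2 * i + 1 by omega, add_mul i 1 i, one_mul,
        qShift_inv hρ, ← two_mul_triangle i,
        div_eq_inv_mul _ ρ, mul_zero, zero_mul, zero_mul, qPochInf_zero_left]
      have hA := baileyAlpha_mul_qShift_zero z q i
      rw [show i + 2 = i + 1 + 1 from rfl]
      push_cast
      generalize baileyAlpha z q i = A at *
      generalize qShift 0 q i = S at *
      generalize qPochInf (ρ⁻¹ * q ^ (i + 1 + 1)) q = W at *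
      generalize qPochInf z q = Z at *
      generalize qPochInf z⁻¹ q = Z' at *
      generalize qPochInf ρ q = R at *
      generalize qPochInf q q = Q at *
      generalize qPoch ρ q i = r at *
      generalize zFactor z _ = c at *
      generalize 1 + z = y at *
      trans A * S * (Q / (R * Z * Z') / y * ((1 - q ^ (2 * i + 1)) * (r / ρ ^ i * (q ^ 2) ^ i * W / Q)))
      · rw [hA]
        field_simp
        ring
      · ring
    · rw [genGInf_eq hρ, qShiftSeries]
      field_simp

end

/-! ### The double series for `S_{L7}`, `S_{L9}` and `S_{L12}`. -/

theorem summable_norm_mul_pow_of_le {q : ℂ} (hq : ‖q‖ < 1) {D : ℕ → ℂ} {M : ℝ}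
    (hD : ∀ n, ‖D n‖ ≤ M) : Summable fun n => ‖D n * q ^ n‖ :=
  Summable.of_nonneg_of_le (fun _ => norm_nonneg _)
    (fun n => by rw [norm_mul, norm_pow]; gcongr; exact hD n)
    ((summable_geometric_of_lt_one (norm_nonneg _) hq).mul_left M)

theorem hasSum_bailey_conjugateSum {z q : ℂ} (hq0 : q ≠ 0) (hq : ‖q‖ < 1) (hz : z ≠ 0)
    {D : ℕ → ℂ} {M : ℝ} (hD : ∀ n, ‖D n‖ ≤ M) :
    HasSum (fun i => baileyAlpha z q i * ((1 - q ^ (2 * i + 1)) * (q ^ i * conjugateSum q D i)))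
      ((1 + z) * ∑' n : ℕ+, qPoch z q n * qPoch z⁻¹ q n / qPoch q q (2 * n) * (D n * q ^ (n : ℕ))) :=
  hasSum_bailey (δ := fun n => D n * q ^ n) hq0 hq hz (summable_norm_mul_pow_of_le hq hD) fun i =>
    ((hasSum_baileyKernel_conjugateSum hq hD i).mul_left (1 - q ^ (2 * i + 1))).congr_fun
      fun n => by ring

/-- The bound on `g` is uniform in `i`, so the double series converges absolutely and its sum is the
iterated one. -/
theorem hasSum_pnat_prod {q : ℂ} (hq : ‖q‖ < 1) {a : ℕ → ℂ} (ha : Summable fun i => ‖a i‖)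
    {g : ℕ → ℕ → ℂ} (hg : ∀ i m, ‖g i m‖ ≤ ‖q‖ ^ m) {T : ℂ}
    (h : HasSum (fun i => a i * ∑' m, g i m) T) {F : ℕ+ × ℕ → ℂ}
    (hF : ∀ i m, F (i.succPNat, m) = a i * g i m) : HasSum F T := by
  have hs : Summable fun p : ℕ × ℕ => a p.1 * g p.1 p.2 :=
    Summable.of_norm_bounded (ha.mul_of_nonneg (summable_geometric_of_lt_one (norm_nonneg q) hq)
      (fun _ => norm_nonneg _) fun _ => by positivity) fun p => by
        rw [norm_mul]; gcongr; exact hg _ _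
  have h1 := hs.hasSum.prod_fiberwise fun i =>
    (summable_of_norm_le_pow hq (hg i)).hasSum.mul_left (a i)
  have h2 := hs.hasSum
  rw [h1.unique h] at h2
  refine ((Equiv.prodCongr Equiv.pnatEquivNat.symm (Equiv.refl ℕ)).hasSum_iff).1
    (h2.congr_fun fun p => ?_)
  exact hF p.1 p.2

theorem tendsto_qPoch_two_mul (z : ℂ) {q : ℂ} (hq : ‖q‖ < 1) :
    Tendsto (fun n => qPoch z q (2 * n)) atTop (𝓝 (qPochInf z q)) :=
  (tendsto_qPoch z hq).comp (tendsto_atTop_mono (fun n => by simp only [id]; omega) tendsto_id)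

theorem qPochInf_self_eq_mul {q : ℂ} (hq : ‖q‖ < 1) :
    qPochInf q q = qPochInf q (q ^ 2) * qPochInf (q ^ 2) (q ^ 2) := by
  have hq2 := norm_sq_lt_one hq
  refine tendsto_nhds_unique (tendsto_qPoch_two_mul q hq) ?_
  simp only [qPoch_two_mul_self]
  exact (tendsto_qPoch q hq2).mul (tendsto_qPoch (q ^ 2) hq2)

theorem qPoch_mul_qPoch_neg (z q : ℂ) (n : ℕ) :
    qPoch z q n * qPoch (-z) q n = qPoch (z ^ 2) (q ^ 2) n := by
  simp only [qPoch, ← Finset.prod_mul_distrib]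
  exact Finset.prod_congr rfl fun j _ => by ring

theorem qPochInf_mul_qPochInf_neg (z : ℂ) {q : ℂ} (hq : ‖q‖ < 1) :
    qPochInf z q * qPochInf (-z) q = qPochInf (z ^ 2) (q ^ 2) := by
  refine tendsto_nhds_unique ((tendsto_qPoch z hq).mul (tendsto_qPoch (-z) hq)) ?_
  simp only [qPoch_mul_qPoch_neg]
  exact tendsto_qPoch _ (norm_sq_lt_one hq)

theorem neg_self_mul_pow_ne_one {q : ℂ} (hq : ‖q‖ < 1) (k : ℕ) : -q * q ^ k ≠ 1 :=
  mul_pow_ne_one_of_norm_lt (by rwa [norm_neg]) hq k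

section
variable {q z : ℂ}

theorem summable_norm_baileyAlpha_mul (hq0 : q ≠ 0) (hq : ‖q‖ < 1) (hz0 : z ≠ 0) {b : ℕ → ℂ}
    {M : ℝ} (hb : ∀ i, ‖b i‖ ≤ M) : Summable fun i => ‖baileyAlpha z q i * b i‖ :=
  Summable.of_nonneg_of_le (fun _ => norm_nonneg _)
    (fun n => by rw [norm_mul, mul_comm M]; gcongr; exact hb n)
    ((summable_norm_baileyAlpha hq0 hq hz0).mul_left M)

theorem norm_one_add_pow_le (hq : ‖q‖ < 1) (k : ℕ) : ‖1 + q ^ k‖ ≤ 2 := by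
  refine (norm_add_le _ _).trans ?_
  rw [norm_one, norm_pow]
  linarith [pow_le_one₀ (norm_nonneg q) hq.le (n := k)]

theorem norm_pow_le_one (hq : ‖q‖ < 1) (k : ℕ) : ‖q ^ k‖ ≤ 1 := by
  rw [norm_pow]; exact pow_le_one₀ (norm_nonneg q) hq.le

theorem sL9_expansion (hq0 : q ≠ 0) (hq1 : ‖q‖ < 1) (hz0 : z ≠ 0) (hz1 : z ≠ -1) :
    Summable (fun n : ℕ+ => termL9 z q n) ∧
      ∃ T : ℂ, HasSum (fun p : ℕ+ × ℕ =>
          let j : ℕ := p.1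
          let n : ℕ := p.2
          zFactor z j * (-1) ^ (j + n + 1) * (1 - q ^ (2 * j - 1))
            * q ^ (j * (j - 1) / 2 + n ^ 2 + 2 * j * n)) T ∧
        sL9 z q = 1 / ((1 + z) * (qPochInf q q * qPochInf z q * qPochInf z⁻¹ q)) * T := by
  have hq2 := norm_sq_lt_one hq1
  have hD := norm_qPoch_le (q ^ 2) hq2
  have hP := qPochInf_self_ne_zero hq1
  have hP2 := qPochInf_self_ne_zero hq2
  have hz1' : 1 + z ≠ 0 := fun h => hz1 (by linear_combination h)
  -- The splitting `(q;q)_{2n} = (q;q²)_n (q²;q²)_n` exhibits the weight `δ_n = (q²;q²)_n q^n`.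
  have ht : ∀ n, termL9 z q n = qPoch z q n * qPoch z⁻¹ q n / qPoch q q (2 * n)
      * (qPoch (q ^ 2) (q ^ 2) n * q ^ n) := fun n => by
    have := qPoch_self_ne_zero hq2 n
    rw [termL9, qPoch_two_mul_self]
    field_simp
  refine ⟨(summable_bailey z hq1 (summable_norm_mul_pow_of_le hq1 hD)).congr fun n => (ht n).symm,
    _, hasSum_pnat_prod hq1 (a := fun i => baileyAlpha z q i * ((1 - q ^ (2 * i + 1)) * q ^ i))
      (g := fun i m => (-1) ^ m * q ^ (m ^ 2 + 2 * (i + 1) * m))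
      (summable_norm_baileyAlpha_mul hq0 hq1 hz0 (M := 2 * 1) fun i => ?_)
      (fun i m => norm_alternating_theta_le hq1 (i + 1) m)
      (((hasSum_bailey_conjugateSum hq0 hq1 hz0 hD).mul_left
        (qPochInf q q * qPochInf q q / qPochInf (q ^ 2) (q ^ 2))).congr_fun fun i => ?_)
      fun i m => ?_, ?_⟩
  · rw [norm_mul]
    exact mul_le_mul (norm_one_sub_pow_le hq1 _) (norm_pow_le_one hq1 i) (norm_nonneg _) zero_le_two
  · rw [conjugateSum_qPoch_sq hq1]
    field_simp
  · simp only [Nat.succPNat_coe, Nat.succ_eq_add_one, Nat.add_sub_cancel]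
    have e1 : (i + 1) * i / 2 = i * (i - 1) / 2 + i := triangle_succ i
    rw [e1, show 2 * (i + 1) - 1 = 2 * i + 1 by omega, show i + 1 + m + 1 = i + m + 2 by omega,
      baileyAlpha]
    push_cast
    ring
  · simp only [sL9, ht]
    rw [qPochInf_self_eq_mul hq1] at hP ⊢
    have := left_ne_zero_of_mul hP
    field_simp

theorem summable_norm_baileyAlpha_sq_mul (hq0 : q ≠ 0) (hq1 : ‖q‖ < 1) (hz0 : z ≠ 0) :
    Summable fun i => ‖baileyAlpha z (q ^ 2) i * ((1 + q ^ (2 * i + 1)) * (q ^ 2) ^ i)‖ := by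
  have hq2 := norm_sq_lt_one hq1
  refine summable_norm_baileyAlpha_mul (pow_ne_zero 2 hq0) hq2 hz0 (M := 2 * 1) fun i => ?_
  rw [norm_mul]
  exact mul_le_mul (norm_one_add_pow_le hq1 _) (norm_pow_le_one hq2 i) (norm_nonneg _) zero_le_two

theorem baileyAlpha_sq_mul_pow (z q : ℂ) (i : ℕ) :
    baileyAlpha z (q ^ 2) i * (q ^ 2) ^ i
      = zFactor z ((i : ℤ) + 1) * (-1) ^ i * q ^ (i * i + i) := by
  rw [baileyAlpha, ← pow_mul, ← pow_mul, ← two_mul_triangle i]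
  ring

theorem one_sub_sq_pow (q : ℂ) (i : ℕ) :
    1 - (q ^ 2) ^ (2 * i + 1) = (1 + q ^ (2 * i + 1)) * (1 - q ^ (2 * i + 1)) := by
  ring

theorem sL7_expansion (hq0 : q ≠ 0) (hq1 : ‖q‖ < 1) (hz0 : z ≠ 0) (hz1 : z ≠ -1) :
      Summable (fun n : ℕ+ => termL7 z q n) ∧
      ∃ T : ℂ, HasSum (fun p : ℕ+ × ℕ =>
          let j : ℕ := p.1
          let n : ℕ := p.2
          zFactor z j * (-1) ^ (j + 1) * (1 + q ^ (2 * j - 1))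
            * q ^ (j * (j - 1) + n * (n - 1) / 2 + 2 * j * n)) T ∧
        sL7 z q = 1 / ((1 + z) * (qPochInf (q ^ 2) (q ^ 2) * qPochInf z (q ^ 2)
          * qPochInf z⁻¹ (q ^ 2))) * T := by
  have hq2 := norm_sq_lt_one hq1
  have hD : ∀ n, ‖qPoch q q (2 * n)‖ ≤ _ := fun n => norm_qPoch_le q hq1 (2 * n)
  have hP := qPochInf_self_ne_zero hq1
  have hP2 := qPochInf_self_ne_zero hq2
  have hN := qPochInf_ne_zero hq1 (neg_self_mul_pow_ne_one hq1)
  have hz1' : 1 + z ≠ 0 := fun h => hz1 (by linear_combination h)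
  -- In base `q²`, `1/(-q;q)_{2n} = (q;q)_{2n}/(q²;q²)_{2n}`, so the weight is `(q;q)_{2n} q^{2n}`.
  have ht : ∀ n, termL7 z q n = qPoch z (q ^ 2) n * qPoch z⁻¹ (q ^ 2) n
      / qPoch (q ^ 2) (q ^ 2) (2 * n) * (qPoch q q (2 * n) * (q ^ 2) ^ n) := fun n => by
    have := qPoch_self_ne_zero hq1 (2 * n)
    rw [termL7, ← qPoch_mul_qPoch_neg, ← pow_mul]
    field_simp
  refine ⟨(summable_bailey z hq2 (summable_norm_mul_pow_of_le hq2 hD)).congr fun n => (ht n).symm,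
    _, hasSum_pnat_prod hq1
      (a := fun i => baileyAlpha z (q ^ 2) i * ((1 + q ^ (2 * i + 1)) * (q ^ 2) ^ i))
      (g := fun i m => q ^ (m * (m - 1) / 2 + 2 * (i + 1) * m))
      (summable_norm_baileyAlpha_sq_mul hq0 hq1 hz0)
      (norm_triangle_theta_le hq1)
      (((hasSum_bailey_conjugateSum (pow_ne_zero 2 hq0) hq2 hz0 hD).mul_left
        (qPochInf (q ^ 2) (q ^ 2) * qPochInf (q ^ 2) (q ^ 2) / qPochInf q q)).congr_fun
        fun i => ?_)
      fun i m => ?_, ?_⟩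
  -- Of the factors of `1 - q^{4i+2}`, `1 - q^{2i+1}` is absorbed by the conjugate pair and `1 +
  -- q^{2i+1}` survives in the expansion.
  · rw [one_sub_sq_pow]
    have h := conjugateSum_qPoch_two_mul hq1 i
    have hc : qPochInf (q ^ 2) (q ^ 2) * qPochInf (q ^ 2) (q ^ 2) / qPochInf q q
        * (qPochInf q q / (qPochInf (q ^ 2) (q ^ 2) * qPochInf (q ^ 2) (q ^ 2))) = 1 := by
      field_simp
    linear_combination (-(baileyAlpha z (q ^ 2) i * ((1 + q ^ (2 * i + 1)) * (q ^ 2) ^ i)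
      * ∑' m, q ^ (m * (m - 1) / 2 + 2 * (i + 1) * m))) * hc
      - qPochInf (q ^ 2) (q ^ 2) * qPochInf (q ^ 2) (q ^ 2) / qPochInf q q *
      (baileyAlpha z (q ^ 2) i * ((1 + q ^ (2 * i + 1)) * (q ^ 2) ^ i)) * h
  · simp only [Nat.succPNat_coe, Nat.succ_eq_add_one, Nat.add_sub_cancel]
    rw [show 2 * (i + 1) - 1 = 2 * i + 1 by omega, neg_one_pow_add_two,
      show (i + 1) * i + m * (m - 1) / 2 + 2 * (i + 1) * m
        = i * i + i + (m * (m - 1) / 2 + 2 * (i + 1) * m) by ring, pow_add _ (i * i + i)]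
    push_cast
    linear_combination (-((1 + q ^ (2 * i + 1)) * q ^ (m * (m - 1) / 2 + 2 * (i + 1) * m)))
      * baileyAlpha_sq_mul_pow z q i
  · simp only [sL7, ht]
    rw [← qPochInf_mul_qPochInf_neg q hq1] at hP2 ⊢
    field_simp

theorem sL12_expansion (hq0 : q ≠ 0) (hq1 : ‖q‖ < 1) (hz0 : z ≠ 0) (hz1 : z ≠ -1) :
      Summable (fun n : ℕ+ => termL12 z q n) ∧
      ∃ T : ℂ, HasSum (fun p : ℕ+ × ℕ =>
          let j : ℕ := p.1
          let n : ℕ := p.2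
          zFactor z j * (-1) ^ (j + 1) * (1 + q ^ (2 * j - 1))
            * q ^ (j * (j - 1) + n ^ 2 + 2 * j * n)) T ∧
        sL12 z q = 1 / ((1 + z) * (qPochInf (q ^ 2) (q ^ 2) * qPochInf z (q ^ 2)
          * qPochInf z⁻¹ (q ^ 2))) * T := by
  have hq2 := norm_sq_lt_one hq1
  have hne : ∀ k : ℕ, -q * (q ^ 2) ^ k ≠ 1 := mul_pow_ne_one_of_norm_lt (by simpa using hq1) hq2
  obtain ⟨B, hB0, hB⟩ := exists_norm_inv_qPoch_le hq2 hne
  set D : ℕ → ℂ := fun n => qPoch (q ^ 2) (q ^ 2) (2 * n)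
        * ((qPoch (-q) (q ^ 2) n)⁻¹ * (qPoch (-q) (q ^ 2) (n + 1))⁻¹) with hDdef
  have hD : ∀ n, ‖D n‖ ≤ Real.exp (‖q ^ 2‖ / (1 - ‖q ^ 2‖)) * (B * B) := fun n => by
    rw [hDdef, norm_mul, norm_mul]
    gcongr
    exacts [norm_qPoch_le _ hq2 _, hB _, hB _]
  have hP2 := qPochInf_self_ne_zero hq2
  have hN := qPochInf_ne_zero hq2 hne
  have hz1' : 1 + z ≠ 0 := fun h => hz1 (by linear_combination h)
  have ht : ∀ n, termL12 z q n = qPoch z (q ^ 2) n * qPoch z⁻¹ (q ^ 2) n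
      / qPoch (q ^ 2) (q ^ 2) (2 * n) * (D n * (q ^ 2) ^ n) := fun n => by
    have := qPoch_self_ne_zero hq2 (2 * n)
    rw [termL12, hDdef, ← pow_mul]
    field_simp
  refine ⟨(summable_bailey z hq2 (summable_norm_mul_pow_of_le hq2 hD)).congr fun n => (ht n).symm,
    _, hasSum_pnat_prod hq1
      (a := fun i => baileyAlpha z (q ^ 2) i * ((1 + q ^ (2 * i + 1)) * (q ^ 2) ^ i))
      (g := fun i m => q ^ (m ^ 2 + 2 * (i + 1) * m))
      (summable_norm_baileyAlpha_sq_mul hq0 hq1 hz0)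
      (fun i m => norm_theta_le hq1 (i + 1) m)
      (((hasSum_bailey_conjugateSum (pow_ne_zero 2 hq0) hq2 hz0 hD).mul_left
        (qPochInf (-q) (q ^ 2) ^ 2 * qPochInf (q ^ 2) (q ^ 2))).congr_fun fun i => ?_)
      fun i m => ?_, ?_⟩
  · rw [one_sub_sq_pow]
    have h := conjugateSum_qPoch_div hq1 i
    have hc : qPochInf (-q) (q ^ 2) ^ 2 * qPochInf (q ^ 2) (q ^ 2)
        * (qPochInf (q ^ 2) (q ^ 2) * ((qPochInf (-q) (q ^ 2))⁻¹ * (qPochInf (-q) (q ^ 2))⁻¹)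
          / (qPochInf (q ^ 2) (q ^ 2) * qPochInf (q ^ 2) (q ^ 2))) = 1 := by
      field_simp
    linear_combination (-(baileyAlpha z (q ^ 2) i * ((1 + q ^ (2 * i + 1)) * (q ^ 2) ^ i)
      * ∑' m, q ^ (m ^ 2 + 2 * (i + 1) * m))) * hc
      - qPochInf (-q) (q ^ 2) ^ 2 * qPochInf (q ^ 2) (q ^ 2) *
      (baileyAlpha z (q ^ 2) i * ((1 + q ^ (2 * i + 1)) * (q ^ 2) ^ i)) * h
  · simp only [Nat.succPNat_coe, Nat.succ_eq_add_one, Nat.add_sub_cancel]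
    rw [show 2 * (i + 1) - 1 = 2 * i + 1 by omega, neg_one_pow_add_two,
      show (i + 1) * i + m ^ 2 + 2 * (i + 1) * m
        = i * i + i + (m ^ 2 + 2 * (i + 1) * m) by ring, pow_add _ (i * i + i)]
    push_cast
    linear_combination (-((1 + q ^ (2 * i + 1)) * q ^ (m ^ 2 + 2 * (i + 1) * m)))
      * baileyAlpha_sq_mul_pow z q i
  · simp only [sL12, ht]
    field_simp

end

/-! ### Bilateral sums and the specialisations `S_{G1}`, `S_{G2}`, `S_{G3}`. -/

theorem hasSum_int_of_pairs {f : ℤ → ℂ} {T : ℂ} (h1 : Summable fun i : ℕ => f (i + 1))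
    (h2 : Summable fun i : ℕ => f (-i)) (h : HasSum (fun i : ℕ => f (i + 1) + f (-i)) T) :
    HasSum f T := by
  rw [h.unique (h1.hasSum.add h2.hasSum)]
  refine (Equiv.addRight (1 : ℤ)).hasSum_iff.1 (HasSum.of_nat_of_neg_add_one h1.hasSum ?_)
  exact h2.hasSum.congr_fun fun i => by simp

/-- The symmetry of `c_j` under `j ↦ 1 - j`, which lets a bilateral series fold onto `j ≥ 1`. -/
theorem zFactor_neg {z : ℂ} (hz : z ≠ 0) (i : ℕ) : zFactor z (-i) = zFactor z ((i : ℤ) + 1) := by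
  rw [zFactor_add_one hz, zFactor]
  rw [show (-(i : ℤ) - 1) = -((i + 1 : ℕ) : ℤ) by push_cast; ring,
    show 1 - -(i : ℤ) = ((i + 1 : ℕ) : ℤ) by push_cast; ring, zpow_neg, zpow_neg, zpow_natCast,
    zpow_natCast, pow_succ, inv_pow]
  field_simp
  ring

theorem neg_one_zpow_neg_add_one (i : ℕ) : (-1 : ℂ) ^ (-(i : ℤ) + 1) = -(-1) ^ i := by
  rw [zpow_add₀ (by norm_num), zpow_neg, zpow_natCast, ← inv_pow]
  norm_num

theorem neg_one_zpow_add_two (i : ℕ) : (-1 : ℂ) ^ ((i : ℤ) + 1 + 1) = (-1) ^ i := by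
  rw [add_assoc, zpow_add₀ (by norm_num), zpow_natCast]
  norm_num

section
variable {q z : ℂ}

theorem sG1_expansion (hq0 : q ≠ 0) (hq1 : ‖q‖ < 1) (hz0 : z ≠ 0)
    (hz : ∀ k : ℤ, z ≠ (q ^ 2) ^ k) (hz1 : z ≠ -1) :
      ∃ T : ℂ, HasSum (fun p : ℕ+ =>
          let j : ℕ := p
          zFactor z j * (-1) ^ (j + 1) * (1 + q ^ (2 * j - 1)) * q ^ ((j - 1) ^ 2)) T ∧
        sG1 z q = 1 / ((1 + z) * (qPochInf z (q ^ 2) * qPochInf z⁻¹ (q ^ 2)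
          * qPochInf q (q ^ 2))) * T := by
  have hq2 := norm_sq_lt_one hq1
  have hz1' : 1 + z ≠ 0 := fun h => hz1 (by linear_combination h)
  have hP2 := qPochInf_self_ne_zero hq2
  have hne : ∀ k : ℕ, q * (q ^ 2) ^ k ≠ 1 := mul_pow_ne_one_of_norm_lt hq1 hq2
  have hO := qPochInf_ne_zero hq2 hne
  have hZ := qPochInf_ne_zero hq2 (mul_pow_ne_one_of_generic hz)
  have hZ' := qPochInf_ne_zero hq2 (inv_mul_pow_ne_one_of_generic hz0 hz)
  have hn : ‖(q ^ 2) ^ 2‖ < ‖q * q ^ 2‖ := by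
    have h3 : q * q ^ 2 ≠ 0 := mul_ne_zero hq0 (pow_ne_zero 2 hq0)
    rw [show (q ^ 2) ^ 2 = q * (q * q ^ 2) by ring, norm_mul q]
    exact mul_lt_of_lt_one_left (norm_pos_iff.2 h3) hq1
  refine ⟨_, (((genG_expansion (pow_ne_zero 2 hq0) hq2 hz0 q (q ^ 2) hn hz1).2).mul_left
    ((1 + z) * (qPochInf z (q ^ 2) * qPochInf z⁻¹ (q ^ 2) * qPochInf q (q ^ 2)))).congr_fun
    fun p => ?_, ?_⟩
  · obtain ⟨i, rfl⟩ : ∃ i : ℕ, p = i.succPNat := ⟨p.natPred, by simp⟩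
    simp only [Nat.succPNat_coe, Nat.succ_eq_add_one, Nat.add_sub_cancel]
    have e1 : 2 * ((i + 1) * (i + 1 + 1) / 2 - 1) = i ^ 2 + 3 * i := by
      have h3 := two_mul_triangle (i + 2)
      have h4 : (i + 1) * (i + 1 + 1) = (i + 2) * (i + 2 - 1) := by
        rw [show i + 2 - 1 = i + 1 by omega]; ring
      rw [h4]
      have : (i + 2) * (i + 2) = i ^ 2 + 3 * i + 2 + (i + 2) := by ring
      omega
    rw [show (q ^ 2) ^ ((i + 1) * (i + 1 + 1) / 2 - 1) = q ^ (i ^ 2 + 3 * i) by rw [← pow_mul, e1],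
      show 2 * (i + 1) - 1 = 2 * i + 1 by omega,
      show (q ^ 2) ^ (i + 1 + 1) / q = q * (q ^ 2) ^ (i + 1) by field_simp; ring,
      show (q ^ 2) ^ (i + 1 + 1) / q ^ 2 = q ^ 2 * (q ^ 2) ^ i by field_simp; ring,
      show (q ^ 2) ^ 2 / (q * q ^ 2) = q by field_simp, one_sub_sq_pow]
    -- For `ρ₁ = q`, `ρ₂ = q²` in base `q²` each finite product meets its own tail. The first lacks
    -- the factor `1 - q^{2i+1}`, which is supplied by `1 - q^{4i+2}`.
    have h1 := qPochInf_eq_mul q hq2 (i + 1)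
    have h2 := qPochInf_eq_mul (q ^ 2) hq2 i
    rw [qPoch_succ, show q * (q ^ 2) ^ i = q ^ (2 * i + 1) by ring] at h1
    rw [eq_comm]
    push_cast
    generalize qPochInf (q * (q ^ 2) ^ (i + 1)) (q ^ 2) = A at *
    generalize qPochInf (q ^ 2 * (q ^ 2) ^ i) (q ^ 2) = A' at *
    generalize qPoch q (q ^ 2) i = B at *
    generalize qPoch (q ^ 2) (q ^ 2) i = B' at *
    generalize qPochInf q (q ^ 2) = O at *
    generalize qPochInf (q ^ 2) (q ^ 2) = Q at *
    generalize 1 - q ^ (2 * i + 1) = X at *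
    generalize qPochInf z⁻¹ (q ^ 2) = Z' at *
    trans zFactor z ((i : ℤ) + 1) * (-1) ^ (i + 1 + 1) * (1 + q ^ (2 * i + 1))
      * (q ^ (i ^ 2 + 3 * i) / (q ^ i * (q ^ 2) ^ i)) * ((B * X * A) / O) * ((B' * A') / Q)
    · field_simp
    · rw [← h1, ← h2, div_self hO, div_self hP2,
        show q ^ (i ^ 2 + 3 * i) = q ^ (i ^ 2) * (q ^ i * (q ^ 2) ^ i) by ring]
      field_simp
  · rw [sG1]
    generalize qPochInf z⁻¹ (q ^ 2) = Z' at *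
    field_simp

theorem sG3_expansion (hq0 : q ≠ 0) (hq1 : ‖q‖ < 1) (hz0 : z ≠ 0)
    (hz : ∀ k : ℤ, z ≠ q ^ k) (hz1 : z ≠ -1) :
      ∃ T : ℂ, HasSum (fun p : ℕ+ =>
          let j : ℕ := p
          zFactor z j * (1 - q ^ (2 * j - 1)) * q ^ ((j - 1) ^ 2)) T ∧
        sG3 z q = 1 / ((1 + z) * (qPochInf z q * qPochInf z⁻¹ q)) * T := by
  have hz1' : 1 + z ≠ 0 := fun h => hz1 (by linear_combination h)
  have hP := qPochInf_self_ne_zero hq1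
  have hZ := qPochInf_ne_zero hq1 (mul_pow_ne_one_of_generic hz)
  have hZ' := qPochInf_ne_zero hq1 (inv_mul_pow_ne_one_of_generic hz0 hz)
  refine ⟨_, (((genGInf_expansion hq0 hq1 hz0 q hq0).2.2 hz1).mul_left
    ((1 + z) * (qPochInf z q * qPochInf z⁻¹ q))).congr_fun fun p => ?_, ?_⟩
  · obtain ⟨i, rfl⟩ : ∃ i : ℕ, p = i.succPNat := ⟨p.natPred, by simp⟩
    simp only [Nat.succPNat_coe, Nat.succ_eq_add_one, Nat.add_sub_cancel]
    have h1 := qPochInf_eq_mul q hq1 i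
    rw [show q ^ (i + 1 + 1) / q = q * q ^ i by field_simp; ring,
      show q ^ ((i + 1) * i) = q ^ (i ^ 2) * q ^ i by ring, eq_comm]
    push_cast
    generalize qPochInf (q * q ^ i) q = A at *
    generalize qPoch q q i = B at *
    generalize qPochInf q q = Q at *
    generalize 1 - q ^ (2 * (i + 1) - 1) = X at *
    generalize qPochInf z⁻¹ q = Z' at *
    trans zFactor z ((i : ℤ) + 1) * X * q ^ (i ^ 2) * ((B * A) / Q)
    · field_simp
    · rw [← h1, div_self hP, mul_one]
  · rw [sG3]
    generalize qPochInf z⁻¹ q = Z' at *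
    field_simp

theorem exists_norm_inv_one_add_pow_le (hq : ‖q‖ < 1) (i : ℕ) :
    ‖(1 + q ^ (2 * i + 1))⁻¹‖ ≤ (1 - ‖q‖)⁻¹ := by
  rw [norm_inv]
  have h := norm_sub_norm_le (1 : ℂ) (-q ^ (2 * i + 1))
  rw [norm_one, norm_neg, sub_neg_eq_add] at h
  have h2 := norm_pow_le_of_pos hq (k := 2 * i + 1) (by omega)
  exact inv_anti₀ (by linarith) (by linarith)

theorem one_add_pow_ne_zero (hq : ‖q‖ < 1) (i : ℕ) : 1 + q ^ (2 * i + 1) ≠ 0 := fun h => by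
  have h2 := norm_pow_le_of_pos hq (k := 2 * i + 1) (by omega)
  rw [eq_neg_of_add_eq_zero_right h, norm_neg, norm_one] at h2
  linarith

theorem int_triangle (i : ℕ) : ((i : ℤ) + 1) * i / 2 = ((i * (i - 1) / 2 + i : ℕ) : ℤ) := by
  rw [← triangle_succ]; push_cast; simp

theorem sG2_expansion (hq0 : q ≠ 0) (hq1 : ‖q‖ < 1) (hz0 : z ≠ 0)
    (hz : ∀ k : ℤ, z ≠ q ^ k) (hz1 : z ≠ -1) :
      Summable (fun n : ℕ+ => termG2 z q n) ∧
      ∃ T : ℂ, HasSum (fun j : ℤ =>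
          zFactor z j * (-1) ^ (j + 1) * q ^ (j * (j - 1) / 2) / (1 + q ^ (2 * j - 1))) T ∧
        sG2 z q = 1 / ((1 + z) * (qPochInf z q * qPochInf z⁻¹ q * qPochInf q q)) * T := by
  -- A square root of `q` gives `ρ = is` with `ρ² = -q` and `ρ·(-ρ) = q`, so paired products pass to
  -- base `q²`.
  obtain ⟨s, hs⟩ := IsAlgClosed.exists_pow_nat_eq q (n := 2) (by norm_num)
  have hz1' : 1 + z ≠ 0 := fun h => hz1 (by linear_combination h)
  have hq2 := norm_sq_lt_one hq1
  have hP := qPochInf_self_ne_zero hq1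
  have hZ := qPochInf_ne_zero hq1 (mul_pow_ne_one_of_generic hz)
  have hZ' := qPochInf_ne_zero hq1 (inv_mul_pow_ne_one_of_generic hz0 hz)
  have hne : ∀ k : ℕ, -q * (q ^ 2) ^ k ≠ 1 := mul_pow_ne_one_of_norm_lt (by simpa using hq1) hq2
  have hN := qPochInf_ne_zero hq2 hne
  set ρ := Complex.I * s with hρ
  have hρ2 : ρ ^ 2 = -q := by rw [hρ, mul_pow, Complex.I_sq, hs]; ring
  have hρ0 : ρ ≠ 0 := fun h => hq0 (by rw [h] at hρ2; linear_combination hρ2)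
  have hρρ : ρ * -ρ = q := by linear_combination -hρ2
  have hn : ‖q ^ 2‖ < ‖ρ * -ρ‖ := by
    rw [hρρ, pow_two, norm_mul]
    exact mul_lt_of_lt_one_left (norm_pos_iff.2 hq0) hq1
  obtain ⟨hsum, hG⟩ := genG_expansion hq0 hq1 hz0 ρ (-ρ) hn hz1
  have hc : q ^ 2 / (ρ * -ρ) = q := by rw [hρρ]; field_simp
  have hA : ∀ i : ℕ, zFactor z ((i : ℤ) + 1) * (-1) ^ ((i : ℤ) + 1 + 1)
      * q ^ (((i : ℤ) + 1) * ((i : ℤ) + 1 - 1) / 2) / (1 + q ^ (2 * ((i : ℤ) + 1) - 1))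
      = baileyAlpha z q i * (q ^ i * (1 + q ^ (2 * i + 1))⁻¹) := fun i => by
    rw [neg_one_zpow_add_two, add_sub_cancel_right, int_triangle, zpow_natCast,
      show 2 * ((i : ℤ) + 1) - 1 = ((2 * i + 1 : ℕ) : ℤ) by push_cast; ring, zpow_natCast,
      baileyAlpha]
    ring
  have hB : ∀ i : ℕ, zFactor z (-(i : ℤ)) * (-1) ^ (-(i : ℤ) + 1)
      * q ^ (-(i : ℤ) * (-(i : ℤ) - 1) / 2) / (1 + q ^ (2 * -(i : ℤ) - 1))
      = baileyAlpha z q i * (-q ^ (3 * i + 1) * (1 + q ^ (2 * i + 1))⁻¹) := fun i => by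
    have := one_add_pow_ne_zero hq1 i
    rw [neg_one_zpow_neg_add_one, show -(i : ℤ) * (-(i : ℤ) - 1) = ((i : ℤ) + 1) * i by ring,
      int_triangle, zpow_natCast, zFactor_neg hz0,
      show 2 * -(i : ℤ) - 1 = -((2 * i + 1 : ℕ) : ℤ) by push_cast; ring, zpow_neg, zpow_natCast,
      baileyAlpha, show 1 + (q ^ (2 * i + 1))⁻¹ = (1 + q ^ (2 * i + 1)) / q ^ (2 * i + 1) by
        field_simp; ring]
    field_simp
    ring
  refine ⟨hsum.congr fun n => ?_, _, hasSum_int_of_pairs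
    ((summable_norm_baileyAlpha_mul hq0 hq1 hz0 (b := fun i => q ^ i * (1 + q ^ (2 * i + 1))⁻¹)
      (M := 1 * (1 - ‖q‖)⁻¹) fun i => ?_).of_norm.congr fun i => ?_)
    ((summable_norm_baileyAlpha_mul hq0 hq1 hz0
      (b := fun i => -q ^ (3 * i + 1) * (1 + q ^ (2 * i + 1))⁻¹)
      (M := 1 * (1 - ‖q‖)⁻¹) fun i => ?_).of_norm.congr fun i => ?_)
    (hasSum_of_eq (((hasSum_pnat_iff_succPNat.1 hG).mul_left ((1 + z) * (qPochInf z q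
      * qPochInf z⁻¹ q * qPochInf q q)))) (fun i => ?_) rfl), ?_⟩
  · rw [termG, hc, termG2, mul_assoc _ (qPoch ρ q n), qPoch_mul_qPoch_neg, hρ2]
  · rw [norm_mul]
    exact mul_le_mul (norm_pow_le_one hq1 i) (exists_norm_inv_one_add_pow_le hq1 i)
      (norm_nonneg _) zero_le_one
  · exact (hA i).symm
  · rw [norm_mul, norm_neg]
    exact mul_le_mul (norm_pow_le_one hq1 _) (exists_norm_inv_one_add_pow_le hq1 i)
      (norm_nonneg _) zero_le_one
  · exact (hB i).symm
  -- The terms `j = i+1` and `j = -i` add up to `α_i q^i (1-q^{2i+1})/(1+q^{2i+1})`. The denominator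
  -- is the one factor of `(-q;q²)_∞` absent from `(-q;q²)_i (-q^{2i+3};q²)_∞`.
  · refine (congrArg₂ (· + ·) (hA i) (hB i)).trans ?_
    simp only [Nat.succPNat_coe, Nat.succ_eq_add_one, Nat.add_sub_cancel, hc]
    have h0 := one_add_pow_ne_zero hq1 i
    have e1 : (i + 1) * (i + 1 + 1) / 2 - 1 = i * (i - 1) / 2 + 2 * i := by
      rw [mul_comm]
      have h3 : (i + 1 + 1) * (i + 1) / 2 = (i + 1) * i / 2 + (i + 1) := triangle_succ (i + 1)
      have h4 : (i + 1) * i / 2 = i * (i - 1) / 2 + i := triangle_succ i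
      omega
    have h1 := qPochInf_eq_mul (-q) hq2 (i + 1)
    rw [qPoch_succ, show 1 - -q * (q ^ 2) ^ i = 1 + q ^ (2 * i + 1) by ring] at h1
    have h2 : qPochInf (q ^ (i + 1 + 1) / ρ) q * qPochInf (q ^ (i + 1 + 1) / -ρ) q
        = qPochInf (-q * (q ^ 2) ^ (i + 1)) (q ^ 2) := by
      have e2 : q ^ (i + 1 + 1) / ρ = -ρ * q ^ (i + 1) := by
        rw [div_eq_iff hρ0]; linear_combination (-q ^ (i + 1)) * hρρ
      rw [div_neg, e2, qPochInf_mul_qPochInf_neg _ hq1]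
      congr 1
      linear_combination ((q ^ 2) ^ (i + 1)) * hρ2
    have h3 : ρ ^ i * (-ρ) ^ i = q ^ i := by rw [← mul_pow, hρρ]
    have h4 : qPochInf z q * qPochInf z⁻¹ q * qPochInf ρ q * qPochInf (-ρ) q * qPochInf q q
        = qPochInf z q * qPochInf z⁻¹ q * qPochInf q q * qPochInf (-q) (q ^ 2) := by
      rw [← hρ2, ← qPochInf_mul_qPochInf_neg ρ hq1]; ring
    rw [h2, mul_assoc (1 + z) (ρ ^ i), h3, h4, qPoch_mul_qPoch_neg, hρ2, e1, baileyAlpha,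
      neg_one_pow_add_two, show 2 * (i + 1) - 1 = 2 * i + 1 by omega,
      show q ^ (3 * i + 1) = q ^ i * q ^ (2 * i + 1) by ring,
      show q ^ (i * (i - 1) / 2 + 2 * i) = q ^ (i * (i - 1) / 2) * q ^ i * q ^ i by ring]
    push_cast
    generalize qPochInf (-q * (q ^ 2) ^ (i + 1)) (q ^ 2) = A at *
    generalize qPoch (-q) (q ^ 2) i = B at *
    generalize qPochInf (-q) (q ^ 2) = N at *
    generalize qPochInf z⁻¹ q = Z' at *
    generalize q ^ (2 * i + 1) = X at *
    rw [h1] at hN ⊢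
    obtain ⟨⟨hB0, -⟩, hA0⟩ := mul_ne_zero_iff.1 hN |>.imp_left mul_ne_zero_iff.1
    field_simp
    ring
  · rw [← genG_eq_sG2 z q s hq0 hq1 hs, ← hρ]
    generalize qPochInf z⁻¹ q = Z' at *
    field_simp

end

/-! ### `S_{F1}`: bilateral series and product formula. -/

section
variable {q z : ℂ}

/-- At `ρ = -q` the product `(-q;q)_i (-q^{i+1};q)_∞` is independent of `i` and cancels. What
remains is the Bailey sequence in base `q²` with a polynomial weight, and no genericity of `z` is
needed. -/
theorem hasSum_genFInf_neg (hq0 : q ≠ 0) (hq1 : ‖q‖ < 1) (hz0 : z ≠ 0) :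
    HasSum (fun i : ℕ => baileyAlpha z (q ^ 2) i
        * (1 + q ^ i - q ^ (3 * i + 1) - q ^ (4 * i + 2)))
      ((1 + z) * (qPochInf q q / qPochInf (-q) q * qShiftSeries z q (-q)⁻¹ 0 q)) := by
  have hP := qPochInf_self_ne_zero hq1
  have hN := qPochInf_ne_zero hq1 (neg_self_mul_pow_ne_one hq1)
  refine hasSum_of_eq ((hasSum_qShift_self hq0 hq1 hz0 (u := (-q)⁻¹) (v := 0)
    (by simp)).mul_left (qPochInf q q / qPochInf (-q) q)) (fun i => ?_) ?_
  · rw [qShift_inv (neg_ne_zero.2 hq0), mul_zero, zero_mul, zero_mul, zero_mul, qPochInf_zero_left,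
      show (-q)⁻¹ * q ^ (i + 2) = -q * q ^ i by rw [inv_neg]; field_simp; ring]
    have hA := baileyAlpha_mul_qShift_zero z q i
    have h1 := qPochInf_eq_mul (-q) hq1 i
    have hA2 : baileyAlpha z (q ^ 2) i
        = (-1) ^ i * (q ^ (2 * (i * (i - 1) / 2)) * zFactor z ((i : ℤ) + 1)) := by
      rw [baileyAlpha, ← pow_mul]; ring
    generalize baileyAlpha z q i = a at *
    generalize qShift 0 q i = S at *
    generalize qPochInf (-q * q ^ i) q = W at *
    generalize qPoch (-q) q i = r at *
    generalize qPochInf (-q) q = N at *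
    generalize qPochInf q q = Q at *
    trans a * S * (r * W / N) * (q ^ i / (-q) ^ i) * (1 - (-q)⁻¹ * q ^ (i + 1)
        + (-q)⁻¹ * q ^ (3 * i + 2) - q ^ (4 * i + 2))
    · rw [hA, ← h1, div_self hN, hA2, show q ^ i / (-q) ^ i = (-1) ^ i by
        rw [← div_pow]; congr 1; field_simp]
      rw [inv_neg]
      field_simp
      ring
    · field_simp
      ring
  · rw [qShiftSeries]
    ring

theorem sF1_eq (hq0 : q ≠ 0) : sF1 z q = qPochInf q q / qPochInf (-q) q
    * qShiftSeries z q (-q)⁻¹ 0 q / (qPochInf z q * qPochInf z⁻¹ q) := by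
  rw [sF1, genFInf_eq (neg_ne_zero.2 hq0)]
  generalize qPochInf z⁻¹ q = Z' at *
  field_simp

theorem sF1_expansion (hq0 : q ≠ 0) (hq1 : ‖q‖ < 1) (hz0 : z ≠ 0)
    (hz : ∀ k : ℤ, z ≠ q ^ k) (hz1 : z ≠ -1) : ∃ T : ℂ, HasSum (fun j : ℤ =>
          zFactor z j * (-1) ^ (j + 1) * q ^ (j ^ 2 - 3 * j + 2) * (1 + q ^ (j - 1))) T ∧
        sF1 z q = 1 / ((1 + z) * (qPochInf z q * qPochInf z⁻¹ q)) * T := by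
  have hz1' : 1 + z ≠ 0 := fun h => hz1 (by linear_combination h)
  have hq2 := norm_sq_lt_one hq1
  have hP := qPochInf_self_ne_zero hq1
  have hZ := qPochInf_ne_zero hq1 (mul_pow_ne_one_of_generic hz)
  have hZ' := qPochInf_ne_zero hq1 (inv_mul_pow_ne_one_of_generic hz0 hz)
  have hA : ∀ i : ℕ, zFactor z ((i : ℤ) + 1) * (-1) ^ ((i : ℤ) + 1 + 1)
      * q ^ (((i : ℤ) + 1) ^ 2 - 3 * ((i : ℤ) + 1) + 2) * (1 + q ^ ((i : ℤ) + 1 - 1))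
      = baileyAlpha z (q ^ 2) i * (1 + q ^ i) := fun i => by
    have e : ((i : ℤ) + 1) ^ 2 - 3 * ((i : ℤ) + 1) + 2 = ((2 * (i * (i - 1) / 2) : ℕ) : ℤ) := by
      have := congrArg (Nat.cast (R := ℤ)) (two_mul_triangle i)
      push_cast at this ⊢
      linear_combination -this
    rw [neg_one_zpow_add_two, add_sub_cancel_right, e, zpow_natCast, zpow_natCast, baileyAlpha,
      ← pow_mul]
    ring
  have hB : ∀ i : ℕ, zFactor z (-(i : ℤ)) * (-1) ^ (-(i : ℤ) + 1)
      * q ^ ((-(i : ℤ)) ^ 2 - 3 * (-(i : ℤ)) + 2) * (1 + q ^ (-(i : ℤ) - 1))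
      = baileyAlpha z (q ^ 2) i * (-(q ^ (3 * i + 1) * (1 + q ^ (i + 1)))) := fun i => by
    have e : (-(i : ℤ)) ^ 2 - 3 * (-(i : ℤ)) + 2 = ((2 * (i * (i - 1) / 2) + 4 * i + 2 : ℕ) : ℤ) := by
      have := congrArg (Nat.cast (R := ℤ)) (two_mul_triangle i)
      push_cast at this ⊢
      linear_combination -this
    rw [neg_one_zpow_neg_add_one, zFactor_neg hz0, e, zpow_natCast,
      show -(i : ℤ) - 1 = -((i + 1 : ℕ) : ℤ) by push_cast; ring, zpow_neg, zpow_natCast, baileyAlpha,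
      ← pow_mul]
    field_simp
    ring
  refine ⟨_, hasSum_int_of_pairs
    ((summable_norm_baileyAlpha_mul (pow_ne_zero 2 hq0) hq2 hz0 (b := fun i => 1 + q ^ i)
      fun i => norm_one_add_pow_le hq1 i).of_norm.congr fun i => (hA i).symm)
    ((summable_norm_baileyAlpha_mul (pow_ne_zero 2 hq0) hq2 hz0
      (b := fun i => -(q ^ (3 * i + 1) * (1 + q ^ (i + 1)))) (M := 1 * 2)
      fun i => ?_).of_norm.congr fun i => (hB i).symm)
    (hasSum_of_eq (hasSum_genFInf_neg hq0 hq1 hz0) (fun i => ?_) rfl), ?_⟩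
  · rw [norm_neg, norm_mul]
    exact mul_le_mul (norm_pow_le_one hq1 _) (norm_one_add_pow_le hq1 _) (norm_nonneg _) zero_le_one
  · refine (congrArg₂ (· + ·) (hA i) (hB i)).trans ?_
    ring
  · rw [sF1_eq hq0]
    generalize qPochInf z⁻¹ q = Z' at *
    field_simp

/-- The numerator `(z, z⁻¹; q²)_∞ (1 + …)` of the product form of `S_{F1}`. -/
noncomputable def thetaNumerator (z q : ℂ) : ℂ :=
  (1 - z) * (1 - z⁻¹) * (qPochInf (z⁻¹ * q ^ 2) (q ^ 2) * qPochInf (z * q ^ 2) (q ^ 2)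
      * qPochInf (q ^ 2) (q ^ 2))
    + qPochInf (z⁻¹ * q) (q ^ 2) * qPochInf (z * q) (q ^ 2) * qPochInf (q ^ 2) (q ^ 2)
    - qPochInf q (q ^ 2) * qPochInf q (q ^ 2) * qPochInf (q ^ 2) (q ^ 2)

theorem triangle_add_two (i : ℕ) : (i + 2) * (i + 1) / 2 = i * (i - 1) / 2 + 2 * i + 1 := by
  have h3 : (i + 2) * (i + 1) / 2 = (i + 1) * i / 2 + (i + 1) := triangle_succ (i + 1)
  have h4 : (i + 1) * i / 2 = i * (i - 1) / 2 + i := triangle_succ i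
  omega

theorem qPochInf_eq_one_sub_mul (z : ℂ) {q : ℂ} (hq : ‖q‖ < 1) :
    qPochInf z q = (1 - z) * qPochInf (z * q) q := by
  rw [qPochInf_eq_mul z hq 1, qPoch_succ, qPoch_zero, pow_zero, mul_one, one_mul, pow_one]

/-- The triple product in base `q²` is used at `z, z⁻¹, 1` and, divided by `q`, at `zq, z⁻¹q, q`,
with the same weights `1, z, -(1+z)`. The two families contribute `q^{i²-i} - q^{i²+3i+2}` and
`q^{i²} - q^{(i+1)²}`, whose sum is `q^{i²-i}(1+q^i-q^{3i+1}-q^{4i+2})`. The product at `1`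
vanishes; the one at `q` is the subtracted product. -/
theorem hasSum_thetaNumerator (hq0 : q ≠ 0) (hq1 : ‖q‖ < 1) (hz0 : z ≠ 0) :
    HasSum (fun i : ℕ => baileyAlpha z (q ^ 2) i
        * (1 + q ^ i - q ^ (3 * i + 1) - q ^ (4 * i + 2)))
      ((1 + z) * thetaNumerator z q) := by
  have hq2 := norm_sq_lt_one hq1
  have hq20 : q ^ 2 ≠ 0 := pow_ne_zero 2 hq0
  have hJ := fun {w : ℂ} (hw : w ≠ 0) => hasSum_triple_product (z := w) hq20 hq2 hw
  have h1 := ((hJ hz0).add ((hJ (inv_ne_zero hz0)).mul_left z)).sub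
    ((hJ one_ne_zero).mul_left (1 + z))
  have h2 := (((hJ (mul_ne_zero hz0 hq0)).add
    ((hJ (mul_ne_zero (inv_ne_zero hz0) hq0)).mul_left z)).sub
    ((hJ hq0).mul_left (1 + z))).mul_left q⁻¹
  refine hasSum_of_eq (h1.add h2) (fun i => ?_) ?_
  · have e1 := sum_triple_product_zFactor (q ^ 2) hz0 (i * (i - 1) / 2) ((i + 2) * (i + 1) / 2) i
    have e2 := sum_triple_product_zFactor q hz0 (i * i) (i * i + 2 * i + 1) i
    have e3 : ∀ w : ℂ, w ≠ 0 → (q ^ 2) ^ (i * (i - 1) / 2) * (w * q) ^ (i + 1)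
        - (q ^ 2) ^ ((i + 2) * (i + 1) / 2) * (w * q)⁻¹ ^ i
        = q * (q ^ (i * i) * w ^ (i + 1) - q ^ (i * i + 2 * i + 1) * w⁻¹ ^ i) := fun w hw => by
      rw [triangle_add_two, ← two_mul_triangle i, mul_inv, mul_pow w⁻¹, inv_pow q,
        mul_sub (q : ℂ)]
      congr 1
      · ring
      · field_simp
        ring
    have e4 := e3 1 one_ne_zero
    rw [one_mul] at e4
    have e5 : (q ^ 2) ^ (i * (i - 1) / 2) - (q ^ 2) ^ ((i + 2) * (i + 1) / 2)
        + (q ^ (i * i) - q ^ (i * i + 2 * i + 1))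
        = (q ^ 2) ^ (i * (i - 1) / 2) * (1 + q ^ i - q ^ (3 * i + 1) - q ^ (4 * i + 2)) := by
      rw [triangle_add_two, ← two_mul_triangle i]; ring
    have hqi : q⁻¹ * q = 1 := inv_mul_cancel₀ hq0
    rw [e3 z hz0, e3 z⁻¹ (inv_ne_zero hz0), e4, baileyAlpha]
    linear_combination (-(zFactor z ((i : ℤ) + 1) * (-1) ^ i)) * e5 - (-1) ^ i * e1
      - (-1) ^ i * (q⁻¹ * q) * e2
      - (-1) ^ i * ((q ^ (i * i) - q ^ (i * i + 2 * i + 1)) * zFactor z ((i : ℤ) + 1)) * hqi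
  · have f0 : qPochInf 1 (q ^ 2) = 0 := by rw [qPochInf_eq_one_sub_mul _ hq2]; ring
    have f1 := qPochInf_eq_one_sub_mul z hq2
    have f2 := qPochInf_eq_one_sub_mul z⁻¹ hq2
    have f3 : q ^ 2 / (z * q) = z⁻¹ * q := by field_simp
    have f4 : q ^ 2 / (z⁻¹ * q) = z * q := by field_simp
    have f5 : q ^ 2 / q = q := by field_simp
    rw [f0, f3, f4, f5, f1, f2, div_eq_inv_mul, div_inv_eq_mul, mul_comm (q ^ 2) z, thetaNumerator]
    generalize qPochInf (z⁻¹ * q ^ 2) (q ^ 2) = A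
    generalize qPochInf (z * q ^ 2) (q ^ 2) = B
    generalize qPochInf (z⁻¹ * q) (q ^ 2) = C
    generalize qPochInf (z * q) (q ^ 2) = D
    field_simp
    ring

/-- Near `w ≠ 0` both `‖z‖` and `‖z⁻¹‖` are bounded, so one majorant serves for all nearby `z`. -/
theorem continuousAt_qShiftSeries (u v x : ℂ) {q w : ℂ} (hq : ‖q‖ < 1) (hx : ‖u * v * x‖ < 1)
    (hw : w ≠ 0) : ContinuousAt (fun z => qShiftSeries z q u v x) w := by
  obtain ⟨B, hB0, hB⟩ := exists_norm_inv_qPoch_le hq (self_mul_pow_ne_one hq)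
  have hs := (summable_norm_qShift hq hx).mul_left
    (Real.exp ((‖w‖ + 1) / (1 - ‖q‖)) * Real.exp ((‖w⁻¹‖ + 1) / (1 - ‖q‖)) * B)
  have hinv := continuousAt_inv₀ hw
  refine tendsto_tsum_of_dominated_convergence
    (hs.comp_injective PNat.coe_injective) (fun n => ?_) ?_
  · refine Tendsto.mul_const _ (Tendsto.div_const (Tendsto.mul ?_ ?_) _)
    · exact (continuous_qPoch q n).continuousAt
    · exact ((continuous_qPoch q n).tendsto w⁻¹).comp hinv
  · have h1 := continuous_norm.continuousAt.eventually_le_const (show ‖w‖ < ‖w‖ + 1 by linarith)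
    have h2 := hinv.norm.eventually_le_const (show ‖w⁻¹‖ < ‖w⁻¹‖ + 1 by linarith)
    have hq' : 0 < 1 - ‖q‖ := by linarith
    filter_upwards [h1, h2] with z h1 h2 n
    simp only [Function.comp]
    rw [norm_mul, div_eq_mul_inv, norm_mul, norm_mul]
    gcongr
    · exact (norm_qPoch_le z hq n).trans (by gcongr)
    · exact (norm_qPoch_le z⁻¹ hq n).trans (by gcongr)
    · exact hB _

theorem continuousAt_thetaNumerator (hq1 : ‖q‖ < 1) (hz0 : z ≠ 0) :
    ContinuousAt (fun z => thetaNumerator z q) z := by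
  have hc := continuous_qPochInf (norm_sq_lt_one hq1)
  have hinv := continuousAt_inv₀ hz0
  have h1 : ∀ a : ℂ, ContinuousAt (fun z => qPochInf (z⁻¹ * a) (q ^ 2)) z := fun a =>
    hc.continuousAt.comp (hinv.mul_const a)
  have h2 : ∀ a : ℂ, ContinuousAt (fun z => qPochInf (z * a) (q ^ 2)) z := fun a =>
    hc.continuousAt.comp (continuousAt_id.mul_const a)
  unfold thetaNumerator
  exact ((((continuousAt_const.sub continuousAt_id).mul (continuousAt_const.sub hinv)).mul
    (((h1 _).mul (h2 _)).mul continuousAt_const)).add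
    (((h1 _).mul (h2 _)).mul continuousAt_const)).sub continuousAt_const

/-- Two evaluations of one series agree after cancelling `1 + z`; both sides are continuous, which
covers `z = -1`. -/
theorem qShiftSeries_eq_thetaNumerator (hq0 : q ≠ 0) (hq1 : ‖q‖ < 1) (hz0 : z ≠ 0) :
    qPochInf q q / qPochInf (-q) q * qShiftSeries z q (-q)⁻¹ 0 q = thetaNumerator z q := by
  have key : ∀ w : ℂ, w ≠ 0 → w ≠ -1 →
      qPochInf q q / qPochInf (-q) q * qShiftSeries w q (-q)⁻¹ 0 q = thetaNumerator w q :=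
    fun w hw hw1 => mul_left_cancel₀ (show 1 + w ≠ 0 from fun h => hw1 (by linear_combination h))
      ((hasSum_genFInf_neg hq0 hq1 hw).unique (hasSum_thetaNumerator hq0 hq1 hw))
  rcases eq_or_ne z (-1) with rfl | hz1
  · have h1 := ((continuousAt_qShiftSeries (-q)⁻¹ 0 q hq1 (by simp) hz0).const_mul
      (qPochInf q q / qPochInf (-q) q)).tendsto.mono_left (nhdsWithin_le_nhds (s := {-1}ᶜ))
    have h2 := (continuousAt_thetaNumerator hq1 hz0).tendsto.mono_left
      (nhdsWithin_le_nhds (s := {-1}ᶜ))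
    refine tendsto_nhds_unique h1 (h2.congr' ?_)
    filter_upwards [self_mem_nhdsWithin, nhdsWithin_le_nhds (isOpen_ne.mem_nhds hz0)] with w h3 h4
    exact (key w h4 h3).symm
  · exact key z hz0 hz1

theorem sF1_eq_product (hq0 : q ≠ 0) (hq1 : ‖q‖ < 1) (hz0 : z ≠ 0) (hz : ∀ k : ℤ, z ≠ q ^ k) :
    sF1 z q =
        qPochInf (z⁻¹ * q ^ 2) (q ^ 2) * qPochInf (z * q ^ 2) (q ^ 2) * qPochInf (q ^ 2) (q ^ 2)
            / (qPochInf (z * q) q * qPochInf (z⁻¹ * q) q)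
          + qPochInf (z⁻¹ * q) (q ^ 2) * qPochInf (z * q) (q ^ 2) * qPochInf (q ^ 2) (q ^ 2)
            / (qPochInf z q * qPochInf z⁻¹ q)
          - qPochInf q (q ^ 2) * qPochInf q (q ^ 2) * qPochInf (q ^ 2) (q ^ 2)
            / (qPochInf z q * qPochInf z⁻¹ q) := by
  have hZ := qPochInf_ne_zero hq1 (mul_pow_ne_one_of_generic hz)
  have hZ' := qPochInf_ne_zero hq1 (inv_mul_pow_ne_one_of_generic hz0 hz)
  rw [sF1_eq hq0, qShiftSeries_eq_thetaNumerator hq0 hq1 hz0, thetaNumerator, sub_div, add_div]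
  congr 2
  -- In the first quotient `(1-z)(1-z⁻¹)` cancels the leading factors of `(z, z⁻¹;q)_∞`.
  rw [qPochInf_eq_one_sub_mul z hq1] at hZ ⊢
  rw [qPochInf_eq_one_sub_mul z⁻¹ hq1] at hZ' ⊢
  rw [mul_mul_mul_comm _ _ (1 - z⁻¹), mul_div_mul_left]
  exact mul_ne_zero (left_ne_zero_of_mul hZ) (left_ne_zero_of_mul hZ')

end

end SptCrank


/-! ### Assembly of the identities. -/

theorem mainTheorem1 (q z : ℂ) (hq0 : q ≠ 0) (hq1 : ‖q‖ < 1) (hz0 : z ≠ 0) :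
    -- S_{L7}
    ((∀ k : ℤ, z ≠ (q ^ 2) ^ k) → z ≠ -1 →
      Summable (fun n : ℕ+ => termL7 z q n) ∧
      ∃ T : ℂ, HasSum (fun p : ℕ+ × ℕ =>
          let j : ℕ := p.1
          let n : ℕ := p.2
          zFactor z j * (-1) ^ (j + 1) * (1 + q ^ (2 * j - 1))
            * q ^ (j * (j - 1) + n * (n - 1) / 2 + 2 * j * n)) T ∧
        sL7 z q = 1 / ((1 + z) * (qPochInf (q ^ 2) (q ^ 2) * qPochInf z (q ^ 2)
          * qPochInf z⁻¹ (q ^ 2))) * T) ∧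
    -- S_{L9}
    ((∀ k : ℤ, z ≠ q ^ k) → z ≠ -1 →
      Summable (fun n : ℕ+ => termL9 z q n) ∧
      ∃ T : ℂ, HasSum (fun p : ℕ+ × ℕ =>
          let j : ℕ := p.1
          let n : ℕ := p.2
          zFactor z j * (-1) ^ (j + n + 1) * (1 - q ^ (2 * j - 1))
            * q ^ (j * (j - 1) / 2 + n ^ 2 + 2 * j * n)) T ∧
        sL9 z q = 1 / ((1 + z) * (qPochInf q q * qPochInf z q * qPochInf z⁻¹ q)) * T) ∧
    -- S_{L12}
    ((∀ k : ℤ, z ≠ (q ^ 2) ^ k) → z ≠ -1 →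
      Summable (fun n : ℕ+ => termL12 z q n) ∧
      ∃ T : ℂ, HasSum (fun p : ℕ+ × ℕ =>
          let j : ℕ := p.1
          let n : ℕ := p.2
          zFactor z j * (-1) ^ (j + 1) * (1 + q ^ (2 * j - 1))
            * q ^ (j * (j - 1) + n ^ 2 + 2 * j * n)) T ∧
        sL12 z q = 1 / ((1 + z) * (qPochInf (q ^ 2) (q ^ 2) * qPochInf z (q ^ 2)
          * qPochInf z⁻¹ (q ^ 2))) * T) ∧
    -- F(ρ₁, ρ₂, z; q)
    (∀ ρ₁ ρ₂ : ℂ, ‖q‖ < ‖ρ₁ * ρ₂‖ → (∀ k : ℕ, ρ₁ * q ^ k ≠ 1) → (∀ k : ℕ, ρ₂ * q ^ k ≠ 1) →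
      (∀ k : ℤ, z ≠ q ^ k) → z ≠ -1 →
      Summable (fun n : ℕ+ => termF ρ₁ ρ₂ z q n) ∧
      HasSum (fun p : ℕ+ =>
          let j : ℕ := p
          zFactor z j * (-1) ^ (j + 1) * q ^ (j * (j - 1) / 2)
            * (qPoch ρ₁ q (j - 1) * qPoch ρ₂ q (j - 1))
            * (qPochInf (q ^ (j + 1) / ρ₁) q * qPochInf (q ^ (j + 1) / ρ₂) q)
            / ((1 + z) * ρ₁ ^ (j - 1) * ρ₂ ^ (j - 1)
              * (qPochInf z q * qPochInf z⁻¹ q * qPochInf ρ₁ q * qPochInf ρ₂ q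
                * qPochInf (q / (ρ₁ * ρ₂)) q))
            * (1 - q ^ j / ρ₁ - q ^ j / ρ₂ + q ^ (3 * j - 1) / ρ₁ + q ^ (3 * j - 1) / ρ₂
              - q ^ (4 * j - 2)))
        (genF ρ₁ ρ₂ z q)) ∧
    -- G(ρ₁, ρ₂, z; q)
    (∀ ρ₁ ρ₂ : ℂ, ‖q ^ 2‖ < ‖ρ₁ * ρ₂‖ → (∀ k : ℕ, ρ₁ * q ^ k ≠ 1) →
      (∀ k : ℕ, ρ₂ * q ^ k ≠ 1) → (∀ k : ℤ, z ≠ q ^ k) → z ≠ -1 →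
      Summable (fun n : ℕ+ => termG ρ₁ ρ₂ z q n) ∧
      HasSum (fun p : ℕ+ =>
          let j : ℕ := p
          zFactor z j * (-1) ^ (j + 1) * (1 - q ^ (2 * j - 1)) * q ^ (j * (j + 1) / 2 - 1)
            * (qPoch ρ₁ q (j - 1) * qPoch ρ₂ q (j - 1))
            * (qPochInf (q ^ (j + 1) / ρ₁) q * qPochInf (q ^ (j + 1) / ρ₂) q)
            / ((1 + z) * ρ₁ ^ (j - 1) * ρ₂ ^ (j - 1)
              * (qPochInf z q * qPochInf z⁻¹ q * qPochInf ρ₁ q * qPochInf ρ₂ q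
                * qPochInf (q ^ 2 / (ρ₁ * ρ₂)) q)))
        (genG ρ₁ ρ₂ z q)) ∧
    -- F(ρ, z; q)
    (∀ ρ : ℂ, ρ ≠ 0 → (∀ k : ℕ, ρ * q ^ k ≠ 1) → (∀ k : ℤ, z ≠ q ^ k) →
      Summable (fun n : ℕ+ => termFInf ρ z q n) ∧
      Tendsto (fun ρ₂ => qPochInf ρ₂ q * genF ρ ρ₂ z q)
        (Bornology.cobounded ℂ ⊓ 𝓟 {ρ₂ | ∀ k : ℕ, ρ₂ * q ^ k ≠ 1}) (𝓝 (genFInf ρ z q)) ∧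
      (z ≠ -1 → HasSum (fun p : ℕ+ =>
          let j : ℕ := p
          zFactor z j * q ^ ((j - 1) ^ 2) * qPoch ρ q (j - 1) * qPochInf (q ^ (j + 1) / ρ) q
            / ((1 + z) * ρ ^ (j - 1) * (qPochInf z q * qPochInf z⁻¹ q * qPochInf ρ q))
            * (1 - q ^ j / ρ + q ^ (3 * j - 1) / ρ - q ^ (4 * j - 2)))
        (genFInf ρ z q))) ∧
    -- G(ρ, z; q)
    (∀ ρ : ℂ, ρ ≠ 0 → (∀ k : ℕ, ρ * q ^ k ≠ 1) → (∀ k : ℤ, z ≠ q ^ k) →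
      Summable (fun n : ℕ+ => termGInf ρ z q n) ∧
      Tendsto (fun ρ₂ => qPochInf ρ₂ q * genG ρ ρ₂ z q)
        (Bornology.cobounded ℂ ⊓ 𝓟 {ρ₂ | ∀ k : ℕ, ρ₂ * q ^ k ≠ 1}) (𝓝 (genGInf ρ z q)) ∧
      (z ≠ -1 → HasSum (fun p : ℕ+ =>
          let j : ℕ := p
          zFactor z j * (1 - q ^ (2 * j - 1)) * q ^ (j * (j - 1)) * qPoch ρ q (j - 1)
            * qPochInf (q ^ (j + 1) / ρ) q
            / ((1 + z) * ρ ^ (j - 1) * (qPochInf z q * qPochInf z⁻¹ q * qPochInf ρ q)))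
        (genGInf ρ z q))) ∧
    -- S_{G1}
    ((∀ k : ℤ, z ≠ (q ^ 2) ^ k) → z ≠ -1 →
      ∃ T : ℂ, HasSum (fun p : ℕ+ =>
          let j : ℕ := p
          zFactor z j * (-1) ^ (j + 1) * (1 + q ^ (2 * j - 1)) * q ^ ((j - 1) ^ 2)) T ∧
        sG1 z q = 1 / ((1 + z) * (qPochInf z (q ^ 2) * qPochInf z⁻¹ (q ^ 2)
          * qPochInf q (q ^ 2))) * T) ∧
    -- S_{G2}
    ((∀ k : ℤ, z ≠ q ^ k) → z ≠ -1 →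
      Summable (fun n : ℕ+ => termG2 z q n) ∧
      ∃ T : ℂ, HasSum (fun j : ℤ =>
          zFactor z j * (-1) ^ (j + 1) * q ^ (j * (j - 1) / 2) / (1 + q ^ (2 * j - 1))) T ∧
        sG2 z q = 1 / ((1 + z) * (qPochInf z q * qPochInf z⁻¹ q * qPochInf q q)) * T) ∧
    -- S_{F1}
    ((∀ k : ℤ, z ≠ q ^ k) →
      (z ≠ -1 → ∃ T : ℂ, HasSum (fun j : ℤ =>
          zFactor z j * (-1) ^ (j + 1) * q ^ (j ^ 2 - 3 * j + 2) * (1 + q ^ (j - 1))) T ∧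
        sF1 z q = 1 / ((1 + z) * (qPochInf z q * qPochInf z⁻¹ q)) * T) ∧
      sF1 z q =
        qPochInf (z⁻¹ * q ^ 2) (q ^ 2) * qPochInf (z * q ^ 2) (q ^ 2) * qPochInf (q ^ 2) (q ^ 2)
            / (qPochInf (z * q) q * qPochInf (z⁻¹ * q) q)
          + qPochInf (z⁻¹ * q) (q ^ 2) * qPochInf (z * q) (q ^ 2) * qPochInf (q ^ 2) (q ^ 2)
            / (qPochInf z q * qPochInf z⁻¹ q)
          - qPochInf q (q ^ 2) * qPochInf q (q ^ 2) * qPochInf (q ^ 2) (q ^ 2)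
            / (qPochInf z q * qPochInf z⁻¹ q)) ∧
    -- S_{G3}
    ((∀ k : ℤ, z ≠ q ^ k) → z ≠ -1 →
      ∃ T : ℂ, HasSum (fun p : ℕ+ =>
          let j : ℕ := p
          zFactor z j * (1 - q ^ (2 * j - 1)) * q ^ ((j - 1) ^ 2)) T ∧
        sG3 z q = 1 / ((1 + z) * (qPochInf z q * qPochInf z⁻¹ q)) * T) := by
  exact ⟨fun _ hz1 => sL7_expansion hq0 hq1 hz0 hz1, fun _ hz1 => sL9_expansion hq0 hq1 hz0 hz1,
    fun _ hz1 => sL12_expansion hq0 hq1 hz0 hz1,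
    fun ρ₁ ρ₂ hρ _ _ _ hz1 => genF_expansion hq0 hq1 hz0 ρ₁ ρ₂ hρ hz1,
    fun ρ₁ ρ₂ hρ _ _ _ hz1 => genG_expansion hq0 hq1 hz0 ρ₁ ρ₂ hρ hz1,
    fun ρ hρ _ _ => genFInf_expansion hq0 hq1 hz0 ρ hρ,
    fun ρ hρ _ _ => genGInf_expansion hq0 hq1 hz0 ρ hρ,
    sG1_expansion hq0 hq1 hz0, sG2_expansion hq0 hq1 hz0,
    fun hz => ⟨sF1_expansion hq0 hq1 hz0 hz, sF1_eq_product hq0 hq1 hz0 hz⟩,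
    sG3_expansion hq0 hq1 hz0⟩
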